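/- Let $N\ge 3$, $2^*=\frac{2N}{N-2}$, $k\in\mathbb N$, $h_1,\dots,h_k\in C^1(\mathbb S^{N-1})$, and let $a_1,\dots,a_k\in\mathbb R^N$ be pairwise distinct. Let $\mathcal D^{1,2}(\mathbb R^N)$ be the closure of $C_c^\infty(\mathbb R^N)$ with respect to the norm $\|u\|=\big(\int_{\mathbb R^N}|\nabla u|^2\,dx\big)^{1/2}$ (realized as a space of functions in $L^{2^*}(\mathbb R^N)$ with gradient in $L^2$). For $u\in\mathcal D^{1,2}(\mathbb R^N)$ put $$\mathcal Q(u)=\int_{\mathbb R^N}|\nabla u|^2\,dx-\sum_{i=1}^k\int_{\mathbb R^N}\frac{h_i\big(\frac{x-a_i}{|x-a_i|}\big)}{|x-a_i|^2}\,u^2(x)\,dx ,$$ and define $$S=\inf_{u\ne0}\frac{\|u\|^2}{\|u\|_{L^{2^*}}^2},\qquad S(h)=\inf_{u\neq 0}\frac{\int_{\mathbb R^N}\big[|\nabla u|^2-\frac{h(x/|x|)}{|x|^2}u^2\big]dx}{\big(\int_{\mathbb R^N}|u|^{2^*}dx\big)^{2/2^*}},\qquad S(h_1,\dots,h_k)=\inf_{u\neq0}\frac{\mathcal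 Q(u)}{\big(\int_{\mathbb R^N}|u|^{2^*}dx\big)^{2/2^*}},$$ for $h\in C^1(\mathbb S^{N-1})$, the infima being over $u\in\mathcal D^{1,2}(\mathbb R^N)\setminus\{0\}$. (For $k=1$ the pole of $\mathcal Q$ is $a_1$ and that of $S(h)$ is the origin.) Let $$J(v)=\frac12\mathcal Q(v)-\frac{S(h_1,\dots,h_k)}{2^*}\int_{\mathbb R^N}|v|^{2^*}dx,\qquad v\in\mathcal D^{1,2}(\mathbb R^N).$$ Assume that $\mathcal Q$ is positive definite, i.e. $\inf_{u\ne0}\mathcal Q(u)/\|u\|^2>0$. Let $(u_n)\subset\mathcal D^{1,2}(\mathbb R^N)$ be a Palais–Smale sequence for $J$ at level $c\in\mathbb R$, i.e. $J(u_n)\to c$ and the Fréchet derivatives $J'(u_n)$ tend to $0$ in the dual space of $\mathcal D^{1,2}(\mathbb R^N)$. If $$c<\frac1N\,S(h_1,\dots,h_k)^{1-\frac N2}\Big(\min\big\{S,S(h_1),\dots,S(h_k),S\big(\textstyle\sum_{j=1}^kh_j\big)\big\}\Big)^{N/2},$$ then $(u_n)$ has a subsequence that converges strongly in $\mathcal D^{1,2}(\mathbb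 R^N)$. -/

import Mathlib

open MeasureTheory Filter Topology Metric
open scoped ContDiff Manifold ENNReal NNReal

noncomputable section

namespace MultiSing

/-- The Euclidean space `ℝ^N`. -/
abbrev Eucl (N : ℕ) : Type := EuclideanSpace ℝ (Fin N)

/-- The unit sphere `𝕊^{N-1}` of `ℝ^N`. -/
abbrev Sph (N : ℕ) : Type := sphere (0 : Eucl N) 1

/-- The critical Sobolev exponent `2^* = 2N/(N-2)`. -/
def crit (N : ℕ) : ℝ := 2 * (N : ℝ) / ((N : ℝ) - 2)

/-- The critical Sobolev exponent, as an exponent for Mathlib's `L^p` spaces. -/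
def critE (N : ℕ) : ℝ≥0∞ := ENNReal.ofReal (crit N)

section Space

variable (N : ℕ) [hN : Fact (3 ≤ N)]

/-- The dimension of `ℝ^N` in the form that the manifold structure of the sphere asks for. -/
instance finrank_fact : Fact (Module.finrank ℝ (Eucl N) = (N - 1) + 1) :=
  ⟨by have := hN.out; rw [finrank_euclideanSpace_fin]; omega⟩

theorem crit_inv : (crit N)⁻¹ = 2⁻¹ - (N : ℝ)⁻¹ := by
  have h3 : (3 : ℝ) ≤ N := by exact_mod_cast hN.out
  have h2 : (N : ℝ) - 2 ≠ 0 := by linarith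
  have h0 : (N : ℝ) ≠ 0 := by linarith
  unfold crit
  field_simp

theorem one_le_crit : 1 ≤ crit N := by
  have h3 : (3 : ℝ) ≤ N := by exact_mod_cast hN.out
  unfold crit
  rw [le_div_iff₀ (by linarith)]
  linarith

instance one_le_critE : Fact (1 ≤ critE N) :=
  ⟨by simpa [critE] using one_le_crit N⟩

/-- The pairs `(φ, ∇φ)` with `φ ∈ C_c^∞(ℝ^N)`, inside `L^{2^*}(ℝ^N) × L^2(ℝ^N; ℝ^N)`. -/
def testGraph :
    Submodule ℝ (Lp ℝ (critE N) (volume : Measure (Eucl N)) ×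
      Lp (Eucl N) 2 (volume : Measure (Eucl N))) where
  carrier := {p | ∃ φ : Eucl N → ℝ, ContDiff ℝ ∞ φ ∧ HasCompactSupport φ ∧
    p.1 =ᵐ[volume] φ ∧ p.2 =ᵐ[volume] gradient φ}
  zero_mem' := by
    refine ⟨0, contDiff_const, HasCompactSupport.zero, Lp.coeFn_zero _ _ _, ?_⟩
    filter_upwards [Lp.coeFn_zero (Eucl N) 2 (volume : Measure (Eucl N))] with x hx
    rw [Prod.snd_zero, hx]
    simp [gradient]
  add_mem' := by
    rintro p q ⟨φ, h1, h2, h3, h4⟩ ⟨ψ, g1, g2, g3, g4⟩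
    refine ⟨φ + ψ, h1.add g1, h2.add g2, ?_, ?_⟩
    · exact (Lp.coeFn_add _ _).trans (h3.add g3)
    · filter_upwards [Lp.coeFn_add p.2 q.2, h4, g4] with x hx e1 e2
      rw [Prod.snd_add, hx, Pi.add_apply, e1, e2]
      simp only [gradient]
      rw [fderiv_add (h1.differentiable (by simp) x) (g1.differentiable (by simp) x), map_add]
  smul_mem' := by
    rintro c p ⟨φ, h1, h2, h3, h4⟩
    refine ⟨c • φ, contDiff_const.smul h1, h2.smul_left (f := fun _ => c), ?_, ?_⟩
    · exact (Lp.coeFn_smul _ _).trans (h3.const_smul c)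
    · filter_upwards [Lp.coeFn_smul c p.2, h4] with x hx e1
      rw [Prod.smul_snd, hx, Pi.smul_apply, e1]
      simp only [gradient]
      rw [fderiv_const_smul (h1.differentiable (by simp) x)]
      simp

/-- The closure of `{(φ, ∇φ) : φ ∈ C_c^∞(ℝ^N)}` in `L^{2^*} × L^2`. -/
def d12Sub :
    Submodule ℝ (Lp ℝ (critE N) (volume : Measure (Eucl N)) ×
      Lp (Eucl N) 2 (volume : Measure (Eucl N))) :=
  (testGraph N).topologicalClosure

/-- The space `𝒟^{1,2}(ℝ^N)`: the closure of `C_c^∞(ℝ^N)` with respect to the norm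
`‖∇u‖_{L^2}`. By Sobolev's inequality a sequence of test functions which is Cauchy for this norm
converges in `L^{2^*}`, while its gradients converge in `L^2`; an element of the space is the
limit `u ∈ L^{2^*}` together with its gradient `∇u ∈ L^2`. -/
def D12 : Type := ↥(d12Sub N)

instance : AddCommGroup (D12 N) := inferInstanceAs (AddCommGroup ↥(d12Sub N))

instance : Module ℝ (D12 N) := inferInstanceAs (Module ℝ ↥(d12Sub N))

variable {N}

/-- The function in `L^{2^*}(ℝ^N)` underlying an element of `𝒟^{1,2}(ℝ^N)`. -/
def D12.fn (u : D12 N) : Lp ℝ (critE N) (volume : Measure (Eucl N)) := u.1.1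

/-- The gradient in `L^2(ℝ^N; ℝ^N)` of an element of `𝒟^{1,2}(ℝ^N)`. -/
def D12.grad (u : D12 N) : Lp (Eucl N) 2 (volume : Measure (Eucl N)) := u.1.2

variable (N)

/-- The gradient as a linear map. -/
def gradL : D12 N →ₗ[ℝ] Lp (Eucl N) 2 (volume : Measure (Eucl N)) where
  toFun u := u.grad
  map_add' _ _ := rfl
  map_smul' _ _ := rfl

/-- Sobolev's inequality, with some constant. -/
theorem exists_sobolev : ∃ C : ℝ, ∀ u : D12 N, ‖u.fn‖ ≤ C * ‖u.grad‖ := by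
  have h3 : 3 ≤ N := hN.out
  have hc := one_le_crit N
  refine ⟨SNormLESNormFDerivOfEqConst ℝ (volume : Measure (Eucl N)) 2, fun u => ?_⟩
  have key : ∀ p ∈ d12Sub N,
      ‖p.1‖ ≤ SNormLESNormFDerivOfEqConst ℝ (volume : Measure (Eucl N)) 2 * ‖p.2‖ := by
    intro p hp
    have hcl : IsClosed {p : Lp ℝ (critE N) (volume : Measure (Eucl N)) ×
        Lp (Eucl N) 2 (volume : Measure (Eucl N)) |
        ‖p.1‖ ≤ SNormLESNormFDerivOfEqConst ℝ (volume : Measure (Eucl N)) 2 * ‖p.2‖} :=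
      isClosed_le (by fun_prop) (by fun_prop)
    refine closure_minimal ?_ hcl hp
    rintro ⟨f, g⟩ ⟨φ, h1, h2, hf, hg⟩
    have hs := eLpNorm_le_eLpNorm_fderiv_of_eq (volume : Measure (Eucl N)) (u := φ)
      (p := 2) (p' := (crit N).toNNReal) (h1.of_le (by simp)) h2 (by norm_num)
      (by rw [finrank_euclideanSpace_fin]; omega)
      (by
        rw [finrank_euclideanSpace_fin, Real.coe_toNNReal _ (by linarith), crit_inv N]
        norm_num)
    have e1 : eLpNorm f (critE N) volume = eLpNorm φ (critE N) volume := eLpNorm_congr_ae hf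
    have e2 : eLpNorm g 2 volume = eLpNorm (fderiv ℝ φ) 2 volume := by
      rw [eLpNorm_congr_ae hg]
      refine eLpNorm_congr_norm_ae (Eventually.of_forall fun x => ?_)
      simp [gradient]
    have hs' : eLpNorm f (critE N) volume ≤
        (SNormLESNormFDerivOfEqConst ℝ (volume : Measure (Eucl N)) 2 : ℝ≥0∞) *
          eLpNorm g 2 volume := by
      rw [e1, e2]; exact_mod_cast hs
    have := ENNReal.toReal_mono
      (ENNReal.mul_ne_top ENNReal.coe_ne_top (Lp.eLpNorm_ne_top g)) hs'
    simpa [Lp.norm_def] using this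
  exact key u.1 u.2

theorem gradL_injective : Function.Injective (gradL N) := by
  rw [← LinearMap.ker_eq_bot, LinearMap.ker_eq_bot']
  intro u hu
  obtain ⟨C, hC⟩ := exists_sobolev N
  have hg : u.grad = 0 := hu
  have hf : u.fn = 0 := by
    have := hC u
    rw [hg, norm_zero, mul_zero] at this
    exact norm_le_zero_iff.1 this
  exact Subtype.ext (Prod.ext hf hg)

/-- The norm of `𝒟^{1,2}(ℝ^N)` is `‖u‖ = ‖∇u‖_{L^2}`. -/
instance : NormedAddCommGroup (D12 N) :=
  NormedAddCommGroup.induced (D12 N) (Lp (Eucl N) 2 (volume : Measure (Eucl N)))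
    (gradL N) (gradL_injective N)

instance : NormedSpace ℝ (D12 N) :=
  NormedSpace.induced ℝ (D12 N) (Lp (Eucl N) 2 (volume : Measure (Eucl N))) (gradL N)

end Space

section Functionals

variable {N : ℕ}

/-- The value `h(x/|x|)` of an angular function `h` on `𝕊^{N-1}`, for `x ≠ 0`
(and `0` at the irrelevant point `x = 0`). -/
def angular (h : Sph N → ℝ) (x : Eucl N) : ℝ :=
  open Classical in
  if hx : x = 0 then 0 else h ⟨‖x‖⁻¹ • x, by
    rw [mem_sphere_zero_iff_norm, norm_smul, norm_inv, norm_norm,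
      inv_mul_cancel₀ (norm_ne_zero_iff.2 hx)]⟩

variable [hN : Fact (3 ≤ N)]

/-- `∫ |∇u|^2 dx`. -/
def dirichlet (u : D12 N) : ℝ := ∫ x, ‖u.grad x‖ ^ 2

/-- `∫ h((x-a)/|x-a|) |x-a|^{-2} u(x)^2 dx`. -/
def poleTerm (h : Sph N → ℝ) (a : Eucl N) (u : D12 N) : ℝ :=
  ∫ x, angular h (x - a) / ‖x - a‖ ^ 2 * (u.fn x) ^ 2

/-- `∫ |u|^{2^*} dx`. -/
def critTerm (u : D12 N) : ℝ := ∫ x, |u.fn x| ^ crit N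

/-- The quadratic form `𝒬`. -/
def Q {k : ℕ} (h : Fin k → Sph N → ℝ) (a : Fin k → Eucl N) (u : D12 N) : ℝ :=
  dirichlet u - ∑ i, poleTerm (h i) (a i) u

/-- The number `μ(h_1,…,h_k,a_1,…,a_k)`, the infimum of `𝒬(u)/‖u‖²` over `u ≠ 0`. -/
def mu {k : ℕ} (h : Fin k → Sph N → ℝ) (a : Fin k → Eucl N) : ℝ :=
  ⨅ u : {u : D12 N // u ≠ 0}, Q h a u.1 / ‖u.1‖ ^ 2

/-- The number `S(h_1,…,h_k)`, the infimum of the Rayleigh quotient of `𝒬`. -/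
def SMulti {k : ℕ} (h : Fin k → Sph N → ℝ) (a : Fin k → Eucl N) : ℝ :=
  ⨅ u : {u : D12 N // u ≠ 0}, Q h a u.1 / (critTerm u.1) ^ (2 / crit N)

/-- The one-pole constant `S(h)`, with pole at the origin. -/
def SOne (h : Sph N → ℝ) : ℝ :=
  ⨅ u : {u : D12 N // u ≠ 0},
    (dirichlet u.1 - poleTerm h 0 u.1) / (critTerm u.1) ^ (2 / crit N)

variable (N) in
/-- The best constant `S` in Sobolev's inequality. -/
def SSob : ℝ :=
  ⨅ u : {u : D12 N // u ≠ 0}, ‖u.1‖ ^ 2 / ‖u.1.fn‖ ^ 2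

/-- The energy functional `J`. -/
def J {k : ℕ} (h : Fin k → Sph N → ℝ) (a : Fin k → Eucl N) (v : D12 N) : ℝ :=
  1 / 2 * dirichlet v - 1 / 2 * ∑ i, poleTerm (h i) (a i) v
    - SMulti h a / crit N * critTerm v

/-- `min {S, S(h_1), …, S(h_k), S(h_1 + ⋯ + h_k)}`; the set is finite and non-empty, so that its
infimum is its minimum. -/
def minLevel {k : ℕ} (h : Fin k → Sph N → ℝ) : ℝ :=
  sInf (insert (SSob N) (insert (SOne (∑ j, h j)) (Set.range fun i => SOne (h i))))

/-- `(u_n)` is a Palais–Smale sequence for `J` at level `c`: `J(u_n) → c`, and the Fréchet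
derivatives `J'(u_n)` tend to `0` in the dual space of `𝒟^{1,2}(ℝ^N)`. -/
def IsPalaisSmale {k : ℕ} (h : Fin k → Sph N → ℝ) (a : Fin k → Eucl N)
    (u : ℕ → D12 N) (c : ℝ) : Prop :=
  Tendsto (fun n => J h a (u n)) atTop (𝓝 c) ∧
    Tendsto (fun n => fderiv ℝ (J h a) (u n)) atTop (𝓝 (0 : D12 N →L[ℝ] ℝ))

end Functionals

end MultiSing

end

noncomputable section

namespace MultiSing

section Space

variable {N : ℕ}

/-- A test function: an element of `C_c^∞(ℝ^N)`. -/
structure IsTest (φ : Eucl N → ℝ) : Prop where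
  smooth : ContDiff ℝ ∞ φ
  cpt : HasCompactSupport φ

namespace IsTest

variable {φ ψ : Eucl N → ℝ}

theorem continuous (h : IsTest φ) : Continuous φ := h.smooth.continuous

theorem differentiable (h : IsTest φ) : Differentiable ℝ φ := h.smooth.differentiable (by simp)

theorem continuous_gradient (h : IsTest φ) : Continuous (gradient φ) := by
  have := h.smooth.continuous_fderiv (by simp)
  unfold gradient
  fun_prop

theorem hasCompactSupport_gradient (h : IsTest φ) : HasCompactSupport (gradient φ) := by
  have := h.cpt.fderiv (𝕜 := ℝ)
  exact this.comp_left (g := (InnerProductSpace.toDual ℝ (Eucl N)).symm) (map_zero _)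

theorem memLp (h : IsTest φ) (p : ℝ≥0∞) : MemLp φ p volume :=
  h.continuous.memLp_of_hasCompactSupport h.cpt

theorem memLp_gradient (h : IsTest φ) (p : ℝ≥0∞) : MemLp (gradient φ) p volume :=
  h.continuous_gradient.memLp_of_hasCompactSupport h.hasCompactSupport_gradient

theorem mul_smooth (h : IsTest φ) (hψ : ContDiff ℝ ∞ ψ) : IsTest (fun x => ψ x * φ x) :=
  ⟨hψ.mul h.smooth, h.cpt.mul_left⟩

end IsTest

variable (N) in
theorem critE_ne_top : critE N ≠ ⊤ := ENNReal.ofReal_ne_top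

variable [hN : Fact (3 ≤ N)]

theorem three_le_real : (3 : ℝ) ≤ N := by exact_mod_cast hN.out

variable (N) in
theorem two_lt_crit : 2 < crit N := by
  have h3 : (3 : ℝ) ≤ N := three_le_real
  unfold crit
  rw [lt_div_iff₀ (by linarith)]
  linarith

theorem crit_pos : 0 < crit N := by linarith [two_lt_crit N]

variable (N) in
theorem critE_ne_zero : critE N ≠ 0 := by
  simpa [critE] using crit_pos (N := N)

theorem critE_toReal : (critE N).toReal = crit N :=
  ENNReal.toReal_ofReal crit_pos.le

/-- A test function as an element of `𝒟^{1,2}(ℝ^N)`. -/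
def ofTest {φ : Eucl N → ℝ} (h : IsTest φ) : D12 N :=
  ⟨(MemLp.toLp φ (h.memLp (critE N)), MemLp.toLp (gradient φ) (h.memLp_gradient 2)),
    subset_closure ⟨φ, h.smooth, h.cpt, MemLp.coeFn_toLp (h.memLp (critE N)),
      MemLp.coeFn_toLp (h.memLp_gradient 2)⟩⟩

theorem ofTest_fn {φ : Eucl N → ℝ} (h : IsTest φ) : (ofTest h).fn =ᵐ[volume] φ :=
  MemLp.coeFn_toLp (h.memLp (critE N))

theorem ofTest_grad {φ : Eucl N → ℝ} (h : IsTest φ) :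
    (ofTest h).grad =ᵐ[volume] gradient φ :=
  MemLp.coeFn_toLp (h.memLp_gradient 2)

theorem D12.norm_eq (u : D12 N) : ‖u‖ = ‖u.grad‖ := rfl

theorem D12.tendsto_iff {ι : Type*} {l : Filter ι} {v : ι → D12 N} {u : D12 N} :
    Tendsto v l (𝓝 u) ↔ Tendsto (fun i => (v i).grad) l (𝓝 u.grad) := by
  rw [tendsto_iff_norm_sub_tendsto_zero,
    tendsto_iff_norm_sub_tendsto_zero (f := fun i => (v i).grad)]
  rfl

/-- Closed properties of elements of `𝒟^{1,2}` may be checked on test functions. -/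
theorem D12.induction_test {P : D12 N → Prop} (hc : IsClosed {u | P u})
    (ht : ∀ (φ : Eucl N → ℝ) (h : IsTest φ), P (ofTest h)) (u : D12 N) : P u := by
  have hu : u.1 ∈ closure (testGraph N : Set _) := u.2
  obtain ⟨v, hv, hlim⟩ := mem_closure_iff_seq_limit.1 hu
  let w : ℕ → D12 N := fun n => ⟨v n, subset_closure (hv n)⟩
  have hw : Tendsto w atTop (𝓝 u) :=
    D12.tendsto_iff.2 ((continuous_snd.tendsto _).comp hlim)
  refine hc.mem_of_tendsto hw (Eventually.of_forall fun n => ?_)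
  obtain ⟨φ, h1, h2, h3, h4⟩ := hv n
  have : w n = ofTest ⟨h1, h2⟩ := by
    refine Subtype.ext (Prod.ext (Lp.ext ?_) (Lp.ext ?_))
    · exact h3.trans (ofTest_fn ⟨h1, h2⟩).symm
    · exact h4.trans (ofTest_grad ⟨h1, h2⟩).symm
  rw [Set.mem_ofPred_eq, this]
  exact ht φ ⟨h1, h2⟩

variable (N) in
/-- The underlying function, as a continuous linear map into `L^{2^*}`. -/
def fnL : D12 N →L[ℝ] Lp ℝ (critE N) (volume : Measure (Eucl N)) :=
  LinearMap.mkContinuousOfExistsBound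
    { toFun := fun u => u.fn, map_add' := fun _ _ => rfl, map_smul' := fun _ _ => rfl }
    (exists_sobolev N)

theorem fnL_apply (u : D12 N) : fnL N u = u.fn := rfl

theorem fn_add_ae (u v : D12 N) : (u + v).fn =ᵐ[volume] fun x => u.fn x + v.fn x :=
  Lp.coeFn_add u.fn v.fn

theorem fn_sub_ae (u v : D12 N) : (u - v).fn =ᵐ[volume] fun x => u.fn x - v.fn x :=
  Lp.coeFn_sub u.fn v.fn

theorem fn_smul_ae (c : ℝ) (u : D12 N) : (c • u).fn =ᵐ[volume] fun x => c * u.fn x :=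
  Lp.coeFn_smul c u.fn

theorem fn_memLp (u : D12 N) : MemLp u.fn (critE N) volume := Lp.memLp _

theorem fn_aesm (u : D12 N) : AEStronglyMeasurable (u.fn) volume := Lp.aestronglyMeasurable _

instance : InnerProductSpace ℝ (D12 N) where
  inner u v := inner ℝ u.grad v.grad
  norm_sq_eq_re_inner u := by
    rw [D12.norm_eq, norm_sq_eq_re_inner (𝕜 := ℝ) u.grad]
  conj_inner_symm u v := inner_conj_symm u.grad v.grad
  add_left u v w := inner_add_left u.grad v.grad w.grad
  smul_left u v r := inner_smul_left u.grad v.grad r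

instance : CompleteSpace (D12 N) := by
  refine Metric.complete_of_cauchySeq_tendsto fun v hv => ?_
  have h1 : CauchySeq fun n => (v n).fn := hv.map (fnL N).uniformContinuous
  have h2 : CauchySeq fun n => (v n).grad := by
    have : Isometry (fun u : D12 N => u.grad) := Isometry.of_dist_eq fun u w => by
      rw [dist_eq_norm, dist_eq_norm]; rfl
    exact hv.map this.uniformContinuous
  obtain ⟨f, hf⟩ := cauchySeq_tendsto_of_complete h1
  obtain ⟨g, hg⟩ := cauchySeq_tendsto_of_complete h2
  have hmem : (f, g) ∈ d12Sub N :=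
    (Submodule.isClosed_topologicalClosure (testGraph N)).mem_of_tendsto (hf.prodMk_nhds hg)
      (Eventually.of_forall fun n => (v n).2)
  exact ⟨⟨(f, g), hmem⟩, D12.tendsto_iff.2 hg⟩

instance : SecondCountableTopology (D12 N) := by
  have h : Isometry (fun u : D12 N => u.grad) := Isometry.of_dist_eq fun u w => by
    rw [dist_eq_norm, dist_eq_norm]; rfl
  have : Fact ((2 : ℝ≥0∞) ≠ ⊤) := ⟨by simp⟩
  exact h.isEmbedding.toIsInducing.secondCountableTopology

/-- Bounded sequences of a separable Hilbert space have weakly convergent subsequences. -/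
theorem exists_weak_subseq {H : Type*} [NormedAddCommGroup H] [InnerProductSpace ℝ H]
    [CompleteSpace H] [TopologicalSpace.SeparableSpace H] (v : ℕ → H) (C : ℝ)
    (hv : ∀ n, ‖v n‖ ≤ C) :
    ∃ (s : ℕ → ℕ) (v₀ : H), StrictMono s ∧
      ∀ f : H →L[ℝ] ℝ, Tendsto (fun n => f (v (s n))) atTop (𝓝 (f v₀)) := by
  obtain ⟨L, -, s, hs, hL⟩ := WeakDual.isSeqCompact_closedBall ℝ H (0 : StrongDual ℝ H) C
    (x := fun n => StrongDual.toWeakDual (InnerProductSpace.toDual ℝ H (v n)))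
    (fun n => by simpa using hv n)
  refine ⟨s, (InnerProductSpace.toDual ℝ H).symm (WeakDual.toStrongDual L), hs, fun f => ?_⟩
  have h := ((WeakDual.eval_continuous ((InnerProductSpace.toDual ℝ H).symm f)).tendsto L).comp hL
  have e : ∀ x : H, f x = inner ℝ x ((InnerProductSpace.toDual ℝ H).symm f) := fun x => by
    rw [real_inner_comm, InnerProductSpace.toDual_symm_apply]
  have e2 : f ((InnerProductSpace.toDual ℝ H).symm (WeakDual.toStrongDual L)) =
      L ((InnerProductSpace.toDual ℝ H).symm f) := by
    rw [e, InnerProductSpace.toDual_symm_apply]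
    rfl
  rw [e2]
  refine h.congr fun n => ?_
  rw [e]
  rfl

theorem dirichlet_eq (u : D12 N) : dirichlet u = ‖u‖ ^ 2 := by
  rw [D12.norm_eq, ← real_inner_self_eq_norm_sq, L2.inner_def]
  simp [dirichlet]

theorem norm_rpow_crit (f : Lp ℝ (critE N) (volume : Measure (Eucl N))) :
    ‖f‖ ^ crit N = ∫ x, |f x| ^ crit N := by
  have h := lpNorm_eq_integral_norm_rpow_toReal (critE_ne_zero N) (critE_ne_top N)
    (Lp.aestronglyMeasurable f)
  rw [← toReal_eLpNorm (Lp.aestronglyMeasurable f), ← Lp.norm_def, critE_toReal] at h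
  rw [h, ← Real.rpow_mul (integral_nonneg fun x => by positivity),
    inv_mul_cancel₀ crit_pos.ne', Real.rpow_one]
  simp

theorem critTerm_eq (u : D12 N) : critTerm u = ‖u.fn‖ ^ crit N := (norm_rpow_crit _).symm

theorem critTerm_rpow (u : D12 N) : critTerm u ^ (2 / crit N) = ‖u.fn‖ ^ 2 := by
  rw [critTerm_eq, ← Real.rpow_mul (norm_nonneg _), mul_div_cancel₀ _ crit_pos.ne']
  simp

theorem integrable_rpow_crit (f : Lp ℝ (critE N) (volume : Measure (Eucl N))) :
    Integrable (fun x => |f x| ^ crit N) := by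
  simpa [critE_toReal] using (Lp.memLp f).integrable_norm_rpow (critE_ne_zero N) (critE_ne_top N)

theorem ofTest_norm_sq {φ : Eucl N → ℝ} (h : IsTest φ) :
    ‖ofTest h‖ ^ 2 = ∫ x, ‖gradient φ x‖ ^ 2 := by
  rw [← dirichlet_eq]
  refine integral_congr_ae ?_
  filter_upwards [ofTest_grad h] with x hx
  rw [hx]

instance holderConjugate_critE : ENNReal.HolderConjugate (critE N) (1 - (critE N)⁻¹)⁻¹ :=
  ENNReal.HolderConjugate.inv_one_sub_inv' (one_le_critE N).out

instance one_le_conj_critE : Fact (1 ≤ (1 - (critE N)⁻¹)⁻¹) := ⟨by simp⟩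

/-- Integration of `u` against a function of the dual Lebesgue space. -/
theorem exists_pairing {g : Eucl N → ℝ} (hg : MemLp g (1 - (critE N)⁻¹)⁻¹ volume) :
    ∃ L : D12 N →L[ℝ] ℝ, ∀ u, L u = ∫ x, g x * u.fn x := by
  refine ⟨(((ContinuousLinearMap.mul ℝ ℝ).lpPairing volume (critE N)
    (1 - (critE N)⁻¹)⁻¹).flip (hg.toLp g)).comp (fnL N), fun u => ?_⟩
  simp only [ContinuousLinearMap.comp_apply, ContinuousLinearMap.flip_apply,
    ContinuousLinearMap.lpPairing_eq_integral, fnL_apply]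
  refine integral_congr_ae ?_
  filter_upwards [hg.coeFn_toLp] with x hx
  rw [hx, ContinuousLinearMap.mul_apply', mul_comm]

/-- `D12.grad u` is the weak gradient of `u`. -/
theorem integral_mul_grad {ψ : Eucl N → ℝ} (hψ : IsTest ψ) (e : Eucl N) (u : D12 N) :
    ∫ x, ψ x * inner ℝ e (u.grad x) = - ∫ x, fderiv ℝ ψ x e * u.fn x := by
  have hd : MemLp (fun x => fderiv ℝ ψ x e) (1 - (critE N)⁻¹)⁻¹ volume := by
    refine Continuous.memLp_of_hasCompactSupport ?_ ?_
    · exact (hψ.smooth.continuous_fderiv (by simp)).clm_apply continuous_const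
    · exact (hψ.cpt.fderiv (𝕜 := ℝ)).comp_left (g := fun L : Eucl N →L[ℝ] ℝ => L e) rfl
  obtain ⟨L, hL⟩ := exists_pairing hd
  have hm : MemLp (fun x => ψ x • e) 2 (volume : Measure (Eucl N)) := by
    refine Continuous.memLp_of_hasCompactSupport (by have := hψ.continuous; fun_prop) ?_
    exact hψ.cpt.smul_right (f' := fun _ => e)
  have hR : ∀ u : D12 N, ∫ x, ψ x * inner ℝ e (u.grad x) =
      inner ℝ (hm.toLp _) u.grad := fun u => by
    rw [L2.inner_def]
    refine integral_congr_ae ?_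
    filter_upwards [hm.coeFn_toLp] with x hx
    rw [hx, real_inner_smul_left]
  have hgc : Continuous fun u : D12 N => u.grad :=
    continuous_iff_continuousAt.2 fun u => D12.tendsto_iff.1 tendsto_id
  refine D12.induction_test (P := fun u => ∫ x, ψ x * inner ℝ e (u.grad x) =
    - ∫ x, fderiv ℝ ψ x e * u.fn x) ?_ ?_ u
  · simp only [hR, ← hL]
    exact isClosed_eq (by fun_prop) (by fun_prop)
  · intro φ h
    have e1 : ∫ x, ψ x * inner ℝ e ((ofTest h).grad x) = ∫ x, ψ x * fderiv ℝ φ x e := by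
      refine integral_congr_ae ?_
      filter_upwards [ofTest_grad h] with x hx
      rw [hx, real_inner_comm]
      simp [gradient]
    have e2 : ∫ x, fderiv ℝ ψ x e * (ofTest h).fn x = ∫ x, fderiv ℝ ψ x e * φ x := by
      refine integral_congr_ae ?_
      filter_upwards [ofTest_fn h] with x hx
      rw [hx]
    rw [e1, e2]
    have c1 := (hψ.smooth.continuous_fderiv (by simp)).clm_apply (continuous_const (y := e))
    have c2 := (h.smooth.continuous_fderiv (by simp)).clm_apply (continuous_const (y := e))
    refine integral_mul_fderiv_eq_neg_fderiv_mul_of_integrable ?_ ?_ ?_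
      (fun x _ => hψ.differentiable x) (fun x _ => h.differentiable x)
    · exact (c1.mul h.continuous).integrable_of_hasCompactSupport h.cpt.mul_left
    · exact (hψ.continuous.mul c2).integrable_of_hasCompactSupport hψ.cpt.mul_right
    · exact (hψ.continuous.mul h.continuous).integrable_of_hasCompactSupport hψ.cpt.mul_right

theorem eq_zero_of_fn_eq_zero {u : D12 N} (hu : u.fn = 0) : u = 0 := by
  have hloc : LocallyIntegrable (fun x => u.grad x) (volume : Measure (Eucl N)) :=
    (Lp.memLp u.grad).locallyIntegrable (by norm_num)
  have h0 : ∀ᵐ x ∂(volume : Measure (Eucl N)), u.grad x = 0 := by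
    refine ae_eq_zero_of_integral_contDiff_smul_eq_zero hloc fun ψ h1 h2 => ?_
    have hψ : IsTest ψ := ⟨h1, h2⟩
    refine ext_inner_left ℝ fun e => ?_
    have hInt : Integrable (fun x => ψ x • u.grad x) :=
      hloc.integrable_smul_left_of_hasCompactSupport hψ.continuous h2
    rw [← integral_inner hInt, inner_zero_right]
    simp only [real_inner_smul_right]
    rw [integral_mul_grad hψ, hu, neg_eq_zero]
    refine integral_eq_zero_of_ae ?_
    filter_upwards [Lp.coeFn_zero ℝ (critE N) (volume : Measure (Eucl N))] with x hx
    rw [hx]; simp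
  rw [← norm_eq_zero, D12.norm_eq, norm_eq_zero]
  exact Lp.eq_zero_iff_ae_eq_zero.2 h0

end Space

section HardyInequality

section Hardy

variable {N : ℕ}

theorem fderiv_coord_mul_weight (a : Eucl N) {ε : ℝ} (hε : 0 < ε) (i : Fin N) (x : Eucl N) :
    fderiv ℝ (fun x : Eucl N => (x i - a i) * (‖x - a‖ ^ 2 + ε)⁻¹) x
      (EuclideanSpace.single i 1) =
      (‖x - a‖ ^ 2 + ε)⁻¹ - 2 * (x i - a i) ^ 2 * ((‖x - a‖ ^ 2 + ε)⁻¹) ^ 2 := by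
  have hpos : ‖x - a‖ ^ 2 + ε ≠ 0 := by positivity
  have h1 : HasFDerivAt (fun x : Eucl N => x i - a i) (EuclideanSpace.proj i : Eucl N →L[ℝ] ℝ) x :=
    (EuclideanSpace.proj i : Eucl N →L[ℝ] ℝ).hasFDerivAt.sub_const (a i)
  have h2 : HasFDerivAt (fun x : Eucl N => ‖x - a‖ ^ 2 + ε)
      (2 • (innerSL ℝ (x - a))) x := by
    have := ((hasStrictFDerivAt_norm_sq (x - a)).hasFDerivAt.comp x
      ((hasFDerivAt_id x).sub_const a)).add_const ε
    simpa using this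
  have h3 := h1.fun_mul ((hasDerivAt_inv hpos).comp_hasFDerivAt x h2)
  simp only [Function.comp_def] at h3
  rw [h3.fderiv]
  simp [EuclideanSpace.inner_single_right]
  field_simp
  ring

theorem integral_div_weight (a : Eucl N) {ε : ℝ} (hε : 0 < ε) {φ : Eucl N → ℝ} (h : IsTest φ) :
    ∫ x, (‖x - a‖ ^ 2 + ε)⁻¹ * φ x * fderiv ℝ φ x (x - a) =
      -∫ x, (N / 2 * (‖x - a‖ ^ 2 + ε)⁻¹ - ‖x - a‖ ^ 2 * ((‖x - a‖ ^ 2 + ε)⁻¹) ^ 2)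
        * φ x ^ 2 := by
  have hpos : ∀ x : Eucl N, ‖x - a‖ ^ 2 + ε ≠ 0 := fun x => by positivity
  have cφ := h.continuous
  have cw : Continuous fun x : Eucl N => (‖x - a‖ ^ 2 + ε)⁻¹ :=
    Continuous.inv₀ (by fun_prop) hpos
  have cd := h.smooth.continuous_fderiv (by simp)
  have dsq : ∀ x v, fderiv ℝ (fun x => φ x ^ 2) x v = 2 * φ x * fderiv ℝ φ x v := fun x v => by
    rw [((h.differentiable x).hasFDerivAt.pow 2).fderiv]
    simp
  have hdiff : ∀ i, Differentiable ℝ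
      (fun x : Eucl N => (x i - a i) * (‖x - a‖ ^ 2 + ε)⁻¹) := fun i x => by
    have : DifferentiableAt ℝ (fun x : Eucl N => ‖x - a‖ ^ 2 + ε) x :=
      ((differentiableAt_id.sub_const a).norm_sq ℝ).add_const ε
    exact ((EuclideanSpace.proj i : Eucl N →L[ℝ] ℝ).differentiableAt.sub_const (a i)).mul
      (this.inv (hpos x))
  have sq_cpt : HasCompactSupport fun x => φ x ^ 2 := h.cpt.comp_left (g := (· ^ 2)) (by simp)
  have i1 : ∀ i, Integrable fun x : Eucl N => fderiv ℝ (fun x : Eucl N =>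
      (x i - a i) * (‖x - a‖ ^ 2 + ε)⁻¹) x (EuclideanSpace.single i 1) * φ x ^ 2 := fun i => by
    simp only [fderiv_coord_mul_weight a hε]
    exact Continuous.integrable_of_hasCompactSupport (by fun_prop) sq_cpt.mul_left
  have i2 : ∀ i, Integrable fun x : Eucl N => ((x i - a i) * (‖x - a‖ ^ 2 + ε)⁻¹) *
      fderiv ℝ (fun x => φ x ^ 2) x (EuclideanSpace.single i 1) := fun i => by
    simp only [dsq]
    refine Continuous.integrable_of_hasCompactSupport (by fun_prop) ?_
    exact HasCompactSupport.mul_left (HasCompactSupport.mul_right h.cpt.mul_left)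
  have key : ∀ i, ∫ x : Eucl N, ((x i - a i) * (‖x - a‖ ^ 2 + ε)⁻¹) *
      fderiv ℝ (fun x => φ x ^ 2) x (EuclideanSpace.single i 1) =
      -∫ x : Eucl N, fderiv ℝ (fun x : Eucl N => (x i - a i) * (‖x - a‖ ^ 2 + ε)⁻¹) x
        (EuclideanSpace.single i 1) * φ x ^ 2 := fun i => by
    refine integral_mul_fderiv_eq_neg_fderiv_mul_of_integrable (i1 i) (i2 i) ?_
      (fun x _ => hdiff i x) (fun x _ => (h.differentiable x).pow 2)
    exact Continuous.integrable_of_hasCompactSupport (by fun_prop) sq_cpt.mul_left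
  have hsum := Finset.sum_congr (s₁ := Finset.univ) rfl fun i _ => key i
  rw [Finset.sum_neg_distrib, ← integral_finsetSum _ (fun i _ => i1 i),
    ← integral_finsetSum _ (fun i _ => i2 i)] at hsum
  have e1 : ∀ x : Eucl N, ∑ i, ((x i - a i) * (‖x - a‖ ^ 2 + ε)⁻¹) *
      fderiv ℝ (fun x => φ x ^ 2) x (EuclideanSpace.single i 1) =
      2 * ((‖x - a‖ ^ 2 + ε)⁻¹ * φ x * fderiv ℝ φ x (x - a)) := fun x => by
    have hx : x - a = ∑ i, (x i - a i) • (EuclideanSpace.single i (1 : ℝ) : Eucl N) := by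
      ext j
      simp [Finset.sum_apply, Pi.single_apply]
    conv_rhs => rw [show fderiv ℝ φ x (x - a) =
      ∑ i, (x i - a i) * fderiv ℝ φ x (EuclideanSpace.single i 1) by
        conv_lhs => rw [hx]
        simp [map_sum]]
    rw [Finset.mul_sum, Finset.mul_sum]
    refine Finset.sum_congr rfl fun i _ => ?_
    rw [dsq]; ring
  have e2 : ∀ x : Eucl N, ∑ i, fderiv ℝ (fun x : Eucl N => (x i - a i) *
      (‖x - a‖ ^ 2 + ε)⁻¹) x (EuclideanSpace.single i 1) * φ x ^ 2 =
      2 * ((N / 2 * (‖x - a‖ ^ 2 + ε)⁻¹ - ‖x - a‖ ^ 2 * ((‖x - a‖ ^ 2 + ε)⁻¹) ^ 2)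
        * φ x ^ 2) := fun x => by
    simp only [fderiv_coord_mul_weight a hε]
    rw [← Finset.sum_mul, Finset.sum_sub_distrib, ← Finset.sum_mul, ← Finset.mul_sum]
    have : ‖x - a‖ ^ 2 = ∑ i, (x i - a i) ^ 2 := by
      rw [EuclideanSpace.norm_sq_eq]; simp
    rw [← this]
    simp
    ring
  simp only [e1, e2, integral_const_mul] at hsum
  linarith

theorem aesm_invSq (a : Eucl N) :
    AEStronglyMeasurable (fun x : Eucl N => (‖x - a‖ ^ 2)⁻¹) volume :=
  (Measurable.inv (by fun_prop)).aestronglyMeasurable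

end Hardy

variable {N : ℕ} [hN : Fact (3 ≤ N)]

theorem hardy_test_weight (a : Eucl N) {ε : ℝ} (hε : 0 < ε) {φ : Eucl N → ℝ} (h : IsTest φ) :
    ∫ x, (‖x - a‖ ^ 2 + ε)⁻¹ * φ x ^ 2 ≤ 4 * ‖ofTest h‖ ^ 2 := by
  have hpos : ∀ x : Eucl N, ‖x - a‖ ^ 2 + ε ≠ 0 := fun x => by positivity
  have cφ := h.continuous
  have cg := h.continuous_gradient
  have cw : Continuous fun x : Eucl N => (‖x - a‖ ^ 2 + ε)⁻¹ :=
    Continuous.inv₀ (by fun_prop) hpos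
  have cd := h.smooth.continuous_fderiv (by simp)
  have sq_cpt : HasCompactSupport fun x => φ x ^ 2 := h.cpt.comp_left (g := (· ^ 2)) (by simp)
  have i0 : Integrable fun x : Eucl N => (‖x - a‖ ^ 2 + ε)⁻¹ * φ x ^ 2 :=
    Continuous.integrable_of_hasCompactSupport (by fun_prop) sq_cpt.mul_left
  have i1 : Integrable fun x => (N / 2 * (‖x - a‖ ^ 2 + ε)⁻¹ -
      ‖x - a‖ ^ 2 * ((‖x - a‖ ^ 2 + ε)⁻¹) ^ 2) * φ x ^ 2 :=
    Continuous.integrable_of_hasCompactSupport (by fun_prop) sq_cpt.mul_left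
  have i2 : Integrable fun x => (‖x - a‖ ^ 2 + ε)⁻¹ * φ x * fderiv ℝ φ x (x - a) :=
    Continuous.integrable_of_hasCompactSupport (by fun_prop)
      (HasCompactSupport.mul_right h.cpt.mul_left)
  have i3 : Integrable fun x => ‖gradient φ x‖ ^ 2 :=
    Continuous.integrable_of_hasCompactSupport (by fun_prop)
      (h.hasCompactSupport_gradient.norm.comp_left (g := (· ^ 2)) (by simp))
  have hdw := integral_div_weight a hε h
  have key : ∀ x, (‖x - a‖ ^ 2 + ε)⁻¹ * φ x ^ 2 ≤ 4 * (‖gradient φ x‖ ^ 2 +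
      ((‖x - a‖ ^ 2 + ε)⁻¹ * φ x * fderiv ℝ φ x (x - a) +
      (N / 2 * (‖x - a‖ ^ 2 + ε)⁻¹ - ‖x - a‖ ^ 2 * ((‖x - a‖ ^ 2 + ε)⁻¹) ^ 2) * φ x ^ 2)) := by
    intro x
    have hin : fderiv ℝ φ x (x - a) = inner ℝ (gradient φ x) (x - a) := by simp [gradient]
    have hsq := sq_nonneg ‖gradient φ x + (1 / 2 * (‖x - a‖ ^ 2 + ε)⁻¹ * φ x) • (x - a)‖
    rw [norm_add_sq_real, norm_smul, real_inner_smul_right, mul_pow, Real.norm_eq_abs, sq_abs,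
      ← hin] at hsq
    set w := (‖x - a‖ ^ 2 + ε)⁻¹ with hw
    have hw0 : 0 ≤ w := by positivity
    have hw1 : ‖x - a‖ ^ 2 * w ≤ 1 := by
      rw [hw, ← div_eq_mul_inv, div_le_one (by positivity)]; linarith
    have h3 : (3 : ℝ) ≤ N := three_le_real
    have hA : w / 4 ≤ N / 2 * w - 5 / 4 * (‖x - a‖ ^ 2 * w ^ 2) := by
      have : ‖x - a‖ ^ 2 * w ^ 2 ≤ w := by
        calc ‖x - a‖ ^ 2 * w ^ 2 = (‖x - a‖ ^ 2 * w) * w := by ring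
          _ ≤ 1 * w := by gcongr
          _ = w := one_mul w
      have : 3 / 2 * w ≤ N / 2 * w := by gcongr
      linarith
    have hB := mul_le_mul_of_nonneg_right hA (sq_nonneg (φ x))
    nlinarith [hB, hsq]
  have := integral_mono i0 ((i3.add (i2.add i1)).const_mul 4) key
  refine this.trans (le_of_eq ?_)
  rw [integral_const_mul]
  congr 1
  calc _ = (∫ x, ‖gradient φ x‖ ^ 2) + ∫ x, ((‖x - a‖ ^ 2 + ε)⁻¹ * φ x * fderiv ℝ φ x (x - a) +
      (N / 2 * (‖x - a‖ ^ 2 + ε)⁻¹ - ‖x - a‖ ^ 2 * ((‖x - a‖ ^ 2 + ε)⁻¹) ^ 2) * φ x ^ 2) :=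
        integral_add i3 (i2.add i1)
    _ = _ := by rw [integral_add i2 i1, hdw, ofTest_norm_sq]; ring

theorem hardy_test (a : Eucl N) {φ : Eucl N → ℝ} (h : IsTest φ) :
    ∫⁻ x, ENNReal.ofReal ((‖x - a‖ ^ 2)⁻¹ * φ x ^ 2) ≤ ENNReal.ofReal (4 * ‖ofTest h‖ ^ 2) := by
  have cφ := h.continuous
  have sq_cpt : HasCompactSupport fun x => φ x ^ 2 := h.cpt.comp_left (g := (· ^ 2)) (by simp)
  have hε : ∀ n : ℕ, (0 : ℝ) < 1 / ((n : ℝ) + 1) := fun n => by positivity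
  have cw : ∀ n : ℕ, Continuous fun x : Eucl N => (‖x - a‖ ^ 2 + 1 / ((n : ℝ) + 1))⁻¹ :=
    fun n => Continuous.inv₀ (by fun_prop) fun x => by positivity
  have hlim : ∀ᵐ x : Eucl N, ENNReal.ofReal ((‖x - a‖ ^ 2)⁻¹ * φ x ^ 2) =
      liminf (fun n : ℕ => ENNReal.ofReal ((‖x - a‖ ^ 2 + 1 / ((n : ℝ) + 1))⁻¹ * φ x ^ 2))
        atTop := by
    have : Nontrivial (Eucl N) := by
      have := hN.out
      have : Nontrivial (Fin N) := Fin.nontrivial_iff_two_le.2 (by omega)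
      infer_instance
    filter_upwards [compl_mem_ae_iff.2 (measure_singleton a)] with x hx
    have hxa : ‖x - a‖ ^ 2 ≠ 0 := by
      have : x - a ≠ 0 := sub_ne_zero.2 (by simpa using hx)
      positivity
    refine (Tendsto.liminf_eq ?_).symm
    refine (ENNReal.continuous_ofReal.tendsto _).comp (Tendsto.mul_const _ (Tendsto.inv₀ ?_ hxa))
    simpa using tendsto_one_div_add_atTop_nhds_zero_nat.const_add (‖x - a‖ ^ 2)
  rw [lintegral_congr_ae hlim]
  refine (lintegral_liminf_le fun n => ?_).trans ?_
  · have := cw n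
    exact ENNReal.measurable_ofReal.comp (by fun_prop : Continuous _).measurable
  · refine liminf_le_of_le (by isBoundedDefault) fun b hb => ?_
    obtain ⟨n, hn⟩ := hb.exists
    refine hn.trans ?_
    have := cw n
    rw [← ofReal_integral_eq_lintegral_ofReal]
    · exact ENNReal.ofReal_le_ofReal (hardy_test_weight a (hε n) h)
    · exact Continuous.integrable_of_hasCompactSupport (by fun_prop) sq_cpt.mul_left
    · exact Eventually.of_forall fun x => by
        have : (0 : ℝ) < (n : ℝ) + 1 := by positivity
        positivity

/-- Weighted `L²` bounds pass from test functions to `𝒟^{1,2}`. -/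
theorem lintegral_bound_of_test {W : Eucl N → ℝ} (hW : AEStronglyMeasurable W volume) {C : ℝ}
    (h : ∀ (φ : Eucl N → ℝ) (hφ : IsTest φ),
      ∫⁻ x, ENNReal.ofReal (W x * φ x ^ 2) ≤ ENNReal.ofReal (C * ‖ofTest hφ‖ ^ 2))
    (u : D12 N) :
    ∫⁻ x, ENNReal.ofReal (W x * u.fn x ^ 2) ≤ ENNReal.ofReal (C * ‖u‖ ^ 2) := by
  refine D12.induction_test (P := fun u => ∫⁻ x, ENNReal.ofReal (W x * u.fn x ^ 2) ≤
    ENNReal.ofReal (C * ‖u‖ ^ 2)) (IsSeqClosed.isClosed ?_) ?_ u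
  · intro v u hv hlim
    have h1 : Tendsto (fun n => (v n).fn) atTop (𝓝 u.fn) := ((fnL N).continuous.tendsto u).comp hlim
    obtain ⟨s, hs, hae⟩ := (tendstoInMeasure_of_tendsto_Lp h1).exists_seq_tendsto_ae
    have hlim' : ∀ᵐ x, ENNReal.ofReal (W x * u.fn x ^ 2) =
        liminf (fun n => ENNReal.ofReal (W x * (v (s n)).fn x ^ 2)) atTop := by
      filter_upwards [hae] with x hx
      exact (Tendsto.liminf_eq ((ENNReal.continuous_ofReal.tendsto _).comp
        ((hx.pow 2).const_mul (W x)))).symm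
    rw [Set.mem_ofPred_eq, lintegral_congr_ae hlim']
    refine (lintegral_liminf_le' fun n => ?_).trans ?_
    · exact (hW.mul ((fn_aesm _).pow 2)).aemeasurable.ennreal_ofReal
    · have ht : Tendsto (fun n => ENNReal.ofReal (C * ‖v (s n)‖ ^ 2)) atTop
          (𝓝 (ENNReal.ofReal (C * ‖u‖ ^ 2))) :=
        (ENNReal.continuous_ofReal.tendsto _).comp
          (((hlim.comp hs.tendsto_atTop).norm.pow 2).const_mul C)
      rw [← ht.liminf_eq]
      exact liminf_le_liminf (Eventually.of_forall fun n => hv (s n))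
  · intro φ hφ
    refine le_trans (le_of_eq (lintegral_congr_ae ?_)) (h φ hφ)
    filter_upwards [ofTest_fn hφ] with x hx
    rw [hx]

/-- Potentials `V` whose quadratic form is bounded on `𝒟^{1,2}`. -/
structure HardyPot (V : Eucl N → ℝ) : Prop where
  aesm : AEStronglyMeasurable V volume
  bound : ∃ C : ℝ, 0 ≤ C ∧ ∀ u : D12 N,
    ∫⁻ x, ENNReal.ofReal (|V x| * u.fn x ^ 2) ≤ ENNReal.ofReal (C * ‖u‖ ^ 2)

/-- **Hardy's inequality.** -/
theorem hardyPot_invSq (a : Eucl N) : HardyPot (fun x : Eucl N => (‖x - a‖ ^ 2)⁻¹) where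
  aesm := aesm_invSq a
  bound := by
    refine ⟨4, by norm_num, fun u => ?_⟩
    simp only [abs_inv, abs_pow, abs_norm]
    exact lintegral_bound_of_test (aesm_invSq a) (fun φ hφ => hardy_test a hφ) u

namespace HardyPot

variable {V W : Eucl N → ℝ}

theorem mono (hW : HardyPot W) (hV : AEStronglyMeasurable V volume) {M : ℝ}
    (h : ∀ᵐ x, |V x| ≤ M * |W x|) : HardyPot V := by
  refine ⟨hV, ?_⟩
  obtain ⟨C, hC, hb⟩ := hW.bound
  refine ⟨|M| * C, by positivity, fun u => ?_⟩
  calc ∫⁻ x, ENNReal.ofReal (|V x| * u.fn x ^ 2)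
      ≤ ∫⁻ x, ENNReal.ofReal |M| * ENNReal.ofReal (|W x| * u.fn x ^ 2) := by
        refine lintegral_mono_ae ?_
        filter_upwards [h] with x hx
        rw [← ENNReal.ofReal_mul (abs_nonneg M)]
        refine ENNReal.ofReal_le_ofReal ?_
        rw [← mul_assoc]
        gcongr
        exact hx.trans (by gcongr; exact le_abs_self M)
    _ = ENNReal.ofReal |M| * ∫⁻ x, ENNReal.ofReal (|W x| * u.fn x ^ 2) :=
        lintegral_const_mul' _ _ ENNReal.ofReal_ne_top
    _ ≤ ENNReal.ofReal |M| * ENNReal.ofReal (C * ‖u‖ ^ 2) := by gcongr; exact hb u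
    _ = _ := by rw [← ENNReal.ofReal_mul (abs_nonneg M), mul_assoc]

theorem add (hV : HardyPot V) (hW : HardyPot W) : HardyPot (fun x => V x + W x) := by
  refine ⟨hV.aesm.add hW.aesm, ?_⟩
  obtain ⟨C, hC, hb⟩ := hV.bound
  obtain ⟨D, hD, hb'⟩ := hW.bound
  refine ⟨C + D, by positivity, fun u => ?_⟩
  calc ∫⁻ x, ENNReal.ofReal (|V x + W x| * u.fn x ^ 2)
      ≤ ∫⁻ x, (ENNReal.ofReal (|V x| * u.fn x ^ 2) + ENNReal.ofReal (|W x| * u.fn x ^ 2)) := by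
        refine lintegral_mono fun x => ?_
        rw [← ENNReal.ofReal_add (by positivity) (by positivity), ← add_mul]
        gcongr
        exact abs_add_le _ _
    _ = (∫⁻ x, ENNReal.ofReal (|V x| * u.fn x ^ 2)) +
        ∫⁻ x, ENNReal.ofReal (|W x| * u.fn x ^ 2) :=
        lintegral_add_left' ((hV.aesm.norm.mul ((fn_aesm _).pow 2)).aemeasurable.ennreal_ofReal) _
    _ ≤ ENNReal.ofReal (C * ‖u‖ ^ 2) + ENNReal.ofReal (D * ‖u‖ ^ 2) := add_le_add (hb u) (hb' u)
    _ = _ := by rw [← ENNReal.ofReal_add (by positivity) (by positivity), add_mul]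

theorem zero : HardyPot (fun _ : Eucl N => (0 : ℝ)) :=
  ⟨aestronglyMeasurable_const, 0, le_rfl, fun u => by simp⟩

theorem sum {ι : Type*} (s : Finset ι) {V : ι → Eucl N → ℝ} (h : ∀ i ∈ s, HardyPot (V i)) :
    HardyPot (fun x => ∑ i ∈ s, V i x) := by
  classical
  induction s using Finset.induction_on with
  | empty => simpa using zero
  | insert i s hi ih =>
    simp only [Finset.sum_insert hi]
    exact (h i (Finset.mem_insert_self i s)).add
      (ih fun j hj => h j (Finset.mem_insert_of_mem hj))

theorem const_mul (hV : HardyPot V) (c : ℝ) : HardyPot (fun x => c * V x) :=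
  hV.mono (hV.aesm.const_mul c) (M := |c|) (Eventually.of_forall fun x => by rw [abs_mul])

theorem indicator (hV : HardyPot V) {s : Set (Eucl N)} (hs : MeasurableSet s) :
    HardyPot (s.indicator V) :=
  hV.mono (hV.aesm.indicator hs) (M := 1) (Eventually.of_forall fun x => by
    by_cases hx : x ∈ s <;> simp [hx])

theorem integrable_sq (hV : HardyPot V) (u : D12 N) :
    Integrable (fun x => |V x| * u.fn x ^ 2) := by
  obtain ⟨C, hC, hb⟩ := hV.bound
  refine ⟨hV.aesm.norm.mul ((fn_aesm _).pow 2), ?_⟩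
  rw [hasFiniteIntegral_iff_ofReal (Eventually.of_forall fun x => by positivity)]
  exact (hb u).trans_lt ENNReal.ofReal_lt_top

theorem integral_sq_le (hV : HardyPot V) :
    ∃ C : ℝ, 0 ≤ C ∧ ∀ u : D12 N, ∫ x, |V x| * u.fn x ^ 2 ≤ C * ‖u‖ ^ 2 := by
  obtain ⟨C, hC, hb⟩ := hV.bound
  refine ⟨C, hC, fun u => ?_⟩
  rw [← ENNReal.ofReal_le_ofReal_iff (by positivity),
    ofReal_integral_eq_lintegral_ofReal (hV.integrable_sq u)
      (Eventually.of_forall fun x => by positivity)]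
  exact hb u

theorem integrable_mul (hV : HardyPot V) (u v : D12 N) :
    Integrable (fun x => V x * (u.fn x * v.fn x)) := by
  refine ((hV.integrable_sq u).add (hV.integrable_sq v)).mono'
    (hV.aesm.mul ((fn_aesm _).mul (fn_aesm _))) (Eventually.of_forall fun x => ?_)
  rw [Real.norm_eq_abs, abs_mul, Pi.add_apply, ← mul_add]
  gcongr
  rw [abs_le]
  constructor <;> nlinarith [sq_nonneg (u.fn x + v.fn x), sq_nonneg (u.fn x - v.fn x),
    sq_nonneg (u.fn x), sq_nonneg (v.fn x)]

/-- Continuity of the bilinear form `∫ V u v`, in the form of an existence statement. -/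
theorem exists_bilin (hV : HardyPot V) : ∃ B : D12 N →L[ℝ] D12 N →L[ℝ] ℝ,
    ∀ u v, B u v = ∫ x, V x * (u.fn x * v.fn x) := by
  obtain ⟨C, hC, hb⟩ := hV.integral_sq_le
  let B₀ : D12 N →ₗ[ℝ] D12 N →ₗ[ℝ] ℝ := LinearMap.mk₂ ℝ
    (fun u v => ∫ x, V x * (u.fn x * v.fn x))
    (fun u u' v => by
      rw [← integral_add (hV.integrable_mul u v) (hV.integrable_mul u' v)]
      refine integral_congr_ae ?_
      filter_upwards [fn_add_ae u u'] with x hx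
      rw [hx]; ring)
    (fun c u v => by
      rw [smul_eq_mul, ← integral_const_mul]
      refine integral_congr_ae ?_
      filter_upwards [fn_smul_ae c u] with x hx
      rw [hx]; ring)
    (fun u v v' => by
      rw [← integral_add (hV.integrable_mul u v) (hV.integrable_mul u v')]
      refine integral_congr_ae ?_
      filter_upwards [fn_add_ae v v'] with x hx
      rw [hx]; ring)
    (fun c u v => by
      rw [smul_eq_mul, ← integral_const_mul]
      refine integral_congr_ae ?_
      filter_upwards [fn_smul_ae c v] with x hx
      rw [hx]; ring)
  have hB₀ : ∀ u v, B₀ u v = ∫ x, V x * (u.fn x * v.fn x) := fun u v => rfl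
  have hsum : ∀ u v, |B₀ u v| ≤ C * (‖u‖ ^ 2 + ‖v‖ ^ 2) := fun u v => by
    rw [hB₀]
    refine (abs_integral_le_integral_abs).trans ?_
    have : ∫ x, |V x * (u.fn x * v.fn x)| ≤
        ∫ x, (|V x| * u.fn x ^ 2 + |V x| * v.fn x ^ 2) := by
      refine integral_mono (hV.integrable_mul u v).abs
        ((hV.integrable_sq u).add (hV.integrable_sq v)) fun x => ?_
      simp only
      rw [abs_mul, ← mul_add]
      gcongr
      rw [abs_le]
      constructor <;> nlinarith [sq_nonneg (u.fn x + v.fn x), sq_nonneg (u.fn x - v.fn x),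
        sq_nonneg (u.fn x), sq_nonneg (v.fn x)]
    rw [integral_add (hV.integrable_sq u) (hV.integrable_sq v)] at this
    linarith [hb u, hb v]
  refine ⟨B₀.mkContinuous₂ (2 * C) fun u v => ?_, fun u v => rfl⟩
  rw [Real.norm_eq_abs]
  by_cases hu : u = 0
  · simp [hu]
  by_cases hv : v = 0
  · simp [hv]
  have hu' : ‖u‖ ≠ 0 := norm_ne_zero_iff.2 hu
  have hv' : ‖v‖ ≠ 0 := norm_ne_zero_iff.2 hv
  have := hsum ((‖u‖)⁻¹ • u) ((‖v‖)⁻¹ • v)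
  rw [map_smul, map_smul, LinearMap.smul_apply, norm_smul, norm_smul, norm_inv, norm_inv,
    norm_norm, norm_norm, inv_mul_cancel₀ hu', inv_mul_cancel₀ hv', smul_eq_mul, smul_eq_mul,
    abs_mul, abs_mul, abs_inv, abs_inv, abs_norm, abs_norm] at this
  have hm := mul_le_mul_of_nonneg_left this (by positivity : 0 ≤ ‖u‖ * ‖v‖)
  have e : ‖u‖ * ‖v‖ * (‖v‖⁻¹ * (‖u‖⁻¹ * |B₀ u v|)) = |B₀ u v| := by field_simp
  rw [e] at hm
  calc |B₀ u v| ≤ _ := hm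
    _ = _ := by ring

end HardyPot

end HardyInequality

section CriticalTerm

/-- The function `t ↦ |t|^{p-2} t`. -/
def dualPow (p t : ℝ) : ℝ := |t| ^ (p - 2) * t

section Scalar

variable {p : ℝ}

theorem dualPow_neg (t : ℝ) : dualPow p (-t) = -dualPow p t := by simp [dualPow]

theorem dualPow_mul_self (hp : 2 < p) (t : ℝ) : dualPow p t * t = |t| ^ p := by
  rcases eq_or_ne t 0 with rfl | ht
  · simp [dualPow, Real.zero_rpow (by linarith : p ≠ 0)]
  · have h0 : 0 < |t| := abs_pos.2 ht
    rw [dualPow, mul_assoc, ← abs_mul_abs_self t, ← pow_two, ← Real.rpow_natCast,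
      ← Real.rpow_add h0]
    norm_num

theorem dualPow_sub_le_of_nonneg (hp : 2 < p) {x y : ℝ} (hy : 0 ≤ y) (hyx : y ≤ x) :
    |dualPow p x - dualPow p y| ≤ (p - 1) * (|x| + |y|) ^ (p - 2) * |x - y| := by
  have hx : 0 ≤ x := hy.trans hyx
  rcases hx.eq_or_lt with rfl | hx0
  · have : y = 0 := le_antisymm hyx hy
    simp [this]
  have hpw : ∀ t : ℝ, 0 ≤ t → dualPow p t = t ^ (p - 1) := fun t ht => by
    rcases ht.eq_or_lt with rfl | ht
    · simp [dualPow, Real.zero_rpow (by linarith : p - 1 ≠ 0)]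
    · rw [dualPow, abs_of_pos ht, ← Real.rpow_add_one ht.ne']; congr 1; ring
  have hmono : y ^ (p - 1) ≤ x ^ (p - 1) := Real.rpow_le_rpow hy hyx (by linarith)
  rw [hpw x hx, hpw y hy, abs_of_nonneg (by linarith), abs_of_nonneg hx, abs_of_nonneg hy,
    abs_of_nonneg (by linarith : 0 ≤ x - y)]
  have hb := one_add_mul_self_le_rpow_one_add (s := y / x - 1)
    (by have : 0 ≤ y / x := by positivity
        linarith) (p := p - 1) (by linarith)
  rw [add_sub_cancel, Real.div_rpow hy hx, le_div_iff₀ (by positivity)] at hb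
  have e : x ^ (p - 1) = x ^ (p - 2) * x := by
    rw [← Real.rpow_add_one hx0.ne']; congr 1; ring
  have h1 : x ^ (p - 1) - y ^ (p - 1) ≤ (p - 1) * x ^ (p - 2) * (x - y) := by
    have : (1 + (p - 1) * (y / x - 1)) * x ^ (p - 1) =
        x ^ (p - 1) - (p - 1) * x ^ (p - 2) * (x - y) := by
      rw [e]; field_simp; ring
    linarith
  refine h1.trans ?_
  gcongr
  · linarith
  · linarith

theorem dualPow_sub_le_of_nonneg_nonpos (hp : 2 < p) {x y : ℝ} (hx : 0 ≤ x) (hy : y ≤ 0) :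
    |dualPow p x - dualPow p y| ≤ (p - 1) * (|x| + |y|) ^ (p - 2) * |x - y| := by
  have h1 : 0 ≤ dualPow p x := by unfold dualPow; positivity
  have h2 : dualPow p y ≤ 0 := mul_nonpos_of_nonneg_of_nonpos (by positivity) hy
  rw [abs_of_nonneg (by linarith), abs_of_nonneg (by linarith : 0 ≤ x - y)]
  have h3 : dualPow p x ≤ (|x| + |y|) ^ (p - 2) * x := by
    unfold dualPow
    gcongr
    linarith [abs_nonneg y]
  have h4 : -dualPow p y ≤ (|x| + |y|) ^ (p - 2) * (-y) := by
    unfold dualPow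
    rw [← mul_neg]
    gcongr
    · linarith
    · linarith [abs_nonneg x]
  have h5 : 0 ≤ (|x| + |y|) ^ (p - 2) * (x - y) := mul_nonneg (by positivity) (by linarith)
  nlinarith

theorem dualPow_sub_le (hp : 2 < p) (x y : ℝ) :
    |dualPow p x - dualPow p y| ≤ (p - 1) * (|x| + |y|) ^ (p - 2) * |x - y| := by
  wlog hyx : y ≤ x generalizing x y
  · have := this y x (le_of_not_ge hyx)
    rwa [abs_sub_comm, abs_sub_comm x y, add_comm |x|]
  rcases le_total 0 y with hy | hy
  · exact dualPow_sub_le_of_nonneg hp hy hyx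
  rcases le_total 0 x with hx | hx
  · exact dualPow_sub_le_of_nonneg_nonpos hp hx hy
  have := dualPow_sub_le_of_nonneg hp (x := -y) (y := -x) (by linarith) (by linarith)
  rw [dualPow_neg, dualPow_neg, abs_neg, abs_neg] at this
  rw [show dualPow p x - dualPow p y = -dualPow p y - -dualPow p x by ring, add_comm |x|,
    show x - y = -y - -x by ring]
  exact this

theorem abs_rpow_taylor (hp : 2 < p) (a b : ℝ) :
    |(|a + b| ^ p - |a| ^ p - p * (dualPow p a * b))| ≤
      p * (p - 1) * ((2 * |a| + |b|) ^ (p - 2) * |b| * |b|) := by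
  have hd : ∀ t, HasDerivAt (fun t : ℝ => |t| ^ p - p * (dualPow p a * (t - a)))
      (p * (dualPow p t - dualPow p a)) t := fun t => by
    have h1 := hasDerivAt_abs_rpow t (by linarith : 1 < p)
    have h2 : HasDerivAt (fun t => p * (dualPow p a * (t - a))) (p * (dualPow p a * 1)) t :=
      (((hasDerivAt_id t).sub_const a).const_mul _).const_mul _
    refine (h1.sub h2).congr_deriv ?_
    unfold dualPow
    ring
  have hbd : ∀ t ∈ Set.uIcc a (a + b), ‖p * (dualPow p t - dualPow p a)‖ ≤
      p * (p - 1) * ((2 * |a| + |b|) ^ (p - 2) * |b|) := fun t ht => by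
    have hta : |t - a| ≤ |b| := by
      have := Set.abs_sub_left_of_mem_uIcc ht
      simpa using this
    have ht' : |t| ≤ |a| + |b| := by
      have := abs_add_le (t - a) a
      rw [sub_add_cancel] at this
      linarith
    rw [norm_mul, Real.norm_eq_abs, Real.norm_eq_abs, abs_of_pos (by linarith : 0 < p), mul_assoc]
    refine mul_le_mul_of_nonneg_left ?_ (by linarith)
    refine (dualPow_sub_le hp t a).trans ?_
    have hle : (|t| + |a|) ^ (p - 2) ≤ (2 * |a| + |b|) ^ (p - 2) :=
      Real.rpow_le_rpow (by positivity) (by linarith) (by linarith)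
    rw [mul_assoc]
    refine mul_le_mul_of_nonneg_left ?_ (by linarith)
    exact mul_le_mul hle hta (abs_nonneg _) (by positivity)
  have := (convex_uIcc a (a + b)).norm_image_sub_le_of_norm_hasDerivWithin_le
    (fun t ht => (hd t).hasDerivWithinAt) hbd Set.left_mem_uIcc Set.right_mem_uIcc
  rw [Real.norm_eq_abs, Real.norm_eq_abs] at this
  simp only [add_sub_cancel_left, sub_self, mul_zero, sub_zero] at this
  calc _ = |(|a + b| ^ p - p * (dualPow p a * b) - |a| ^ p)| := by congr 1; ring
    _ ≤ _ := this
    _ = _ := by ring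

theorem rpow_mul_mul_le (hp : 2 < p) {F G H : ℝ} (hF : 0 ≤ F) (hG : 0 ≤ G) (hH : 0 ≤ H) :
    F ^ (p - 2) * G * H ≤ F ^ p + G ^ p + H ^ p := by
  set m := max F (max G H) with hm
  have h1 : F ≤ m := le_max_left _ _
  have h2 : G ≤ m := (le_max_left _ _).trans (le_max_right _ _)
  have h3 : H ≤ m := (le_max_right _ _).trans (le_max_right _ _)
  have hm0 : 0 ≤ m := hF.trans h1
  have e : m ^ (p - 2) * m * m = m ^ p := by
    rcases hm0.eq_or_lt with h | h
    · rw [← h]; simp [Real.zero_rpow (by linarith : p ≠ 0)]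
    · rw [← Real.rpow_add_one h.ne', ← Real.rpow_add_one h.ne']; congr 1; ring
  have hle : F ^ (p - 2) * G * H ≤ m ^ p := by
    rw [← e]
    gcongr
  have a1 : 0 ≤ F ^ p := by positivity
  have a2 : 0 ≤ G ^ p := by positivity
  have a3 : 0 ≤ H ^ p := by positivity
  refine hle.trans ?_
  rcases max_choice F (max G H) with h | h
  · rw [hm, h]; linarith
  · rcases max_choice G H with h' | h'
    · rw [hm, h, h']; linarith
    · rw [hm, h, h']; linarith

theorem exists_rpow_mul_le (hp : 2 < p) {δ : ℝ} (hδ : 0 < δ) :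
    ∃ C : ℝ, 0 ≤ C ∧ ∀ F w : ℝ, 0 ≤ F → 0 ≤ w →
      F ^ (p - 2) * w ≤ δ * F ^ p + δ * (1 + w ^ p) + C * w ^ 2 := by
  set T : ℝ := 1 + δ⁻¹ with hT
  have hT1 : 1 ≤ T := by rw [hT]; linarith [inv_pos.2 hδ]
  have hTδ : 1 ≤ δ * T := by
    rw [hT, mul_add, mul_inv_cancel₀ hδ.ne']; linarith
  have split1 : ∀ t : ℝ, 0 ≤ t → t ^ p = t ^ (p - 2) * t ^ 2 := fun t ht => by
    rcases ht.eq_or_lt with rfl | h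
    · simp [Real.zero_rpow (by linarith : p ≠ 0)]
    · rw [← Real.rpow_natCast, ← Real.rpow_add h]; norm_num
  refine ⟨T ^ (p - 2) / δ, by positivity, fun F w hF hw => ?_⟩
  have hC : 0 ≤ T ^ (p - 2) / δ * w ^ 2 := by positivity
  have hFp : 0 ≤ F ^ p := by positivity
  have hwp : 0 ≤ w ^ p := by positivity
  have hFq : 0 ≤ F ^ (p - 2) := by positivity
  have hwq : 0 ≤ w ^ (p - 2) := by positivity
  rcases le_total F T with hFT | hFT
  · rcases le_total w δ with hwd | hwd
    · rcases le_total F 1 with h1 | h1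
      · have : F ^ (p - 2) ≤ 1 := Real.rpow_le_one hF h1 (by linarith)
        have : F ^ (p - 2) * w ≤ 1 * δ := by gcongr
        nlinarith
      · have : F ^ (p - 2) * w ≤ F ^ p * δ := by
          gcongr; linarith
        nlinarith
    · have h1 : F ^ (p - 2) * w ≤ T ^ (p - 2) * w := by
        gcongr
      have h2 : T ^ (p - 2) * w ≤ T ^ (p - 2) / δ * w ^ 2 := by
        rw [div_mul_eq_mul_div, le_div_iff₀ hδ, mul_assoc, pow_two]
        gcongr
      nlinarith
  · rcases le_total w F with hwF | hwF
    · have : F ^ (p - 2) * w ≤ δ * F ^ p := by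
        rw [split1 F hF]
        have : w ≤ δ * F ^ 2 := by nlinarith [mul_le_mul_of_nonneg_left hFT hδ.le]
        nlinarith [mul_le_mul_of_nonneg_left this hFq]
      nlinarith
    · have : F ^ (p - 2) * w ≤ δ * w ^ p := by
        rw [split1 w hw]
        have h1 : F ^ (p - 2) ≤ w ^ (p - 2) := by gcongr
        have h2 : w ≤ δ * w ^ 2 := by nlinarith [mul_le_mul_of_nonneg_left (hFT.trans hwF) hδ.le]
        calc F ^ (p - 2) * w ≤ w ^ (p - 2) * w := by gcongr
          _ ≤ w ^ (p - 2) * (δ * w ^ 2) := by gcongr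
          _ = _ := by ring
      nlinarith

end Scalar

/-- The space `L^{2^*}(ℝ^N)`. -/
abbrev LCrit (N : ℕ) : Type := Lp ℝ (critE N) (volume : Measure (Eucl N))

variable {N : ℕ}

theorem aesm_rpow_mul_mul (f g k : LCrit N) :
    AEStronglyMeasurable (fun x => |f x| ^ (crit N - 2) * |g x| * |k x|) volume :=
  ((((Lp.aestronglyMeasurable f).norm.aemeasurable.pow_const _).mul
    (Lp.aestronglyMeasurable g).norm.aemeasurable).mul
      (Lp.aestronglyMeasurable k).norm.aemeasurable).aestronglyMeasurable

theorem aesm_dualPow_mul (f g : LCrit N) :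
    AEStronglyMeasurable (fun x => dualPow (crit N) (f x) * g x) volume := by
  unfold dualPow
  exact ((((Lp.aestronglyMeasurable f).norm.aemeasurable.pow_const _).mul
    (Lp.aestronglyMeasurable f).aemeasurable).mul
      (Lp.aestronglyMeasurable g).aemeasurable).aestronglyMeasurable

variable [hN : Fact (3 ≤ N)]

theorem integrable_rpow_mul_mul (f g k : LCrit N) :
    Integrable (fun x => |f x| ^ (crit N - 2) * |g x| * |k x|) := by
  refine (((integrable_rpow_crit f).add (integrable_rpow_crit g)).add
    (integrable_rpow_crit k)).mono' (aesm_rpow_mul_mul f g k) (Eventually.of_forall fun x => ?_)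
  rw [Real.norm_of_nonneg (by positivity)]
  exact rpow_mul_mul_le (two_lt_crit N) (abs_nonneg _) (abs_nonneg _) (abs_nonneg _)

/-- A form of Hölder's inequality with three functions of `L^{2^*}`. -/
theorem integral_rpow_mul_mul_le (f g k : LCrit N) :
    ∫ x, |f x| ^ (crit N - 2) * |g x| * |k x| ≤ 3 * (‖f‖ ^ (crit N - 2) * ‖g‖ * ‖k‖) := by
  have hp := two_lt_crit N
  have hz : ∀ r : LCrit N, r = 0 → ∀ᵐ x, r x = 0 := fun r hr => by
    rw [hr]; exact Lp.coeFn_zero _ _ _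
  have triv : (∀ᵐ x, |f x| ^ (crit N - 2) * |g x| * |k x| = 0) →
      ∫ x, |f x| ^ (crit N - 2) * |g x| * |k x| ≤ 3 * (‖f‖ ^ (crit N - 2) * ‖g‖ * ‖k‖) :=
    fun h => by rw [integral_eq_zero_of_ae h]; positivity
  by_cases hf : f = 0
  · refine triv ?_
    filter_upwards [hz f hf] with x hx
    rw [hx]; simp [Real.zero_rpow (by linarith : crit N - 2 ≠ 0)]
  by_cases hg : g = 0
  · refine triv ?_
    filter_upwards [hz g hg] with x hx
    simp [hx]
  by_cases hk : k = 0
  · refine triv ?_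
    filter_upwards [hz k hk] with x hx
    simp [hx]
  have hf' : 0 < ‖f‖ := norm_pos_iff.2 hf
  have hg' : 0 < ‖g‖ := norm_pos_iff.2 hg
  have hk' : 0 < ‖k‖ := norm_pos_iff.2 hk
  set K := ‖f‖ ^ (crit N - 2) * ‖g‖ * ‖k‖ with hK
  have hK0 : 0 < K := by positivity
  have pw : ∀ x, |f x| ^ (crit N - 2) * |g x| * |k x| ≤
      K * (|f x| ^ crit N / ‖f‖ ^ crit N + |g x| ^ crit N / ‖g‖ ^ crit N +
        |k x| ^ crit N / ‖k‖ ^ crit N) := fun x => by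
    have := rpow_mul_mul_le hp (F := |f x| / ‖f‖) (G := |g x| / ‖g‖) (H := |k x| / ‖k‖)
      (by positivity) (by positivity) (by positivity)
    rw [Real.div_rpow (abs_nonneg _) hf'.le, Real.div_rpow (abs_nonneg _) hf'.le,
      Real.div_rpow (abs_nonneg _) hg'.le, Real.div_rpow (abs_nonneg _) hk'.le] at this
    have e : |f x| ^ (crit N - 2) * |g x| * |k x| = K * (|f x| ^ (crit N - 2) /
        ‖f‖ ^ (crit N - 2) * (|g x| / ‖g‖) * (|k x| / ‖k‖)) := by
      rw [hK]
      field_simp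
    rw [e]
    gcongr
  have i1 := (integrable_rpow_crit f).div_const (‖f‖ ^ crit N)
  have i2 := (integrable_rpow_crit g).div_const (‖g‖ ^ crit N)
  have i3 := (integrable_rpow_crit k).div_const (‖k‖ ^ crit N)
  have hfp : ‖f‖ ^ crit N ≠ 0 := by positivity
  have hgp : ‖g‖ ^ crit N ≠ 0 := by positivity
  have hkp : ‖k‖ ^ crit N ≠ 0 := by positivity
  refine (integral_mono (integrable_rpow_mul_mul f g k) (((i1.add i2).add i3).const_mul K)
    pw).trans (le_of_eq ?_)
  have e1 : ∫ x, |f x| ^ crit N / ‖f‖ ^ crit N = 1 := by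
    rw [integral_div, ← norm_rpow_crit, div_self hfp]
  have e2 : ∫ x, |g x| ^ crit N / ‖g‖ ^ crit N = 1 := by
    rw [integral_div, ← norm_rpow_crit, div_self hgp]
  have e3 : ∫ x, |k x| ^ crit N / ‖k‖ ^ crit N = 1 := by
    rw [integral_div, ← norm_rpow_crit, div_self hkp]
  rw [integral_const_mul]
  have : ∫ x, (|f x| ^ crit N / ‖f‖ ^ crit N + |g x| ^ crit N / ‖g‖ ^ crit N +
        |k x| ^ crit N / ‖k‖ ^ crit N) = 1 + 1 + 1 := by
    have h1 := integral_add (i1.add i2) i3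
    have h2 := integral_add i1 i2
    simp only [Pi.add_apply] at h1
    rw [h1, h2, e1, e2, e3]
  linear_combination K * this

theorem abs_dualPow_mul (p s t : ℝ) : |dualPow p s * t| = |s| ^ (p - 2) * |s| * |t| := by
  rw [dualPow, abs_mul, abs_mul, abs_of_nonneg (by positivity : 0 ≤ |s| ^ (p - 2))]

theorem integrable_dualPow_mul (f g : LCrit N) :
    Integrable (fun x => dualPow (crit N) (f x) * g x) :=
  (integrable_rpow_mul_mul f f g).mono' (aesm_dualPow_mul f g)
    (Eventually.of_forall fun x => by rw [Real.norm_eq_abs, abs_dualPow_mul])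

theorem exists_dualPow_clm (f : LCrit N) :
    ∃ L : LCrit N →L[ℝ] ℝ, ∀ g, L g = ∫ x, dualPow (crit N) (f x) * g x := by
  let L₀ : LCrit N →ₗ[ℝ] ℝ :=
    { toFun := fun g => ∫ x, dualPow (crit N) (f x) * g x
      map_add' := fun g k => by
        rw [← integral_add (integrable_dualPow_mul f g) (integrable_dualPow_mul f k)]
        refine integral_congr_ae ?_
        filter_upwards [Lp.coeFn_add g k] with x hx
        rw [hx, Pi.add_apply]; ring
      map_smul' := fun c g => by
        rw [RingHom.id_apply, smul_eq_mul, ← integral_const_mul]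
        refine integral_congr_ae ?_
        filter_upwards [Lp.coeFn_smul c g] with x hx
        rw [hx, Pi.smul_apply, smul_eq_mul]; ring }
  refine ⟨L₀.mkContinuous (3 * (‖f‖ ^ (crit N - 2) * ‖f‖)) fun g => ?_, fun g => rfl⟩
  calc ‖L₀ g‖ ≤ ∫ x, ‖dualPow (crit N) (f x) * g x‖ := norm_integral_le_integral_norm _
    _ = ∫ x, |f x| ^ (crit N - 2) * |f x| * |g x| := by
        simp only [Real.norm_eq_abs, abs_dualPow_mul]
    _ ≤ _ := integral_rpow_mul_mul_le f f g
    _ = _ := by ring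

/-- `f ↦ ∫ |f|^{2^*}` is Fréchet differentiable on `L^{2^*}`. -/
theorem exists_hasFDerivAt_rpow (f : LCrit N) : ∃ L : LCrit N →L[ℝ] ℝ,
    (∀ g, L g = crit N * ∫ x, dualPow (crit N) (f x) * g x) ∧
      HasFDerivAt (fun f : LCrit N => ∫ x, |f x| ^ crit N) L f := by
  obtain ⟨L, hL⟩ := exists_dualPow_clm f
  have hp := two_lt_crit N
  refine ⟨crit N • L, fun g => by simp [hL], ?_⟩
  rw [hasFDerivAt_iff_isLittleO_nhds_zero]
  refine Asymptotics.IsBigO.trans_isLittleO (g := fun g : LCrit N => ‖g‖ ^ 2) ?_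
    (Asymptotics.isLittleO_norm_pow_id one_lt_two)
  set M := crit N * (crit N - 1) * (3 * (2 * ‖f‖ + 1) ^ (crit N - 2)) with hM
  refine Asymptotics.IsBigO.of_bound M ?_
  filter_upwards [Metric.ball_mem_nhds (0 : LCrit N) one_pos] with g hg
  have hg1 : ‖g‖ ≤ 1 := by
    have := mem_ball_zero_iff.1 hg
    exact this.le
  set F : LCrit N := (2 : ℝ) • |f| + |g| with hF
  have hFae : ∀ᵐ x, |F x| = 2 * |f x| + |g x| := by
    filter_upwards [Lp.coeFn_add ((2 : ℝ) • |f|) |g|, Lp.coeFn_smul (2 : ℝ) |f|,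
      Lp.coeFn_abs f, Lp.coeFn_abs g] with x h1 h2 h3 h4
    rw [hF, h1, Pi.add_apply, h2, Pi.smul_apply, h3, h4, smul_eq_mul, abs_of_nonneg (by positivity)]
  have hFn : ‖F‖ ≤ 2 * ‖f‖ + 1 := by
    refine (norm_add_le _ _).trans ?_
    rw [norm_smul, norm_abs_eq_norm, norm_abs_eq_norm]
    simp only [Real.norm_ofNat]
    linarith
  have pw : ∀ᵐ x, |(|(f + g) x| ^ crit N - |f x| ^ crit N -
      crit N * (dualPow (crit N) (f x) * g x))| ≤
      crit N * (crit N - 1) * (|F x| ^ (crit N - 2) * |g x| * |g x|) := by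
    filter_upwards [hFae, Lp.coeFn_add f g] with x h1 h2
    rw [h1, h2, Pi.add_apply]
    exact abs_rpow_taylor hp _ _
  have hInt := integral_rpow_mul_mul_le F g g
  have i1 := integrable_rpow_crit (f + g)
  have i2 := integrable_rpow_crit f
  have i3 := (integrable_dualPow_mul f g).const_mul (crit N)
  have e : (∫ x, |(f + g) x| ^ crit N) - (∫ x, |f x| ^ crit N) - (crit N • L) g =
      ∫ x, (|(f + g) x| ^ crit N - |f x| ^ crit N -
        crit N * (dualPow (crit N) (f x) * g x)) := by
    rw [smul_apply, hL, smul_eq_mul, ← integral_const_mul,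
      ← integral_sub i1 i2]
    exact (integral_sub (i1.sub i2) i3).symm
  rw [e, Real.norm_eq_abs, Real.norm_of_nonneg (by positivity)]
  refine abs_integral_le_integral_abs.trans ?_
  refine (integral_mono_ae ((i1.sub i2).sub i3).abs
    ((integrable_rpow_mul_mul F g g).const_mul _) pw).trans ?_
  rw [integral_const_mul, hM, mul_assoc _ _ (‖g‖ ^ 2)]
  refine mul_le_mul_of_nonneg_left ?_ (mul_nonneg (by linarith) (by linarith))
  refine hInt.trans ?_
  have : ‖F‖ ^ (crit N - 2) ≤ (2 * ‖f‖ + 1) ^ (crit N - 2) :=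
    Real.rpow_le_rpow (norm_nonneg _) hFn (by linarith)
  calc 3 * (‖F‖ ^ (crit N - 2) * ‖g‖ * ‖g‖) ≤
      3 * ((2 * ‖f‖ + 1) ^ (crit N - 2) * ‖g‖ * ‖g‖) := by gcongr
    _ = _ := by ring

theorem exists_hasFDerivAt_critTerm (u : D12 N) : ∃ L : D12 N →L[ℝ] ℝ,
    (∀ v, L v = crit N * ∫ x, dualPow (crit N) (u.fn x) * v.fn x) ∧
      HasFDerivAt (critTerm (N := N)) L u := by
  obtain ⟨L, hL, hd⟩ := exists_hasFDerivAt_rpow u.fn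
  refine ⟨L.comp (fnL N), fun v => by rw [ContinuousLinearMap.comp_apply, hL]; rfl, ?_⟩
  have hd' : HasFDerivAt (fun f : LCrit N => ∫ x, |f x| ^ crit N) L (fnL N u) := hd
  exact hd'.comp u (fnL N).hasFDerivAt

end CriticalTerm

section Forms

section Potential

variable {N : ℕ}

theorem angular_of_ne {h : Sph N → ℝ} {x : Eucl N} (hx : x ≠ 0) :
    angular h x = h ⟨‖x‖⁻¹ • x, by
      rw [mem_sphere_zero_iff_norm, norm_smul, norm_inv, norm_norm,
        inv_mul_cancel₀ (norm_ne_zero_iff.2 hx)]⟩ := by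
  simp [angular, hx]

theorem continuousOn_angular {h : Sph N → ℝ} (hc : Continuous h) :
    ContinuousOn (angular h) {0}ᶜ := by
  rw [continuousOn_iff_continuous_domRestrict]
  have : Set.domRestrict {0}ᶜ (angular h) = fun x : ({0}ᶜ : Set (Eucl N)) =>
      h ⟨‖(x : Eucl N)‖⁻¹ • (x : Eucl N), by
        have hx : (x : Eucl N) ≠ 0 := x.2
        rw [mem_sphere_zero_iff_norm, norm_smul, norm_inv, norm_norm,
          inv_mul_cancel₀ (norm_ne_zero_iff.2 hx)]⟩ := by
    ext x
    exact angular_of_ne x.2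
  rw [this]
  refine hc.comp (Continuous.subtype_mk ?_ _)
  exact (continuous_subtype_val.norm.inv₀ fun x => norm_ne_zero_iff.2 x.2).smul
    continuous_subtype_val

theorem measurable_angular {h : Sph N → ℝ} (hc : Continuous h) : Measurable (angular h) :=
  measurable_of_continuousOn_compl_singleton 0 (continuousOn_angular hc)

theorem exists_angular_bound {h : Sph N → ℝ} (hc : Continuous h) :
    ∃ M : ℝ, 0 ≤ M ∧ ∀ x, |angular h x| ≤ M := by
  obtain ⟨C, hC⟩ := isCompact_univ.exists_bound_of_continuousOn hc.continuousOn
  refine ⟨|C|, abs_nonneg C, fun x => ?_⟩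
  by_cases hx : x = 0
  · simp [angular, hx]
  · rw [angular_of_ne hx]
    exact (hC _ (Set.mem_univ _)).trans (le_abs_self C)

theorem angular_smul {h : Sph N → ℝ} {t : ℝ} (ht : 0 < t) (x : Eucl N) :
    angular h (t • x) = angular h x := by
  by_cases hx : x = 0
  · simp [hx]
  · rw [angular_of_ne hx, angular_of_ne (smul_ne_zero ht.ne' hx)]
    congr 2
    rw [norm_smul, Real.norm_of_nonneg ht.le, smul_smul, mul_inv_rev, mul_assoc,
      inv_mul_cancel₀ ht.ne', mul_one]

theorem angular_sum {k : ℕ} (h : Fin k → Sph N → ℝ) (x : Eucl N) :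
    angular (∑ j, h j) x = ∑ j, angular (h j) x := by
  by_cases hx : x = 0
  · simp [angular, hx]
  · simp only [angular_of_ne hx, Finset.sum_apply]

/-- The singular potential `h((x-a)/|x-a|) / |x-a|²`. -/
def polePot (h : Sph N → ℝ) (a x : Eucl N) : ℝ := angular h (x - a) / ‖x - a‖ ^ 2

theorem measurable_polePot {h : Sph N → ℝ} (hc : Continuous h) (a : Eucl N) :
    Measurable (polePot h a) := by
  unfold polePot
  have := measurable_angular hc
  fun_prop

theorem exists_polePot_bound {h : Sph N → ℝ} (hc : Continuous h) :
    ∃ M : ℝ, 0 ≤ M ∧ ∀ a x, |polePot h a x| ≤ M * (‖x - a‖ ^ 2)⁻¹ := by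
  obtain ⟨M, hM, hb⟩ := exists_angular_bound hc
  refine ⟨M, hM, fun a x => ?_⟩
  rw [polePot, abs_div, abs_of_nonneg (by positivity : 0 ≤ ‖x - a‖ ^ 2), div_eq_mul_inv]
  gcongr
  exact hb _

theorem indicator_mul_sq (s : Set (Eucl N)) (f : Eucl N → ℝ) (x : Eucl N) :
    s.indicator (fun _ => (1 : ℝ)) x * f x ^ 2 = s.indicator (fun x => f x ^ 2) x := by
  by_cases hx : x ∈ s <;> simp [hx]

end Potential

variable {N : ℕ} [hN : Fact (3 ≤ N)]

instance nontrivial_eucl : Nontrivial (Eucl N) := by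
  have := hN.out
  have : Nontrivial (Fin N) := Fin.nontrivial_iff_two_le.2 (by omega)
  infer_instance

theorem hardyPot_polePot {h : Sph N → ℝ} (hc : Continuous h) (a : Eucl N) :
    HardyPot (polePot h a) := by
  obtain ⟨M, hM, hb⟩ := exists_polePot_bound hc
  refine (hardyPot_invSq a).mono (measurable_polePot hc a).aestronglyMeasurable (M := M)
    (Eventually.of_forall fun x => ?_)
  simpa using hb a x

theorem hardyPot_ball (R : ℝ) :
    HardyPot ((closedBall (0 : Eucl N) R).indicator fun _ => (1 : ℝ)) := by
  refine (hardyPot_invSq 0).mono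
    (aestronglyMeasurable_const.indicator measurableSet_closedBall) (M := R ^ 2) ?_
  filter_upwards [compl_mem_ae_iff.2 (measure_singleton (0 : Eucl N))] with x hx
  by_cases hR : x ∈ closedBall (0 : Eucl N) R
  · have hx0 : 0 < ‖x‖ := norm_pos_iff.2 (by simpa using hx)
    have hxR : ‖x‖ ≤ R := by simpa using hR
    rw [Set.indicator_of_mem hR]
    simp only [abs_one, sub_zero, abs_inv, abs_pow, abs_norm]
    rw [← div_eq_mul_inv, le_div_iff₀ (by positivity), one_mul]
    gcongr
  · rw [Set.indicator_of_notMem hR]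
    simp
    positivity

/-- `∫_{|x| ≤ R} u²`. -/
def ballTerm (R : ℝ) (u : D12 N) : ℝ := ∫ x in closedBall (0 : Eucl N) R, u.fn x ^ 2

theorem ballTerm_eq (R : ℝ) (u : D12 N) : ballTerm R u =
    ∫ x, (closedBall (0 : Eucl N) R).indicator (fun _ => (1 : ℝ)) x * u.fn x ^ 2 := by
  simp only [indicator_mul_sq _ (fun x => u.fn x)]
  rw [integral_indicator measurableSet_closedBall, ballTerm]

/-- `∫ V u²`. -/
def potTerm (V : Eucl N → ℝ) (u : D12 N) : ℝ := ∫ x, V x * u.fn x ^ 2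

theorem poleTerm_eq (h : Sph N → ℝ) (a : Eucl N) (u : D12 N) :
    poleTerm h a u = potTerm (polePot h a) u := rfl

namespace HardyPot

variable {V W : Eucl N → ℝ}

theorem integrable_mul_sq (hV : HardyPot V) (u : D12 N) :
    Integrable (fun x => V x * u.fn x ^ 2) := by
  simpa only [pow_two] using hV.integrable_mul u u

theorem continuous_potTerm (hV : HardyPot V) : Continuous (potTerm V) := by
  obtain ⟨B, hB⟩ := hV.exists_bilin
  have : potTerm V = fun u => B u u := by
    ext u
    simp only [hB, potTerm, pow_two]
  rw [this]
  fun_prop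

theorem exists_potTerm_le (hV : HardyPot V) :
    ∃ C : ℝ, 0 ≤ C ∧ ∀ u : D12 N, |potTerm V u| ≤ C * ‖u‖ ^ 2 := by
  obtain ⟨C, hC, hb⟩ := hV.integral_sq_le
  refine ⟨C, hC, fun u => (abs_integral_le_integral_abs).trans (le_trans (le_of_eq ?_) (hb u))⟩
  refine integral_congr_ae (Eventually.of_forall fun x => ?_)
  simp [abs_mul]

end HardyPot

theorem potTerm_sum {ι : Type*} (s : Finset ι) {V : ι → Eucl N → ℝ}
    (h : ∀ i ∈ s, HardyPot (V i)) (u : D12 N) :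
    potTerm (fun x => ∑ i ∈ s, V i x) u = ∑ i ∈ s, potTerm (V i) u := by
  unfold potTerm
  simp only [Finset.sum_mul]
  exact integral_finsetSum _ fun i hi => (h i hi).integrable_mul_sq u

theorem ballTerm_eq_potTerm (R : ℝ) : ballTerm (N := N) R =
    potTerm ((closedBall (0 : Eucl N) R).indicator fun _ => (1 : ℝ)) :=
  funext (ballTerm_eq R)

/-- The sum of the singular potentials. -/
def totalPot {k : ℕ} (h : Fin k → Sph N → ℝ) (a : Fin k → Eucl N) (x : Eucl N) : ℝ :=
  ∑ i, polePot (h i) (a i) x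

theorem hardyPot_totalPot {k : ℕ} {h : Fin k → Sph N → ℝ} (hc : ∀ i, Continuous (h i))
    (a : Fin k → Eucl N) : HardyPot (totalPot h a) :=
  HardyPot.sum _ fun i _ => hardyPot_polePot (hc i) (a i)

theorem Q_eq {k : ℕ} {h : Fin k → Sph N → ℝ} (hc : ∀ i, Continuous (h i))
    (a : Fin k → Eucl N) (u : D12 N) : Q h a u = ‖u‖ ^ 2 - potTerm (totalPot h a) u := by
  unfold Q totalPot
  rw [potTerm_sum _ (fun i _ => hardyPot_polePot (hc i) (a i)), dirichlet_eq]
  rfl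

/-- The bilinear form associated with a potential. -/
theorem HardyPot.exists_form {V : Eucl N → ℝ} (hV : HardyPot V) :
    ∃ B : D12 N →L[ℝ] D12 N →L[ℝ] ℝ, (∀ u v, B u v = B v u) ∧
      ∀ u, B u u = ‖u‖ ^ 2 - potTerm V u := by
  obtain ⟨B, hB⟩ := hV.exists_bilin
  let I : D12 N →L[ℝ] D12 N →L[ℝ] ℝ := innerSL ℝ
  have hI : ∀ u v, I u v = inner ℝ u v := fun u v => rfl
  refine ⟨I - B, fun u v => ?_, fun u => ?_⟩
  · simp only [sub_apply, hB, hI, real_inner_comm, mul_comm]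
  · simp only [sub_apply, hB, hI, real_inner_self_eq_norm_sq, potTerm, pow_two]

theorem fderiv_J_apply {k : ℕ} {h : Fin k → Sph N → ℝ} {a : Fin k → Eucl N}
    {B : D12 N →L[ℝ] D12 N →L[ℝ] ℝ} (hs : ∀ u v, B u v = B v u)
    (hB : ∀ u, B u u = Q h a u) (u v : D12 N) :
    fderiv ℝ (J h a) u v = B u v - SMulti h a * ∫ x, dualPow (crit N) (u.fn x) * v.fn x := by
  obtain ⟨L, hL, hd⟩ := exists_hasFDerivAt_critTerm u
  have hJ : J h a = fun u => 1 / 2 * B u u - SMulti h a / crit N * critTerm u := by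
    ext u
    rw [hB, J, Q]
    ring
  have hBd : HasFDerivAt (fun u => B u u)
      ((B.precompR (D12 N) u (ContinuousLinearMap.id ℝ _)) + (B.precompL (D12 N)
        (ContinuousLinearMap.id ℝ _) u)) u :=
    B.hasFDerivAt_of_bilinear (hasFDerivAt_id u) (hasFDerivAt_id u)
  have := (hBd.const_mul (1 / 2)).sub (hd.const_mul (SMulti h a / crit N))
  rw [hJ]
  have e := this.fderiv
  simp only [Pi.sub_def] at e
  rw [e]
  simp only [sub_apply, smul_apply, add_apply, hL, smul_eq_mul,
    ContinuousLinearMap.precompR_apply, ContinuousLinearMap.compL_apply,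
    ContinuousLinearMap.comp_apply, ContinuousLinearMap.precompL_apply,
    ContinuousLinearMap.id_apply, hs v u]
  have := (crit_pos (N := N)).ne'
  field_simp
  ring

end Forms

section LocalCompactness

theorem sq_integral_le {α : Type*} [MeasurableSpace α] {ν : Measure α} [IsProbabilityMeasure ν]
    {f : α → ℝ} (hf : Integrable f ν) (hf2 : Integrable (fun x => f x ^ 2) ν) :
    (∫ x, f x ∂ν) ^ 2 ≤ ∫ x, f x ^ 2 ∂ν := by
  set c := ∫ x, f x ∂ν with hc
  have h0 : 0 ≤ ∫ x, (f x ^ 2 - 2 * c * f x + c ^ 2) ∂ν :=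
    integral_nonneg fun x => by
      have := sq_nonneg (f x - c)
      simp only [Pi.zero_apply]
      nlinarith
  have h1 : ∫ x, (f x ^ 2 - 2 * c * f x + c ^ 2) ∂ν =
      (∫ x, f x ^ 2 ∂ν) - 2 * c * c + c ^ 2 := by
    have e1 := integral_add (hf2.sub (hf.const_mul (2 * c))) (integrable_const (c ^ 2) (μ := ν))
    have e2 := integral_sub hf2 (hf.const_mul (2 * c))
    simp only [Pi.sub_apply] at e1
    rw [e1, e2, integral_const_mul, ← hc, integral_const]
    simp
  rw [h1] at h0
  nlinarith

theorem ofReal_sq_integral_le {α : Type*} [MeasurableSpace α] {ν : Measure α}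
    [IsProbabilityMeasure ν] {f : α → ℝ} (hf : AEStronglyMeasurable f ν) {C : ℝ}
    (hC : ∀ x, |f x| ≤ C) :
    ENNReal.ofReal ((∫ x, f x ∂ν) ^ 2) ≤ ∫⁻ x, ENNReal.ofReal (f x ^ 2) ∂ν := by
  have h1 : Integrable f ν := Integrable.of_bound hf C (Eventually.of_forall hC)
  have h2 : Integrable (fun x => f x ^ 2) ν :=
    Integrable.of_bound (hf.pow 2) (C ^ 2) (Eventually.of_forall fun x => by
      rw [norm_pow, Real.norm_eq_abs]
      gcongr
      exact hC x)
  rw [← ofReal_integral_eq_lintegral_ofReal h2 (Eventually.of_forall fun x => sq_nonneg _)]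
  exact ENNReal.ofReal_le_ofReal (sq_integral_le h1 h2)

section Translation

variable {N : ℕ}

theorem IsTest.lintegral_sub_translate_le {φ : Eucl N → ℝ} (h : IsTest φ) (y : Eucl N) :
    ∫⁻ x, ENNReal.ofReal ((φ (x + y) - φ x) ^ 2) ≤
      ENNReal.ofReal (‖y‖ ^ 2) * ∫⁻ x, ENNReal.ofReal (‖gradient φ x‖ ^ 2) := by
  have cd := h.smooth.continuous_fderiv (by simp)
  have cg := h.continuous_gradient
  set ν : Measure ℝ := volume.restrict (Set.Ioc 0 1) with hν
  have : IsProbabilityMeasure ν := ⟨by simp [hν]⟩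
  obtain ⟨C, hC⟩ := h.hasCompactSupport_gradient.exists_bound_of_continuous cg
  have hfg : ∀ x v, fderiv ℝ φ x v = inner ℝ (gradient φ x) v := fun x v => by simp [gradient]
  have ftc : ∀ x, φ (x + y) - φ x = ∫ t, fderiv ℝ φ (x + t • y) y ∂ν := fun x => by
    have hd : ∀ t : ℝ, HasDerivAt (fun t : ℝ => φ (x + t • y)) (fderiv ℝ φ (x + t • y) y) t :=
      fun t => by
        have h1 : HasDerivAt (fun t : ℝ => x + t • y) y t := by
          simpa using ((hasDerivAt_id t).smul_const y).const_add x
        exact (h.differentiable _).hasFDerivAt.comp_hasDerivAt t h1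
    have hcont : Continuous fun t : ℝ => fderiv ℝ φ (x + t • y) y := by fun_prop
    have := intervalIntegral.integral_eq_sub_of_hasDerivAt (a := 0) (b := 1) (fun t _ => hd t)
      (hcont.intervalIntegrable 0 1)
    rw [intervalIntegral.integral_of_le zero_le_one] at this
    rw [hν, this]
    simp
  have bd : ∀ z, fderiv ℝ φ z y ^ 2 ≤ ‖y‖ ^ 2 * ‖gradient φ z‖ ^ 2 := fun z => by
    rw [hfg, ← sq_abs, ← mul_pow, mul_comm]
    gcongr
    exact abs_real_inner_le_norm _ _
  calc ∫⁻ x, ENNReal.ofReal ((φ (x + y) - φ x) ^ 2)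
      ≤ ∫⁻ x, ∫⁻ t, ENNReal.ofReal (‖y‖ ^ 2) *
          ENNReal.ofReal (‖gradient φ (x + t • y)‖ ^ 2) ∂ν := by
        refine lintegral_mono fun x => ?_
        rw [ftc x]
        refine (ofReal_sq_integral_le (C := C * ‖y‖) ?_ fun t => ?_).trans
          (lintegral_mono fun t => ?_)
        · exact (by fun_prop : Continuous fun t : ℝ =>
            fderiv ℝ φ (x + t • y) y).aestronglyMeasurable
        · rw [hfg]
          refine (abs_real_inner_le_norm _ _).trans ?_
          gcongr
          exact hC _
        · rw [← ENNReal.ofReal_mul (by positivity)]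
          exact ENNReal.ofReal_le_ofReal (bd _)
    _ = ∫⁻ t, (∫⁻ x, ENNReal.ofReal (‖y‖ ^ 2) *
          ENNReal.ofReal (‖gradient φ (x + t • y)‖ ^ 2)) ∂ν := by
        refine lintegral_lintegral_swap (Measurable.aemeasurable ?_)
        refine Measurable.const_mul (ENNReal.measurable_ofReal.comp ?_) _
        exact (by fun_prop : Continuous fun q : Eucl N × ℝ =>
          ‖gradient φ (q.1 + q.2 • y)‖ ^ 2).measurable
    _ = ∫⁻ _t, (ENNReal.ofReal (‖y‖ ^ 2) *
          ∫⁻ x, ENNReal.ofReal (‖gradient φ x‖ ^ 2)) ∂ν := by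
        refine lintegral_congr fun t => ?_
        rw [lintegral_const_mul' _ _ ENNReal.ofReal_ne_top,
          lintegral_add_right_eq_self (fun x => ENNReal.ofReal (‖gradient φ x‖ ^ 2)) (t • y)]
    _ = _ := by simp

/-- The average of `φ` over the ball of radius `ε` around `x`. -/
def ballAvg (ε : ℝ) (φ : Eucl N → ℝ) (x : Eucl N) : ℝ :=
  ∫ y, φ (x + y) ∂(ProbabilityTheory.cond volume (ball (0 : Eucl N) ε))

theorem isProbabilityMeasure_cond_ball {ε : ℝ} (hε : 0 < ε) :
    IsProbabilityMeasure (ProbabilityTheory.cond volume (ball (0 : Eucl N) ε)) :=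
  ProbabilityTheory.cond_isProbabilityMeasure_of_finite (measure_ball_pos _ _ hε).ne'
    measure_ball_lt_top.ne

theorem IsTest.measurable_ballAvg {φ : Eucl N → ℝ} (h : IsTest φ) (ε : ℝ) :
    Measurable (ballAvg ε φ) := by
  have : StronglyMeasurable (fun q : Eucl N × Eucl N => φ (q.1 + q.2)) := by
    have := h.continuous
    exact (by fun_prop : Continuous fun q : Eucl N × Eucl N => φ (q.1 + q.2)).stronglyMeasurable
  exact (this.integral_prod_right).measurable

theorem IsTest.lintegral_sub_ballAvg_le {φ : Eucl N → ℝ} (h : IsTest φ) {ε : ℝ} (hε : 0 < ε) :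
    ∫⁻ x, ENNReal.ofReal ((ballAvg ε φ x - φ x) ^ 2) ≤
      ENNReal.ofReal (ε ^ 2) * ∫⁻ x, ENNReal.ofReal (‖gradient φ x‖ ^ 2) := by
  have hprob := isProbabilityMeasure_cond_ball (N := N) hε
  set ν := ProbabilityTheory.cond volume (ball (0 : Eucl N) ε) with hν
  have cφ := h.continuous
  obtain ⟨C, hC⟩ := h.cpt.exists_bound_of_continuous cφ
  have hsupp : ∀ᵐ y ∂ν, y ∈ ball (0 : Eucl N) ε :=
    ProbabilityTheory.ae_cond_mem measurableSet_ball
  have hInt : ∀ x, Integrable (fun y => φ (x + y)) ν := fun x =>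
    Integrable.of_bound (by fun_prop : Continuous fun y => φ (x + y)).aestronglyMeasurable C
      (Eventually.of_forall fun y => hC _)
  calc ∫⁻ x, ENNReal.ofReal ((ballAvg ε φ x - φ x) ^ 2)
      ≤ ∫⁻ x, ∫⁻ y, ENNReal.ofReal ((φ (x + y) - φ x) ^ 2) ∂ν := by
        refine lintegral_mono fun x => ?_
        have e : ballAvg ε φ x - φ x = ∫ y, (φ (x + y) - φ x) ∂ν := by
          rw [integral_sub (hInt x) (integrable_const _)]
          simp [ballAvg, hν]
        rw [e]
        refine ofReal_sq_integral_le (C := C + C) ?_ fun y => ?_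
        · exact (by fun_prop : Continuous fun y => φ (x + y) - φ x).aestronglyMeasurable
        · exact (abs_sub _ _).trans (add_le_add (hC _) (hC _))
    _ = ∫⁻ y, (∫⁻ x, ENNReal.ofReal ((φ (x + y) - φ x) ^ 2)) ∂ν := by
        refine lintegral_lintegral_swap (Measurable.aemeasurable ?_)
        refine ENNReal.measurable_ofReal.comp ?_
        exact (by fun_prop : Continuous fun q : Eucl N × Eucl N =>
          (φ (q.1 + q.2) - φ q.1) ^ 2).measurable
    _ ≤ ∫⁻ _y, (ENNReal.ofReal (ε ^ 2) * ∫⁻ x, ENNReal.ofReal (‖gradient φ x‖ ^ 2)) ∂ν := by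
        refine lintegral_mono_ae ?_
        filter_upwards [hsupp] with y hy
        refine (h.lintegral_sub_translate_le y).trans ?_
        gcongr
        exact (mem_ball_zero_iff.1 hy).le
    _ = _ := by simp

theorem ballAvg_eq (φ : Eucl N → ℝ) (ε : ℝ) (x : Eucl N) : ballAvg ε φ x =
    (volume (ball (0 : Eucl N) ε)).toReal⁻¹ *
      ∫ y, (ball x ε).indicator (fun _ => (1 : ℝ)) y * φ y := by
  rw [ballAvg, ProbabilityTheory.cond, integral_smul_measure, ENNReal.toReal_inv, smul_eq_mul]
  congr 1
  rw [← integral_indicator measurableSet_ball,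
    ← integral_sub_right_eq_self _ x (μ := (volume : Measure (Eucl N)))]
  refine integral_congr_ae (Eventually.of_forall fun y => ?_)
  by_cases hy : y ∈ ball x ε
  · have : y - x ∈ ball (0 : Eucl N) ε := by simpa [dist_eq_norm] using hy
    simp [hy, this]
  · have : y - x ∉ ball (0 : Eucl N) ε := by simpa [dist_eq_norm] using hy
    simp [hy, this]

theorem memLp_indicator_ball (x : Eucl N) (ε : ℝ) (q : ℝ≥0∞) :
    MemLp ((ball x ε).indicator fun _ => (1 : ℝ)) q volume :=
  memLp_indicator_const q measurableSet_ball 1 (Or.inr measure_ball_lt_top.ne)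

end Translation

variable {N : ℕ} [hN : Fact (3 ≤ N)]

theorem ballTerm_ofTest {φ : Eucl N → ℝ} (h : IsTest φ) (R : ℝ) :
    ballTerm R (ofTest h) = ∫ x in closedBall (0 : Eucl N) R, φ x ^ 2 := by
  refine integral_congr_ae (ae_restrict_of_ae ?_)
  filter_upwards [ofTest_fn h] with x hx
  rw [hx]

theorem exists_ballTerm_le (R : ℝ) :
    ∃ C : ℝ, 0 ≤ C ∧ ∀ u : D12 N, ballTerm R u ≤ C * ‖u‖ ^ 2 := by
  obtain ⟨C, hC, hb⟩ := (hardyPot_ball (N := N) R).exists_potTerm_le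
  refine ⟨C, hC, fun u => ?_⟩
  rw [ballTerm_eq_potTerm]
  exact (le_abs_self _).trans (hb u)

theorem ballTerm_nonneg (R : ℝ) (u : D12 N) : 0 ≤ ballTerm R u :=
  integral_nonneg fun _ => sq_nonneg _

theorem exists_ballAvg_bound {ε : ℝ} (hε : 0 < ε) (R : ℝ) : ∃ C : ℝ, 0 ≤ C ∧
    ∀ (φ : Eucl N → ℝ) (h : IsTest φ), ∀ x ∈ closedBall (0 : Eucl N) R,
      ballAvg ε φ x ^ 2 ≤ C * ‖ofTest h‖ ^ 2 := by
  obtain ⟨C, hC, hb⟩ := exists_ballTerm_le (N := N) (R + ε)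
  have hprob := isProbabilityMeasure_cond_ball (N := N) hε
  refine ⟨(volume (ball (0 : Eucl N) ε)).toReal⁻¹ * C, by positivity, fun φ h x hx => ?_⟩
  have cφ := h.continuous
  obtain ⟨K, hK⟩ := h.cpt.exists_bound_of_continuous cφ
  have hm : Continuous fun y => φ (x + y) := by fun_prop
  have h1 : ballAvg ε φ x ^ 2 ≤ ballAvg ε (fun x => φ x ^ 2) x := by
    refine sq_integral_le (Integrable.of_bound hm.aestronglyMeasurable K
      (Eventually.of_forall fun y => hK _)) (Integrable.of_bound (C := K ^ 2)
      (hm.pow 2).aestronglyMeasurable (Eventually.of_forall fun y => ?_))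
    simp only [norm_pow]
    gcongr
    exact hK _
  refine h1.trans ?_
  rw [ballAvg_eq, mul_assoc]
  gcongr
  refine le_trans ?_ (hb (ofTest h))
  rw [ballTerm_ofTest, ← integral_indicator measurableSet_closedBall]
  have hsq : Integrable fun x => φ x ^ 2 :=
    Continuous.integrable_of_hasCompactSupport (by fun_prop)
      (h.cpt.comp_left (g := (· ^ 2)) (by simp))
  refine integral_mono_of_nonneg (Eventually.of_forall fun y => ?_)
    (hsq.indicator measurableSet_closedBall) (Eventually.of_forall fun y => ?_)
  · exact mul_nonneg (Set.indicator_nonneg (fun _ _ => zero_le_one) _) (sq_nonneg _)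
  · simp only
    by_cases hy : y ∈ ball x ε
    · have : y ∈ closedBall (0 : Eucl N) (R + ε) := by
        rw [mem_closedBall_zero_iff] at hx ⊢
        rw [mem_ball, dist_eq_norm] at hy
        calc ‖y‖ = ‖x + (y - x)‖ := by congr 1; abel
          _ ≤ ‖x‖ + ‖y - x‖ := norm_add_le _ _
          _ ≤ R + ε := by linarith
      simp [hy, this]
    · rw [Set.indicator_of_notMem hy, zero_mul]
      exact Set.indicator_nonneg (fun _ _ => sq_nonneg _) _

/-- Local compactness, for sequences of test functions. -/
theorem tendsto_ballTerm_of_test (φ : ℕ → Eucl N → ℝ) (h : ∀ n, IsTest (φ n)) {K : ℝ}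
    (hK : ∀ n, ‖ofTest (h n)‖ ≤ K)
    (hw : ∀ f : D12 N →L[ℝ] ℝ, Tendsto (fun n => f (ofTest (h n))) atTop (𝓝 0)) (R : ℝ) :
    Tendsto (fun n => ballTerm R (ofTest (h n))) atTop (𝓝 0) := by
  have hK0 : 0 ≤ K := (norm_nonneg _).trans (hK 0)
  have havg : ∀ ε : ℝ, 0 < ε → Tendsto (fun n =>
      ∫ x in closedBall (0 : Eucl N) R, ballAvg ε (φ n) x ^ 2) atTop (𝓝 0) := fun ε hε => by
    obtain ⟨C, hC, hb⟩ := exists_ballAvg_bound (N := N) hε R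
    have hlim : ∀ x, Tendsto (fun n => ballAvg ε (φ n) x ^ 2) atTop (𝓝 0) := fun x => by
      obtain ⟨L, hL⟩ := exists_pairing (N := N) (memLp_indicator_ball x ε _)
      have e : ∀ n, ballAvg ε (φ n) x =
          (volume (ball (0 : Eucl N) ε)).toReal⁻¹ * L (ofTest (h n)) := fun n => by
        rw [ballAvg_eq, hL]
        congr 1
        refine integral_congr_ae ?_
        filter_upwards [ofTest_fn (h n)] with y hy
        rw [hy]
      simp only [e]
      simpa using ((hw L).const_mul _).pow 2
    have := tendsto_integral_of_dominated_convergence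
      (μ := volume.restrict (closedBall (0 : Eucl N) R))
      (F := fun n x => ballAvg ε (φ n) x ^ 2) (f := fun _ => 0) (fun _ => C * K ^ 2)
      (fun n => (((h n).measurable_ballAvg ε).pow_const 2).aestronglyMeasurable)
      (integrableOn_const measure_closedBall_lt_top.ne) (fun n => ?_)
      (Eventually.of_forall hlim)
    · simpa using this
    · filter_upwards [ae_restrict_mem measurableSet_closedBall] with x hx
      rw [Real.norm_of_nonneg (sq_nonneg _)]
      refine (hb _ (h n) x hx).trans ?_
      gcongr
      exact hK n
  have hle : ∀ ε : ℝ, 0 < ε → ∀ n, ballTerm R (ofTest (h n)) ≤ 2 * (ε ^ 2 * K ^ 2) +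
      2 * ∫ x in closedBall (0 : Eucl N) R, ballAvg ε (φ n) x ^ 2 := fun ε hε n => by
    obtain ⟨C, hC, hb⟩ := exists_ballAvg_bound (N := N) hε R
    have cφ := (h n).continuous
    have mavg := (h n).measurable_ballAvg ε
    have hgrad : Integrable fun x => ‖gradient (φ n) x‖ ^ 2 :=
      Continuous.integrable_of_hasCompactSupport
        (by have := (h n).continuous_gradient; fun_prop)
        ((h n).hasCompactSupport_gradient.norm.comp_left (g := (· ^ 2)) (by simp))
    have hl := (h n).lintegral_sub_ballAvg_le hε
    rw [← ofReal_integral_eq_lintegral_ofReal hgrad (Eventually.of_forall fun x => sq_nonneg _),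
      ← ENNReal.ofReal_mul (sq_nonneg _), ← ofTest_norm_sq (h n)] at hl
    have i1 : Integrable fun x => (ballAvg ε (φ n) x - φ n x) ^ 2 := by
      refine ⟨((mavg.sub cφ.measurable).pow_const 2).aestronglyMeasurable, ?_⟩
      rw [hasFiniteIntegral_iff_ofReal (Eventually.of_forall fun x => sq_nonneg _)]
      exact hl.trans_lt ENNReal.ofReal_lt_top
    have h1 : ∫ x in closedBall (0 : Eucl N) R, (ballAvg ε (φ n) x - φ n x) ^ 2 ≤
        ε ^ 2 * K ^ 2 := by
      refine (setIntegral_le_integral i1 (Eventually.of_forall fun x => sq_nonneg _)).trans ?_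
      rw [← ofReal_integral_eq_lintegral_ofReal i1 (Eventually.of_forall fun x => sq_nonneg _),
        ENNReal.ofReal_le_ofReal_iff (by positivity)] at hl
      refine hl.trans ?_
      gcongr
      exact hK n
    have i2 : IntegrableOn (fun x => ballAvg ε (φ n) x ^ 2) (closedBall (0 : Eucl N) R) := by
      refine Measure.integrableOn_of_bounded (M := C * ‖ofTest (h n)‖ ^ 2)
        measure_closedBall_lt_top.ne (mavg.pow_const 2).aestronglyMeasurable ?_
      filter_upwards [ae_restrict_mem measurableSet_closedBall] with x hx
      rw [Real.norm_of_nonneg (sq_nonneg _)]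
      exact hb _ (h n) x hx
    have i3 : IntegrableOn (fun x => φ n x ^ 2) (closedBall (0 : Eucl N) R) :=
      (Continuous.integrable_of_hasCompactSupport (by fun_prop)
        ((h n).cpt.comp_left (g := (· ^ 2)) (by simp))).integrableOn
    rw [ballTerm_ofTest]
    have h2 := integral_mono i3 ((i1.integrableOn.const_mul 2).add (i2.const_mul 2)) fun x => by
      simp only [Pi.add_apply]
      nlinarith [sq_nonneg (ballAvg ε (φ n) x + (ballAvg ε (φ n) x - φ n x))]
    have h3 := integral_add (i1.integrableOn (s := closedBall (0 : Eucl N) R) |>.const_mul 2)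
      (i2.const_mul 2)
    rw [integral_const_mul, integral_const_mul] at h3
    simp only [Pi.add_def] at h2
    rw [h3] at h2
    linarith
  rw [Metric.tendsto_atTop]
  intro δ hδ
  obtain ⟨ε, hε, hεδ⟩ : ∃ ε : ℝ, 0 < ε ∧ 2 * (ε ^ 2 * K ^ 2) < δ / 2 := by
    have : Tendsto (fun ε : ℝ => 2 * (ε ^ 2 * K ^ 2)) (𝓝[>] 0) (𝓝 0) := by
      have : Continuous fun ε : ℝ => 2 * (ε ^ 2 * K ^ 2) := by fun_prop
      simpa using (this.tendsto 0).mono_left nhdsWithin_le_nhds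
    obtain ⟨ε, h1, h2⟩ := ((this.eventually_lt_const (by linarith : (0 : ℝ) < δ / 2)).and
      self_mem_nhdsWithin).exists
    exact ⟨ε, h2, h1⟩
  obtain ⟨n₀, hn₀⟩ := eventually_atTop.1
    ((havg ε hε).eventually_lt_const (by linarith : (0 : ℝ) < δ / 4))
  refine ⟨n₀, fun n hn => ?_⟩
  rw [Real.dist_eq, sub_zero, abs_of_nonneg (ballTerm_nonneg _ _)]
  have := hle ε hε n
  have := hn₀ n hn
  linarith

theorem exists_test_near (u : D12 N) {ε : ℝ} (hε : 0 < ε) :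
    ∃ (φ : Eucl N → ℝ) (h : IsTest φ), ‖u - ofTest h‖ < ε := by
  have hd : u ∈ closure {v : D12 N | ∃ (φ : Eucl N → ℝ) (h : IsTest φ), v = ofTest h} :=
    D12.induction_test (P := fun u => u ∈ closure
      {v : D12 N | ∃ (φ : Eucl N → ℝ) (h : IsTest φ), v = ofTest h}) isClosed_closure
      (fun φ h => subset_closure ⟨φ, h, rfl⟩) u
  obtain ⟨v, ⟨φ, h, rfl⟩, hv⟩ := Metric.mem_closure_iff.1 hd ε hε
  exact ⟨φ, h, by rwa [dist_eq_norm] at hv⟩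

theorem integrableOn_fn_sq (R : ℝ) (u : D12 N) :
    IntegrableOn (fun x => u.fn x ^ 2) (closedBall (0 : Eucl N) R) := by
  have := (hardyPot_ball (N := N) R).integrable_mul_sq u
  simp only [indicator_mul_sq _ (fun x => u.fn x)] at this
  exact (integrable_indicator_iff measurableSet_closedBall).1 this

theorem ballTerm_add_le (R : ℝ) (u v : D12 N) :
    ballTerm R (u + v) ≤ 2 * ballTerm R u + 2 * ballTerm R v := by
  have i1 := (integrableOn_fn_sq R u).const_mul 2
  have i2 := (integrableOn_fn_sq R v).const_mul 2
  have h1 := integral_mono_ae (integrableOn_fn_sq R (u + v)) (i1.add i2) (by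
    filter_upwards [ae_restrict_of_ae (fn_add_ae u v)] with x hx
    simp only [Pi.add_apply, hx]
    nlinarith [sq_nonneg (u.fn x - v.fn x)])
  have h2 := integral_add i1 i2
  rw [integral_const_mul, integral_const_mul] at h2
  simp only [Pi.add_def] at h1
  rw [h2] at h1
  exact h1

/-- **Local compactness**: weakly null sequences tend to zero in `L²_loc`. -/
theorem tendsto_ballTerm (w : ℕ → D12 N) {K : ℝ} (hK : ∀ n, ‖w n‖ ≤ K)
    (hw : ∀ f : D12 N →L[ℝ] ℝ, Tendsto (fun n => f (w n)) atTop (𝓝 0)) (R : ℝ) :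
    Tendsto (fun n => ballTerm R (w n)) atTop (𝓝 0) := by
  have hpos : ∀ n : ℕ, (0 : ℝ) < 1 / ((n : ℝ) + 1) := fun n => by positivity
  choose φ h hφ using fun n => exists_test_near (w n) (hpos n)
  have hd : Tendsto (fun n => w n - ofTest (h n)) atTop (𝓝 0) :=
    squeeze_zero_norm (fun n => (hφ n).le) tendsto_one_div_add_atTop_nhds_zero_nat
  have hK' : ∀ n, ‖ofTest (h n)‖ ≤ K + 1 := fun n => by
    have h1 : ‖ofTest (h n)‖ ≤ ‖w n‖ + ‖w n - ofTest (h n)‖ := by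
      have := norm_sub_le (w n) (w n - ofTest (h n))
      rwa [sub_sub_cancel] at this
    have h2 : (1 : ℝ) / ((n : ℝ) + 1) ≤ 1 := by
      rw [div_le_one (by positivity)]
      linarith [(Nat.cast_nonneg n : (0 : ℝ) ≤ n)]
    linarith [hφ n, hK n]
  have hw' : ∀ f : D12 N →L[ℝ] ℝ, Tendsto (fun n => f (ofTest (h n))) atTop (𝓝 0) := fun f => by
    have := (hw f).sub ((f.continuous.tendsto 0).comp hd)
    simpa using this
  have h1 := tendsto_ballTerm_of_test φ h hK' hw' R
  obtain ⟨C, hC, hb⟩ := exists_ballTerm_le (N := N) R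
  have h2 : Tendsto (fun n => 2 * ballTerm R (ofTest (h n)) +
      2 * (C * ‖w n - ofTest (h n)‖ ^ 2)) atTop (𝓝 0) := by
    simpa using (h1.const_mul 2).add (((hd.norm.pow 2).const_mul C).const_mul 2)
  refine squeeze_zero (fun n => ballTerm_nonneg _ _) (fun n => ?_) h2
  have := ballTerm_add_le R (ofTest (h n)) (w n - ofTest (h n))
  rw [add_sub_cancel] at this
  linarith [hb (w n - ofTest (h n))]

end LocalCompactness

section Scaling

section Dilation

variable {N : ℕ}

theorem integral_comp_affine (f : Eucl N → ℝ) {t : ℝ} (ht : 0 < t) (a : Eucl N) :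
    ∫ x, f x = t ^ N * ∫ y, f (t • y + a) := by
  have h1 := Measure.integral_comp_smul (volume : Measure (Eucl N)) (fun x => f (x + a)) t
  rw [integral_add_right_eq_self f a, finrank_euclideanSpace_fin,
    abs_of_pos (by positivity), smul_eq_mul] at h1
  rw [h1, mul_inv_cancel_left₀ (by positivity)]

/-- The function `φ` concentrated at scale `t` around `a`. -/
def dilate (t : ℝ) (a : Eucl N) (φ : Eucl N → ℝ) (x : Eucl N) : ℝ := φ (t⁻¹ • (x - a))

theorem dilate_apply {t : ℝ} (ht : 0 < t) (a : Eucl N) (φ : Eucl N → ℝ) (y : Eucl N) :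
    dilate t a φ (t • y + a) = φ y := by
  rw [dilate, add_sub_cancel_right, smul_smul, inv_mul_cancel₀ ht.ne', one_smul]

theorem IsTest.dilate {φ : Eucl N → ℝ} (h : IsTest φ) {t : ℝ} (ht : 0 < t) (a : Eucl N) :
    IsTest (dilate t a φ) := by
  refine ⟨?_, ?_⟩
  · have := h.smooth
    unfold MultiSing.dilate
    fun_prop
  · let e : Eucl N ≃ₜ Eucl N :=
      (Homeomorph.subRight a).trans (Homeomorph.smulOfNeZero t⁻¹ (inv_ne_zero ht.ne'))
    exact h.cpt.comp_homeomorph e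

theorem gradient_dilate {φ : Eucl N → ℝ} (h : IsTest φ) {t : ℝ} (ht : 0 < t) (a y : Eucl N) :
    gradient (dilate t a φ) (t • y + a) = t⁻¹ • gradient φ y := by
  have h1 : HasFDerivAt (fun x : Eucl N => t⁻¹ • (x - a))
      (t⁻¹ • ContinuousLinearMap.id ℝ (Eucl N)) (t • y + a) :=
    ((hasFDerivAt_id _).sub_const a).const_smul t⁻¹
  have e : t⁻¹ • (t • y + a - a) = y := by
    rw [add_sub_cancel_right, smul_smul, inv_mul_cancel₀ ht.ne', one_smul]
  have h2 : HasFDerivAt φ (fderiv ℝ φ y) (t⁻¹ • (t • y + a - a)) := by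
    rw [e]; exact (h.differentiable y).hasFDerivAt
  have h3 : HasFDerivAt (dilate t a φ) _ _ := h2.comp (t • y + a) h1
  refine ext_inner_right ℝ fun v => ?_
  simp [gradient, h3.fderiv, real_inner_smul_left]

theorem polePot_affine (h : Sph N → ℝ) {t : ℝ} (ht : 0 < t) (a b y : Eucl N) :
    polePot h b (t • y + a) = (t ^ 2)⁻¹ * polePot h (t⁻¹ • (b - a)) y := by
  have e : t • y + a - b = t • (y - t⁻¹ • (b - a)) := by
    rw [smul_sub, smul_smul, mul_inv_cancel₀ ht.ne', one_smul]
    abel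
  rw [polePot, polePot, e, angular_smul ht, norm_smul, Real.norm_of_nonneg ht.le, mul_pow,
    div_eq_mul_inv, div_eq_mul_inv, mul_inv]
  ring

theorem exists_test_bump (R : ℝ) : ∃ ψ : Eucl N → ℝ, IsTest ψ ∧ (∀ x, ‖x‖ ≤ R → ψ x = 1) ∧
    (∀ x, 0 ≤ ψ x ∧ ψ x ≤ 1) ∧ ∀ x, |R| + 2 ≤ ‖x‖ → ψ x = 0 := by
  let f : ContDiffBump (0 : Eucl N) := ⟨|R| + 1, |R| + 2, by positivity, by linarith⟩
  refine ⟨f, ⟨f.contDiff, f.hasCompactSupport⟩, fun x hx => ?_, fun x => ⟨f.nonneg, f.le_one⟩,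
    fun x hx => ?_⟩
  · exact f.one_of_mem_closedBall (by
      rw [mem_closedBall_zero_iff]
      exact hx.trans ((le_abs_self R).trans (by simp [f])))
  · exact f.zero_of_le_dist (by simpa [f] using hx)

theorem IsTest.exists_support_bound {φ : Eucl N → ℝ} (h : IsTest φ) :
    ∃ R : ℝ, 0 ≤ R ∧ ∀ x, φ x ≠ 0 → ‖x‖ ≤ R := by
  obtain ⟨R, hR⟩ := h.cpt.isCompact.isBounded.subset_closedBall 0
  refine ⟨|R|, abs_nonneg R, fun x hx => ?_⟩
  have := hR (subset_tsupport _ hx)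
  rw [mem_closedBall_zero_iff] at this
  exact this.trans (le_abs_self R)

theorem polePot_sum {k : ℕ} (h : Fin k → Sph N → ℝ) (b x : Eucl N) :
    polePot (∑ j, h j) b x = ∑ j, polePot (h j) b x := by
  simp only [polePot, angular_sum, Finset.sum_div]

end Dilation

variable {N : ℕ} [hN : Fact (3 ≤ N)]

theorem potTerm_ofTest (V : Eucl N → ℝ) {φ : Eucl N → ℝ} (h : IsTest φ) :
    potTerm V (ofTest h) = ∫ x, V x * φ x ^ 2 := by
  refine integral_congr_ae ?_
  filter_upwards [ofTest_fn h] with x hx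
  rw [hx]

theorem critTerm_ofTest {φ : Eucl N → ℝ} (h : IsTest φ) :
    critTerm (ofTest h) = ∫ x, |φ x| ^ crit N := by
  refine integral_congr_ae ?_
  filter_upwards [ofTest_fn h] with x hx
  rw [hx]

theorem norm_sq_dilate {φ : Eucl N → ℝ} (h : IsTest φ) {t : ℝ} (ht : 0 < t) (a : Eucl N) :
    ‖ofTest (h.dilate ht a)‖ ^ 2 = t ^ N * (t ^ 2)⁻¹ * ‖ofTest h‖ ^ 2 := by
  rw [ofTest_norm_sq, ofTest_norm_sq, integral_comp_affine _ ht a, mul_assoc]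
  congr 1
  rw [← integral_const_mul]
  refine integral_congr_ae (Eventually.of_forall fun y => ?_)
  simp only [gradient_dilate h ht, norm_smul, norm_inv, Real.norm_of_nonneg ht.le, mul_pow, inv_pow]

theorem potTerm_dilate (h : Sph N → ℝ) {φ : Eucl N → ℝ} (hφ : IsTest φ) {t : ℝ} (ht : 0 < t)
    (a b : Eucl N) : potTerm (polePot h b) (ofTest (hφ.dilate ht a)) =
      t ^ N * (t ^ 2)⁻¹ * potTerm (polePot h (t⁻¹ • (b - a))) (ofTest hφ) := by
  rw [potTerm_ofTest, potTerm_ofTest, integral_comp_affine _ ht a, mul_assoc]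
  congr 1
  rw [← integral_const_mul]
  refine integral_congr_ae (Eventually.of_forall fun y => ?_)
  simp only [polePot_affine h ht, dilate_apply ht, mul_assoc]

theorem norm_fn_translate {φ : Eucl N → ℝ} (h : IsTest φ) (a : Eucl N) :
    ‖(ofTest (h.dilate one_pos a)).fn‖ ^ 2 = ‖(ofTest h).fn‖ ^ 2 := by
  rw [← critTerm_rpow, ← critTerm_rpow, critTerm_ofTest, critTerm_ofTest,
    integral_comp_affine _ one_pos a]
  simp only [dilate_apply one_pos, one_pow, one_mul]

theorem integrable_bound_ball (R : ℝ) : Integrable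
    (fun x : Eucl N => (closedBall (0 : Eucl N) R).indicator (fun _ => (1 : ℝ)) x *
      (‖x‖ ^ 2)⁻¹) := by
  obtain ⟨ψ, hψ, h1, h2, -⟩ := exists_test_bump (N := N) R
  have := (hardyPot_invSq (N := N) 0).integrable_mul_sq (ofTest hψ)
  refine this.mono' ?_ ?_
  · exact (aestronglyMeasurable_const.indicator measurableSet_closedBall).mul
      (by simpa using aesm_invSq (0 : Eucl N))
  · filter_upwards [ofTest_fn hψ] with x hx
    rw [hx, sub_zero]
    by_cases hR : x ∈ closedBall (0 : Eucl N) R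
    · rw [h1 x (by simpa using hR), Set.indicator_of_mem hR]
      simp
    · rw [Set.indicator_of_notMem hR, zero_mul, norm_zero]
      positivity

theorem potTerm_polePot_translate (h : Sph N → ℝ) {φ : Eucl N → ℝ} (hφ : IsTest φ) (b : Eucl N) :
    potTerm (polePot h b) (ofTest hφ) = ∫ y, polePot h 0 y * φ (y + b) ^ 2 := by
  rw [potTerm_ofTest, ← integral_add_right_eq_self _ b]
  simp [polePot]

theorem tendsto_potTerm_zero {h : Sph N → ℝ} (hc : Continuous h) {φ : Eucl N → ℝ}
    (hφ : IsTest φ) {b : ℕ → Eucl N} (hb : Tendsto b atTop (𝓝 0)) :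
    Tendsto (fun n => potTerm (polePot h (b n)) (ofTest hφ)) atTop
      (𝓝 (potTerm (polePot h 0) (ofTest hφ))) := by
  obtain ⟨M, hM, hbd⟩ := exists_polePot_bound hc
  obtain ⟨K, hK⟩ := hφ.cpt.exists_bound_of_continuous hφ.continuous
  obtain ⟨R, hR0, hR⟩ := hφ.exists_support_bound
  have cφ := hφ.continuous
  simp only [potTerm_polePot_translate]
  refine tendsto_integral_filter_of_dominated_convergence (fun x => M * K ^ 2 *
    ((closedBall (0 : Eucl N) (R + 1)).indicator (fun _ => (1 : ℝ)) x * (‖x‖ ^ 2)⁻¹)) ?_ ?_ ?_ ?_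
  · refine Eventually.of_forall fun n => ?_
    exact ((measurable_polePot hc 0).mul
      (by fun_prop : Continuous fun y => φ (y + b n) ^ 2).measurable).aestronglyMeasurable
  · have : ∀ᶠ n in atTop, ‖b n‖ < 1 := by
      have := hb.norm
      rw [norm_zero] at this
      exact this.eventually_lt_const one_pos
    filter_upwards [this] with n hn
    refine Eventually.of_forall fun x => ?_
    by_cases hx : x ∈ closedBall (0 : Eucl N) (R + 1)
    · rw [Set.indicator_of_mem hx, one_mul, norm_mul, norm_pow, Real.norm_eq_abs]
      have h1 := hbd 0 x
      rw [sub_zero] at h1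
      calc |polePot h 0 x| * ‖φ (x + b n)‖ ^ 2 ≤ (M * (‖x‖ ^ 2)⁻¹) * K ^ 2 := by
            gcongr
            exact hK _
        _ = _ := by ring
    · have : φ (x + b n) = 0 := by
        by_contra hne
        have h1 := hR _ hne
        have h2 : ‖x‖ ≤ ‖x + b n‖ + ‖b n‖ := by
          have := norm_sub_le (x + b n) (b n)
          rwa [add_sub_cancel_right] at this
        exact hx (by rw [mem_closedBall_zero_iff]; linarith)
      rw [this, Set.indicator_of_notMem hx]
      simp
  · exact (integrable_bound_ball (R + 1)).const_mul _
  · refine Eventually.of_forall fun x => ?_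
    have : Tendsto (fun n => φ (x + b n)) atTop (𝓝 (φ (x + 0))) :=
      (cφ.tendsto _).comp (hb.const_add x)
    exact (this.pow 2).const_mul _

theorem tendsto_potTerm_infty {h : Sph N → ℝ} (hc : Continuous h) {φ : Eucl N → ℝ}
    (hφ : IsTest φ) {b : ℕ → Eucl N} (hb : Tendsto (fun n => ‖b n‖) atTop atTop) :
    Tendsto (fun n => potTerm (polePot h (b n)) (ofTest hφ)) atTop (𝓝 0) := by
  obtain ⟨M, hM, hbd⟩ := exists_polePot_bound hc
  obtain ⟨R, hR0, hR⟩ := hφ.exists_support_bound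
  have cφ := hφ.continuous
  have hsq : Integrable fun x => φ x ^ 2 :=
    Continuous.integrable_of_hasCompactSupport (by fun_prop)
      (hφ.cpt.comp_left (g := (· ^ 2)) (by simp))
  have hlim : Tendsto (fun n => (M * ((‖b n‖ - R) ^ 2)⁻¹) * ∫ x, φ x ^ 2) atTop (𝓝 0) := by
    have h1 : Tendsto (fun n => (‖b n‖ - R) ^ 2) atTop atTop :=
      (tendsto_pow_atTop two_ne_zero).comp (tendsto_atTop_add_const_right _ (-R) hb)
    simpa using (h1.inv_tendsto_atTop.const_mul M).mul_const (∫ x, φ x ^ 2)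
  refine squeeze_zero_norm' ?_ hlim
  filter_upwards [hb.eventually_gt_atTop R] with n hn
  rw [potTerm_ofTest, ← integral_const_mul]
  refine norm_integral_le_of_norm_le (hsq.const_mul _) (Eventually.of_forall fun x => ?_)
  rw [norm_mul, norm_pow, Real.norm_eq_abs, Real.norm_eq_abs, sq_abs]
  by_cases hx : φ x = 0
  · simp [hx]
  have h1 := hR x hx
  have h2 : ‖b n‖ - R ≤ ‖x - b n‖ := by
    have := norm_sub_norm_le (b n) x
    rw [norm_sub_rev] at this
    linarith
  gcongr
  refine (hbd _ _).trans ?_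
  have : 0 < ‖b n‖ - R := by linarith
  gcongr

section Constants

variable {k : ℕ} {h : Fin k → Sph N → ℝ} {a : Fin k → Eucl N}

theorem mu_mul_le_Q (hpos : 0 < mu h a) (u : D12 N) : mu h a * ‖u‖ ^ 2 ≤ Q h a u := by
  have hbdd : BddBelow (Set.range fun u : {u : D12 N // u ≠ 0} => Q h a u.1 / ‖u.1‖ ^ 2) := by
    by_contra hn
    exact hpos.ne' (Real.sInf_of_not_bddBelow hn)
  by_cases hu : u = 0
  · have h0 : ∀ᵐ x, (0 : D12 N).fn x = 0 := Lp.coeFn_zero _ _ _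
    have : ∀ i, poleTerm (h i) (a i) (0 : D12 N) = 0 := fun i =>
      integral_eq_zero_of_ae (by filter_upwards [h0] with x hx; simp [hx])
    subst hu
    simp [Q, dirichlet_eq, this]
  · have h1 : mu h a ≤ Q h a u / ‖u‖ ^ 2 := ciInf_le hbdd ⟨u, hu⟩
    have h2 : 0 < ‖u‖ ^ 2 := by
      have := norm_pos_iff.2 hu
      positivity
    rwa [le_div_iff₀ h2] at h1

theorem Q_nonneg (hpos : 0 < mu h a) (u : D12 N) : 0 ≤ Q h a u :=
  (by positivity : 0 ≤ mu h a * ‖u‖ ^ 2).trans (mu_mul_le_Q hpos u)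

theorem sum_potTerm_le (hpos : 0 < mu h a) {φ : Eucl N → ℝ}
    (hφ : IsTest φ) {t : ℝ} (ht : 0 < t) (b : Eucl N) :
    ∑ i, potTerm (polePot (h i) (t⁻¹ • (a i - b))) (ofTest hφ) ≤ ‖ofTest hφ‖ ^ 2 := by
  have h1 := Q_nonneg hpos (ofTest (hφ.dilate ht b))
  unfold Q at h1
  simp only [dirichlet_eq, poleTerm_eq, potTerm_dilate _ hφ ht] at h1
  rw [norm_sq_dilate hφ ht, ← Finset.mul_sum, ← mul_sub] at h1
  have h2 : 0 < t ^ N * (t ^ 2)⁻¹ := by positivity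
  have := nonneg_of_mul_nonneg_right h1 h2
  linarith

theorem potTerm_le_of_test {V : Eucl N → ℝ} (hV : HardyPot V)
    (ht : ∀ (φ : Eucl N → ℝ) (hφ : IsTest φ), potTerm V (ofTest hφ) ≤ ‖ofTest hφ‖ ^ 2)
    (u : D12 N) : potTerm V u ≤ ‖u‖ ^ 2 :=
  D12.induction_test (P := fun u => potTerm V u ≤ ‖u‖ ^ 2)
    (isClosed_le hV.continuous_potTerm (by fun_prop)) ht u

/-- Positivity of the one-pole forms, by concentration at a pole. -/
theorem potTerm_pole_le (hc : ∀ i, Continuous (h i)) (ha : Function.Injective a)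
    (hpos : 0 < mu h a) (i : Fin k) (u : D12 N) :
    potTerm (polePot (h i) 0) u ≤ ‖u‖ ^ 2 := by
  refine potTerm_le_of_test (hardyPot_polePot (hc i) 0) (fun φ hφ => ?_) u
  have hlim : Tendsto (fun n : ℕ => ∑ j, potTerm (polePot (h j)
      ((1 / ((n : ℝ) + 1))⁻¹ • (a j - a i))) (ofTest hφ)) atTop
      (𝓝 (∑ j, if j = i then potTerm (polePot (h i) 0) (ofTest hφ) else 0)) := by
    refine tendsto_finsetSum _ fun j _ => ?_
    split_ifs with hj
    · subst hj
      simp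
    · refine tendsto_potTerm_infty (hc j) hφ ?_
      have hne : 0 < ‖a j - a i‖ := norm_pos_iff.2 (sub_ne_zero.2 fun e => hj (ha e))
      have : Tendsto (fun n : ℕ => ((n : ℝ) + 1) * ‖a j - a i‖) atTop atTop :=
        (tendsto_atTop_add_const_right _ 1 tendsto_natCast_atTop_atTop).atTop_mul_const hne
      refine this.congr fun n => ?_
      rw [norm_smul, one_div, inv_inv, Real.norm_of_nonneg (by positivity)]
  rw [Finset.sum_ite_eq' Finset.univ i, if_pos (Finset.mem_univ i)] at hlim
  exact le_of_tendsto hlim (Eventually.of_forall fun n =>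
    sum_potTerm_le hpos hφ (by positivity) (a i))

/-- Positivity of the form at infinity, by spreading. -/
theorem potTerm_infty_le (hc : ∀ i, Continuous (h i)) (hpos : 0 < mu h a) (u : D12 N) :
    potTerm (polePot (∑ j, h j) 0) u ≤ ‖u‖ ^ 2 := by
  have hcs : Continuous (∑ j, h j) := by
    have := continuous_finsetSum Finset.univ fun i _ => hc i
    convert this using 1
    ext x
    simp
  refine potTerm_le_of_test (hardyPot_polePot hcs 0) (fun φ hφ => ?_) u
  have e : polePot (∑ j, h j) (0 : Eucl N) = fun x => ∑ j, polePot (h j) 0 x :=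
    funext fun x => polePot_sum h 0 x
  rw [e, potTerm_sum _ fun i _ => hardyPot_polePot (hc i) 0]
  have hlim : Tendsto (fun n : ℕ => ∑ j, potTerm (polePot (h j)
      (((n : ℝ) + 1)⁻¹ • (a j - 0))) (ofTest hφ)) atTop
      (𝓝 (∑ j, potTerm (polePot (h j) 0) (ofTest hφ))) := by
    refine tendsto_finsetSum _ fun j _ => tendsto_potTerm_zero (hc j) hφ ?_
    have := tendsto_one_div_add_atTop_nhds_zero_nat (𝕜 := ℝ)
    simpa using this.smul_const (a j)
  exact le_of_tendsto hlim (Eventually.of_forall fun n =>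
    sum_potTerm_le hpos hφ (by positivity) 0)

theorem iInf_div_mul_le {F : D12 N → ℝ} (hF : ∀ u, 0 ≤ F u) :
    0 ≤ (⨅ u : {u : D12 N // u ≠ 0}, F u.1 / ‖u.1.fn‖ ^ 2) ∧
      ∀ u, (⨅ u : {u : D12 N // u ≠ 0}, F u.1 / ‖u.1.fn‖ ^ 2) * ‖u.fn‖ ^ 2 ≤ F u := by
  have hnn : ∀ u : {u : D12 N // u ≠ 0}, 0 ≤ F u.1 / ‖u.1.fn‖ ^ 2 := fun u =>
    div_nonneg (hF _) (by positivity)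
  refine ⟨Real.iInf_nonneg hnn, fun u => ?_⟩
  by_cases hu : u.fn = 0
  · rw [hu]
    simpa using hF u
  · have hu0 : u ≠ 0 := fun e => hu (by rw [e]; rfl)
    have := ciInf_le ⟨(0 : ℝ), by rintro _ ⟨v, rfl⟩; exact hnn v⟩ (⟨u, hu0⟩ : {u : D12 N // u ≠ 0})
    have h2 : 0 < ‖u.fn‖ ^ 2 := by
      have := norm_pos_iff.2 hu
      positivity
    rwa [le_div_iff₀ h2] at this

theorem SOne_mul_le {g : Sph N → ℝ} (hg : ∀ u : D12 N, potTerm (polePot g 0) u ≤ ‖u‖ ^ 2) :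
    0 ≤ SOne g ∧ ∀ u : D12 N, SOne g * ‖u.fn‖ ^ 2 ≤ ‖u‖ ^ 2 - potTerm (polePot g 0) u := by
  have := iInf_div_mul_le (F := fun u : D12 N => ‖u‖ ^ 2 - potTerm (polePot g 0) u)
    fun u => by linarith [hg u]
  unfold SOne
  simpa only [critTerm_rpow, dirichlet_eq, poleTerm_eq] using this

theorem SSob_mul_le : 0 ≤ SSob N ∧ ∀ u : D12 N, SSob N * ‖u.fn‖ ^ 2 ≤ ‖u‖ ^ 2 :=
  iInf_div_mul_le (F := fun u : D12 N => ‖u‖ ^ 2) fun u => by positivity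

theorem SMulti_pos (hpos : 0 < mu h a) : 0 < SMulti h a := by
  obtain ⟨C, hC⟩ := exists_sobolev N
  have hne : Nonempty {u : D12 N // u ≠ 0} := by
    by_contra hn
    rw [not_nonempty_iff] at hn
    exact hpos.ne' (Real.iInf_of_isEmpty _)
  have hC0 : 0 < C ^ 2 := by
    obtain ⟨u, hu⟩ := hne
    have hf : u.fn ≠ 0 := fun e => hu (eq_zero_of_fn_eq_zero e)
    have : C ≠ 0 := fun e => by
      have h1 := hC u
      rw [e, zero_mul] at h1
      exact hf (norm_le_zero_iff.1 h1)
    positivity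
  have : mu h a / C ^ 2 ≤ SMulti h a := by
    refine le_ciInf fun u => ?_
    rw [critTerm_rpow]
    have hf : 0 < ‖u.1.fn‖ := norm_pos_iff.2 fun e => u.2 (eq_zero_of_fn_eq_zero e)
    rw [le_div_iff₀ (by positivity)]
    have h1 : ‖u.1.fn‖ ^ 2 ≤ C ^ 2 * ‖u.1‖ ^ 2 := by
      rw [← mul_pow]
      exact pow_le_pow_left₀ hf.le (hC u.1) 2
    calc mu h a / C ^ 2 * ‖u.1.fn‖ ^ 2 ≤ mu h a / C ^ 2 * (C ^ 2 * ‖u.1‖ ^ 2) := by gcongr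
      _ = mu h a * ‖u.1‖ ^ 2 := by rw [← mul_assoc, div_mul_cancel₀ _ hC0.ne']
      _ ≤ _ := mu_mul_le_Q hpos u.1
  exact (by positivity : 0 < mu h a / C ^ 2).trans_le this

theorem minLevel_props (hc : ∀ i, Continuous (h i)) (ha : Function.Injective a)
    (hpos : 0 < mu h a) : 0 ≤ minLevel h ∧ minLevel h ≤ SSob N ∧
      minLevel h ≤ SOne (∑ j, h j) ∧ ∀ i, minLevel h ≤ SOne (h i) := by
  have hfin : BddBelow (insert (SSob N) (insert (SOne (∑ j, h j))
      (Set.range fun i => SOne (h i)))) :=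
    (((Set.finite_range _).insert _).insert _).bddBelow
  refine ⟨Real.sInf_nonneg ?_, csInf_le hfin (Set.mem_insert _ _),
    csInf_le hfin (Set.mem_insert_of_mem _ (Set.mem_insert _ _)),
    fun i => csInf_le hfin (Set.mem_insert_of_mem _ (Set.mem_insert_of_mem _ ⟨i, rfl⟩))⟩
  rintro _ (rfl | rfl | ⟨i, rfl⟩)
  · exact SSob_mul_le.1
  · exact (SOne_mul_le (potTerm_infty_le hc hpos)).1
  · exact (SOne_mul_le (potTerm_pole_le hc ha hpos i)).1

end Constants

end Scaling

section Localization

section Pointwise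

variable {N : ℕ}

/-- `V ≤ W` on `A`, up to bounded compactly supported functions and small multiples of
`|x|⁻²`. -/
def PertLE (V W : Eucl N → ℝ) (A : Set (Eucl N)) : Prop :=
  ∀ ε > 0, ∃ C R : ℝ, 0 ≤ C ∧ ∀ x ∈ A, V x ≤ W x +
    C * (closedBall (0 : Eucl N) R).indicator (fun _ => (1 : ℝ)) x + ε * (‖x‖ ^ 2)⁻¹

theorem PertLE.of_bound {V W : Eucl N → ℝ} {A : Set (Eucl N)} {C R : ℝ} (hC : 0 ≤ C)
    (h : ∀ x ∈ A, V x ≤ W x + C * (closedBall (0 : Eucl N) R).indicator (fun _ => (1 : ℝ)) x) :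
    PertLE V W A := fun ε hε => ⟨C, R, hC, fun x hx => (h x hx).trans (by
      have : 0 ≤ ε * (‖x‖ ^ 2)⁻¹ := by positivity
      linarith)⟩

theorem IsTest.const_mul {φ : Eucl N → ℝ} (h : IsTest φ) (c : ℝ) : IsTest (fun x => c * φ x) :=
  h.mul_smooth contDiff_const

theorem IsTest.cos_mul {φ θ : Eucl N → ℝ} (h : IsTest φ) (hθ : IsTest θ) :
    IsTest (fun x => Real.cos (θ x) * φ x) :=
  h.mul_smooth (Real.contDiff_cos.comp hθ.smooth)

theorem IsTest.sin_mul {φ θ : Eucl N → ℝ} (h : IsTest φ) (hθ : IsTest θ) :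
    IsTest (fun x => Real.sin (θ x) * φ x) :=
  h.mul_smooth (Real.contDiff_sin.comp hθ.smooth)

theorem norm_sq_gradient_cos_add_sin {φ θ : Eucl N → ℝ} (h : IsTest φ) (hθ : IsTest θ)
    (x : Eucl N) :
    ‖gradient (fun x => Real.cos (θ x) * φ x) x‖ ^ 2 +
      ‖gradient (fun x => Real.sin (θ x) * φ x) x‖ ^ 2 =
      ‖gradient φ x‖ ^ 2 + ‖gradient θ x‖ ^ 2 * φ x ^ 2 := by
  have dθ := (hθ.differentiable x).hasFDerivAt
  have dφ := (h.differentiable x).hasFDerivAt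
  have e1 : gradient (fun x => Real.cos (θ x) * φ x) x =
      Real.cos (θ x) • gradient φ x + (-(φ x * Real.sin (θ x))) • gradient θ x := by
    refine ext_inner_right ℝ fun v => ?_
    rw [inner_add_left, real_inner_smul_left, real_inner_smul_left]
    simp only [gradient, InnerProductSpace.toDual_symm_apply]
    rw [(dθ.cos.fun_mul dφ).fderiv]
    simp
    ring
  have e2 : gradient (fun x => Real.sin (θ x) * φ x) x =
      Real.sin (θ x) • gradient φ x + (φ x * Real.cos (θ x)) • gradient θ x := by
    refine ext_inner_right ℝ fun v => ?_
    rw [inner_add_left, real_inner_smul_left, real_inner_smul_left]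
    simp only [gradient, InnerProductSpace.toDual_symm_apply]
    rw [(dθ.sin.fun_mul dφ).fderiv]
    simp
    ring
  rw [e1, e2, norm_add_sq_real, norm_add_sq_real]
  simp only [norm_smul, real_inner_smul_left, real_inner_smul_right, mul_pow, Real.norm_eq_abs,
    sq_abs]
  have := Real.sin_sq_add_cos_sq (θ x)
  linear_combination (‖gradient φ x‖ ^ 2 + ‖gradient θ x‖ ^ 2 * φ x ^ 2) * this

theorem IsTest.exists_gradient_bound {θ : Eucl N → ℝ} (h : IsTest θ) :
    ∃ K R : ℝ, 0 ≤ K ∧ ∀ x, ‖gradient θ x‖ ^ 2 ≤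
      K * (closedBall (0 : Eucl N) R).indicator (fun _ => (1 : ℝ)) x := by
  obtain ⟨C, hC⟩ := h.hasCompactSupport_gradient.exists_bound_of_continuous h.continuous_gradient
  obtain ⟨R, hR⟩ := h.hasCompactSupport_gradient.isCompact.isBounded.subset_closedBall 0
  refine ⟨C ^ 2, R, sq_nonneg C, fun x => ?_⟩
  by_cases hx : x ∈ closedBall (0 : Eucl N) R
  · rw [Set.indicator_of_mem hx, mul_one]
    gcongr
    exact hC x
  · rw [Set.indicator_of_notMem hx, image_eq_zero_of_notMem_tsupport fun h => hx (hR h)]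
    simp

/-- Far from the origin, the position of the pole does not matter. -/
theorem exists_polePot_near {h : Sph N → ℝ} (hc : Continuous h) (b : Eucl N) {ε : ℝ}
    (hε : 0 < ε) : ∃ R : ℝ, 0 ≤ R ∧ ∀ x, R < ‖x‖ →
      |polePot h b x - polePot h 0 x| ≤ ε * (‖x‖ ^ 2)⁻¹ := by
  have hG : ∀ z : Eucl N, z ≠ 0 → ContinuousAt (fun z => angular h z / ‖z‖ ^ 2) z :=
    fun z hz => by
      have h1 : ContinuousAt (angular h) z :=
        (continuousOn_angular hc).continuousAt (isOpen_compl_singleton.mem_nhds hz)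
      exact h1.div (by fun_prop) (by positivity)
  have hu := (isCompact_sphere (0 : Eucl N) 1).uniformContinuousAt_of_continuousAt
    (fun z => angular h z / ‖z‖ ^ 2) (fun z hz => hG z (by
      rintro rfl
      simp at hz)) (Metric.dist_mem_uniformity hε)
  obtain ⟨δ, hδ, hδ'⟩ := Metric.mem_uniformity_dist.1 hu
  refine ⟨‖b‖ / δ, by positivity, fun x hx => ?_⟩
  have hx0 : 0 < ‖x‖ := lt_of_le_of_lt (by positivity) hx
  set z₀ := ‖x‖⁻¹ • x with hz
  have hzs : z₀ ∈ sphere (0 : Eucl N) 1 := by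
    rw [mem_sphere_zero_iff_norm, hz, norm_smul, norm_inv, norm_norm, inv_mul_cancel₀ hx0.ne']
  have hxz : x = ‖x‖ • z₀ + 0 := by
    rw [hz, smul_smul, mul_inv_cancel₀ hx0.ne', one_smul, add_zero]
  have hd : dist z₀ (z₀ - ‖x‖⁻¹ • b) < δ := by
    rw [dist_eq_norm, sub_sub_cancel, norm_smul, norm_inv, norm_norm, inv_mul_lt_iff₀ hx0]
    rwa [div_lt_iff₀ hδ] at hx
  have key := hδ' hd hzs
  rw [Set.mem_ofPred_eq, Real.dist_eq, abs_sub_comm] at key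
  have e1 : polePot h b x = (‖x‖ ^ 2)⁻¹ * (angular h (z₀ - ‖x‖⁻¹ • b) / ‖z₀ - ‖x‖⁻¹ • b‖ ^ 2) := by
    conv_lhs => rw [hxz, polePot_affine h hx0]
    rw [sub_zero, polePot]
  have e2 : polePot h 0 x = (‖x‖ ^ 2)⁻¹ * (angular h z₀ / ‖z₀‖ ^ 2) := by
    conv_lhs => rw [hxz, polePot_affine h hx0]
    rw [sub_zero, smul_zero, polePot, sub_zero]
  rw [e1, e2, ← mul_sub, abs_mul, abs_of_nonneg (by positivity : 0 ≤ (‖x‖ ^ 2)⁻¹), mul_comm]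
  gcongr

theorem IsTest.integrable_sq_gradient {φ : Eucl N → ℝ} (h : IsTest φ) :
    Integrable fun x => ‖gradient φ x‖ ^ 2 :=
  Continuous.integrable_of_hasCompactSupport (by have := h.continuous_gradient; fun_prop)
    (h.hasCompactSupport_gradient.norm.comp_left (g := (· ^ 2)) (by simp))

theorem pertLE_infty {k : ℕ} {h : Fin k → Sph N → ℝ} {a : Fin k → Eucl N}
    (hc : ∀ i, Continuous (h i)) {R : ℝ} (hR : ∀ i, ‖a i‖ + 1 ≤ R) (hR1 : 1 ≤ R) :
    PertLE (totalPot h a) (polePot (∑ j, h j) 0) {x | R ≤ ‖x‖} := by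
  intro ε hε
  choose M hM0 hM using fun i => exists_polePot_bound (hc i)
  have hη : 0 < ε / (k + 1) := by positivity
  choose R' hR'0 hR' using fun i => exists_polePot_near (hc i) (a i) hη
  refine ⟨∑ i, 2 * M i, ∑ i, R' i, Finset.sum_nonneg fun i _ => by linarith [hM0 i],
    fun x hx => ?_⟩
  rw [totalPot, polePot_sum]
  have hx' : R ≤ ‖x‖ := hx
  by_cases hxR : x ∈ closedBall (0 : Eucl N) (∑ i, R' i)
  · rw [Set.indicator_of_mem hxR, mul_one, ← Finset.sum_add_distrib]
    have : ∑ i, polePot (h i) (a i) x ≤ ∑ i, (polePot (h i) 0 x + 2 * M i) := by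
      refine Finset.sum_le_sum fun i _ => ?_
      have h1 : (‖x - a i‖ ^ 2)⁻¹ ≤ 1 := by
        refine inv_le_one_of_one_le₀ (one_le_pow₀ ?_)
        have := norm_sub_norm_le x (a i)
        linarith [hR i]
      have h2 : (‖x - 0‖ ^ 2)⁻¹ ≤ 1 := by
        refine inv_le_one_of_one_le₀ (one_le_pow₀ ?_)
        rw [sub_zero]; linarith
      have h3 := abs_le.1 (hM i (a i) x)
      have h4 := abs_le.1 (hM i 0 x)
      have h5 := mul_le_mul_of_nonneg_left h1 (hM0 i)
      have h6 := mul_le_mul_of_nonneg_left h2 (hM0 i)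
      linarith [h3.2, h4.1]
    have h0 : 0 ≤ ε * (‖x‖ ^ 2)⁻¹ := by positivity
    linarith
  · rw [Set.indicator_of_notMem hxR, mul_zero, add_zero]
    have hlt : ∑ i, R' i < ‖x‖ := by simpa using hxR
    have : ∑ i, polePot (h i) (a i) x ≤
        ∑ i, (polePot (h i) 0 x + ε / (k + 1) * (‖x‖ ^ 2)⁻¹) := by
      refine Finset.sum_le_sum fun i _ => ?_
      have h1 : R' i < ‖x‖ :=
        (Finset.single_le_sum (fun j _ => hR'0 j) (Finset.mem_univ i)).trans_lt hlt
      linarith [(abs_le.1 (hR' i x h1)).2]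
    refine this.trans ?_
    rw [Finset.sum_add_distrib, Finset.sum_const, Finset.card_univ, Fintype.card_fin, nsmul_eq_mul,
      ← mul_assoc]
    gcongr
    rw [mul_div_assoc', div_le_iff₀ (by positivity)]
    nlinarith

theorem exists_separation {k : ℕ} {a : Fin k → Eucl N} (ha : Function.Injective a) :
    ∃ r : ℝ, 0 < r ∧ r ≤ 1 ∧ ∀ i j, i ≠ j → 3 * r ≤ ‖a i - a j‖ := by
  have h1 : ∀ᶠ r : ℝ in 𝓝[>] 0, ∀ i j, i ≠ j → 3 * r ≤ ‖a i - a j‖ := by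
    simp only [eventually_all]
    intro i j hij
    have hpos : 0 < ‖a i - a j‖ := norm_pos_iff.2 (sub_ne_zero.2 fun e => hij (ha e))
    have : Tendsto (fun r : ℝ => 3 * r) (𝓝[>] 0) (𝓝 0) := by
      have : Continuous fun r : ℝ => 3 * r := by fun_prop
      simpa using (this.tendsto 0).mono_left nhdsWithin_le_nhds
    exact this.eventually_le_const hpos
  have h2 : ∀ᶠ r : ℝ in 𝓝[>] 0, r ≤ 1 :=
    (eventually_le_nhds one_pos).filter_mono nhdsWithin_le_nhds
  obtain ⟨r, ⟨hr1, hr2⟩, hr3⟩ := ((h1.and h2).and self_mem_nhdsWithin).exists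
  exact ⟨r, hr3, hr2, hr1⟩

end Pointwise

variable {N : ℕ} [hN : Fact (3 ≤ N)]

theorem ballTerm_mono {R R' : ℝ} (hR : R ≤ R') (u : D12 N) : ballTerm R u ≤ ballTerm R' u :=
  setIntegral_mono_set (integrableOn_fn_sq R' u) (Eventually.of_forall fun _ => sq_nonneg _)
    (closedBall_subset_closedBall hR).eventuallyLE

theorem norm_sq_le_of_sq_eq {f g k : LCrit N} (h : ∀ᵐ x, f x ^ 2 = g x ^ 2 + k x ^ 2) :
    ‖f‖ ^ 2 ≤ ‖g‖ ^ 2 + ‖k‖ ^ 2 := by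
  have h2 : critE N / 2 * ENNReal.ofReal 2 = critE N := by
    rw [ENNReal.ofReal_ofNat, ENNReal.div_mul_cancel (by norm_num) (by norm_num)]
  have hone : 1 ≤ critE N / 2 := by
    rw [ENNReal.le_div_iff_mul_le (by norm_num) (by norm_num), one_mul, critE]
    have := ENNReal.ofReal_le_ofReal (two_lt_crit N).le
    simpa using this
  have hs : ∀ r : LCrit N, eLpNorm (fun x => r x ^ 2) (critE N / 2) volume =
      ENNReal.ofReal (‖r‖ ^ 2) := fun r => by
    have := eLpNorm_norm_rpow (μ := (volume : Measure (Eucl N))) (p := critE N / 2) r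
      (two_pos : (0 : ℝ) < 2)
    rw [h2] at this
    simp only [Real.rpow_ofNat, Real.norm_eq_abs, sq_abs] at this
    rw [this, Lp.norm_def, ENNReal.ofReal_pow ENNReal.toReal_nonneg,
      ENNReal.ofReal_toReal (Lp.eLpNorm_ne_top r)]
    simp
  have hm : ∀ r : LCrit N, AEStronglyMeasurable (fun x => r x ^ 2) volume := fun r =>
    (Lp.aestronglyMeasurable r).pow 2
  have := eLpNorm_add_le (hm g) (hm k) hone
  rw [hs, hs, ← ENNReal.ofReal_add (by positivity) (by positivity)] at this
  rw [← ENNReal.ofReal_le_ofReal_iff (by positivity), ← hs f]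
  refine le_trans (le_of_eq (eLpNorm_congr_ae ?_)) this
  filter_upwards [h] with x hx
  simpa using hx

/-- The Sobolev-type inequality `m ‖u‖² ≤ ∫ |∇u|² - ∫ V u²` holds up to errors which are
negligible along bounded weakly null sequences. -/
def Good (m : ℝ) (V : Eucl N → ℝ) : Prop :=
  ∀ ε > 0, ∃ C R : ℝ, 0 ≤ C ∧ ∀ (φ : Eucl N → ℝ) (h : IsTest φ),
    m * ‖(ofTest h).fn‖ ^ 2 ≤ ‖ofTest h‖ ^ 2 - potTerm V (ofTest h) +
      C * ballTerm R (ofTest h) + ε * ‖ofTest h‖ ^ 2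

theorem Good.of_le {m : ℝ} {V : Eucl N → ℝ} (h : ∀ (φ : Eucl N → ℝ) (h : IsTest φ),
    m * ‖(ofTest h).fn‖ ^ 2 ≤ ‖ofTest h‖ ^ 2 - potTerm V (ofTest h)) : Good m V :=
  fun ε hε => ⟨0, 0, le_rfl, fun φ hφ => (h φ hφ).trans (by
    have : 0 ≤ ε * ‖ofTest hφ‖ ^ 2 := by positivity
    linarith)⟩

theorem HardyPot.integrable_test {V : Eucl N → ℝ} (hV : HardyPot V) {φ : Eucl N → ℝ}
    (h : IsTest φ) : Integrable fun x => V x * φ x ^ 2 := by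
  refine (hV.integrable_mul_sq (ofTest h)).congr ?_
  filter_upwards [ofTest_fn h] with x hx
  rw [hx]

theorem norm_sq_cos_add_sin_le {θ : Eucl N → ℝ} (hθ : IsTest θ) :
    ∃ K R : ℝ, 0 ≤ K ∧ ∀ (φ : Eucl N → ℝ) (h : IsTest φ),
      ‖ofTest (h.cos_mul hθ)‖ ^ 2 + ‖ofTest (h.sin_mul hθ)‖ ^ 2 ≤
        ‖ofTest h‖ ^ 2 + K * ballTerm R (ofTest h) := by
  obtain ⟨K, R, hK, hb⟩ := hθ.exists_gradient_bound
  refine ⟨K, R, hK, fun φ h => ?_⟩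
  have i3 := ((hardyPot_ball (N := N) R).integrable_test h).const_mul K
  rw [ballTerm_eq_potTerm, potTerm_ofTest, ofTest_norm_sq, ofTest_norm_sq, ofTest_norm_sq,
    ← integral_add (h.cos_mul hθ).integrable_sq_gradient (h.sin_mul hθ).integrable_sq_gradient,
    ← integral_const_mul, ← integral_add h.integrable_sq_gradient i3]
  refine integral_mono ((h.cos_mul hθ).integrable_sq_gradient.add
    (h.sin_mul hθ).integrable_sq_gradient) (h.integrable_sq_gradient.add i3) fun x => ?_
  simp only
  rw [norm_sq_gradient_cos_add_sin h hθ, ← mul_assoc]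
  gcongr
  exact hb x

theorem norm_fn_sq_le_cos_add_sin {φ θ : Eucl N → ℝ} (h : IsTest φ) (hθ : IsTest θ) :
    ‖(ofTest h).fn‖ ^ 2 ≤ ‖(ofTest (h.cos_mul hθ)).fn‖ ^ 2 +
      ‖(ofTest (h.sin_mul hθ)).fn‖ ^ 2 := by
  refine norm_sq_le_of_sq_eq ?_
  filter_upwards [ofTest_fn h, ofTest_fn (h.cos_mul hθ), ofTest_fn (h.sin_mul hθ)] with x h1 h2 h3
  rw [h1, h2, h3]
  linear_combination -(φ x ^ 2) * Real.sin_sq_add_cos_sq (θ x)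

theorem ballTerm_mul_le {φ ψ : Eucl N → ℝ} (h : IsTest φ) (h' : IsTest fun x => ψ x * φ x)
    (hψ : ∀ x, |ψ x| ≤ 1) (R : ℝ) :
    ballTerm R (ofTest h') ≤ ballTerm R (ofTest h) := by
  refine integral_mono_ae (integrableOn_fn_sq R _) (integrableOn_fn_sq R _)
    (ae_restrict_of_ae ?_)
  filter_upwards [ofTest_fn h, ofTest_fn h'] with x h1 h2
  simp only [h1, h2, mul_pow]
  have : ψ x ^ 2 ≤ 1 := (sq_le_one_iff_abs_le_one _).2 (hψ x)
  nlinarith [sq_nonneg (φ x)]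

theorem exists_potTerm_cos_add_sin {V V₁ V₂ θ : Eucl N → ℝ} (hV : HardyPot V)
    (hV₁ : HardyPot V₁) (hV₂ : HardyPot V₂) (hθ : IsTest θ)
    (h₁ : PertLE V V₁ {x | Real.cos (θ x) ≠ 0}) (h₂ : PertLE V V₂ {x | Real.sin (θ x) ≠ 0}) :
    ∀ ε > 0, ∃ C R : ℝ, 0 ≤ C ∧ ∀ (φ : Eucl N → ℝ) (h : IsTest φ),
      potTerm V (ofTest h) ≤ potTerm V₁ (ofTest (h.cos_mul hθ)) +
        potTerm V₂ (ofTest (h.sin_mul hθ)) + C * ballTerm R (ofTest h) + ε * ‖ofTest h‖ ^ 2 := by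
  intro ε hε
  obtain ⟨H, hH, hHb⟩ := (hardyPot_invSq (N := N) 0).exists_potTerm_le
  have hη : 0 < ε / (H + 1) := by positivity
  obtain ⟨C₁, R₁, hC₁, hb₁⟩ := h₁ _ hη
  obtain ⟨C₂, R₂, hC₂, hb₂⟩ := h₂ _ hη
  refine ⟨C₁ + C₂, max R₁ R₂, by positivity, fun φ h => ?_⟩
  have i0 := hV.integrable_test h
  have i1 := hV₁.integrable_test (h.cos_mul hθ)
  have i2 := hV₂.integrable_test (h.sin_mul hθ)
  have i3 := ((hardyPot_ball (N := N) R₁).integrable_test h).const_mul C₁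
  have i4 := ((hardyPot_ball (N := N) R₂).integrable_test h).const_mul C₂
  have i5 := ((hardyPot_invSq (N := N) 0).integrable_test h).const_mul (ε / (H + 1))
  have key := integral_mono i0 ((((i1.add i2).add i3).add i4).add i5) fun x => by
    simp only [Pi.add_apply, sub_zero]
    set I₁ := (closedBall (0 : Eucl N) R₁).indicator (fun _ => (1 : ℝ)) x
    set I₂ := (closedBall (0 : Eucl N) R₂).indicator (fun _ => (1 : ℝ)) x
    have hI₁ : 0 ≤ I₁ := Set.indicator_nonneg (fun _ _ => zero_le_one) _
    have hI₂ : 0 ≤ I₂ := Set.indicator_nonneg (fun _ _ => zero_le_one) _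
    set D := ε / (H + 1) * (‖x‖ ^ 2)⁻¹
    set c := Real.cos (θ x) with hc
    set s := Real.sin (θ x) with hs
    have hsc : s ^ 2 + c ^ 2 = 1 := Real.sin_sq_add_cos_sq (θ x)
    have hp : 0 ≤ φ x ^ 2 := sq_nonneg _
    have hc1 : c ^ 2 ≤ 1 := by linarith [sq_nonneg s]
    have hs1 : s ^ 2 ≤ 1 := by linarith [sq_nonneg c]
    have a1 : V x * c ^ 2 ≤ V₁ x * c ^ 2 + C₁ * I₁ + D * c ^ 2 := by
      by_cases h0 : c = 0
      · rw [h0]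
        have : 0 ≤ C₁ * I₁ := by positivity
        simpa using this
      · have := mul_le_mul_of_nonneg_right (hb₁ x h0) (sq_nonneg c)
        have h2 : C₁ * I₁ * c ^ 2 ≤ C₁ * I₁ := mul_le_of_le_one_right (by positivity) hc1
        nlinarith
    have a2 : V x * s ^ 2 ≤ V₂ x * s ^ 2 + C₂ * I₂ + D * s ^ 2 := by
      by_cases h0 : s = 0
      · rw [h0]
        have : 0 ≤ C₂ * I₂ := by positivity
        simpa using this
      · have := mul_le_mul_of_nonneg_right (hb₂ x h0) (sq_nonneg s)
        have h2 : C₂ * I₂ * s ^ 2 ≤ C₂ * I₂ := mul_le_of_le_one_right (by positivity) hs1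
        nlinarith
    have a3 : V x ≤ V₁ x * c ^ 2 + V₂ x * s ^ 2 + C₁ * I₁ + C₂ * I₂ + D := by
      have e1 : V x * c ^ 2 + V x * s ^ 2 = V x := by linear_combination V x * hsc
      have e2 : D * c ^ 2 + D * s ^ 2 = D := by linear_combination D * hsc
      linarith
    have := mul_le_mul_of_nonneg_right a3 hp
    refine this.trans (le_of_eq ?_)
    ring
  have e1 := integral_add (((i1.add i2).add i3).add i4) i5
  have e2 := integral_add ((i1.add i2).add i3) i4
  have e3 := integral_add (i1.add i2) i3
  have e4 := integral_add i1 i2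
  simp only [Pi.add_def] at key e1 e2 e3 e4
  rw [e1, e2, e3, e4, integral_const_mul, integral_const_mul, integral_const_mul] at key
  simp only [← potTerm_ofTest V h, ← potTerm_ofTest V₁ (h.cos_mul hθ),
    ← potTerm_ofTest V₂ (h.sin_mul hθ), ← potTerm_ofTest _ h, ← ballTerm_eq_potTerm] at key
  have b1 : C₁ * ballTerm R₁ (ofTest h) ≤ C₁ * ballTerm (max R₁ R₂) (ofTest h) := by
    gcongr
    exact ballTerm_mono (le_max_left _ _) _
  have b2 : C₂ * ballTerm R₂ (ofTest h) ≤ C₂ * ballTerm (max R₁ R₂) (ofTest h) := by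
    gcongr
    exact ballTerm_mono (le_max_right _ _) _
  have b3 : ε / (H + 1) * potTerm (fun x : Eucl N => (‖x - 0‖ ^ 2)⁻¹) (ofTest h) ≤
      ε * ‖ofTest h‖ ^ 2 := by
    have h1 := (le_abs_self _).trans (hHb (ofTest h))
    calc _ ≤ ε / (H + 1) * (H * ‖ofTest h‖ ^ 2) := by gcongr
      _ ≤ ε / (H + 1) * ((H + 1) * ‖ofTest h‖ ^ 2) := by gcongr; linarith
      _ = _ := by field_simp
  linarith

/-- Gluing of `Good` potentials by means of the partition of unity `cos² θ + sin² θ = 1`. -/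
theorem Good.glue {m : ℝ} (hm : 0 ≤ m) {V V₁ V₂ θ : Eucl N → ℝ} (hV : HardyPot V)
    (hV₁ : HardyPot V₁) (hV₂ : HardyPot V₂) (hθ : IsTest θ)
    (h₁ : PertLE V V₁ {x | Real.cos (θ x) ≠ 0}) (h₂ : PertLE V V₂ {x | Real.sin (θ x) ≠ 0})
    (g₁ : Good m V₁) (g₂ : Good m V₂) : Good m V := by
  intro ε hε
  obtain ⟨K, R₀, hK, hb₀⟩ := norm_sq_cos_add_sin_le hθ
  obtain ⟨C₁, R₁, hC₁, hb₁⟩ := g₁ (ε / 2) (by positivity)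
  obtain ⟨C₂, R₂, hC₂, hb₂⟩ := g₂ (ε / 2) (by positivity)
  obtain ⟨C₃, R₃, hC₃, hb₃⟩ := exists_potTerm_cos_add_sin hV hV₁ hV₂ hθ h₁ h₂ (ε / 2)
    (by positivity)
  set R := max (max R₀ R₁) (max R₂ R₃) with hR
  refine ⟨(1 + ε / 2) * K + C₁ + C₂ + C₃, R, by positivity, fun φ h => ?_⟩
  have k1 := hb₁ _ (h.cos_mul hθ)
  have k2 := hb₂ _ (h.sin_mul hθ)
  have k3 := hb₃ _ h
  have k0 := hb₀ _ h
  have kf := mul_le_mul_of_nonneg_left (norm_fn_sq_le_cos_add_sin h hθ) hm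
  have m0 : ballTerm R₀ (ofTest h) ≤ ballTerm R (ofTest h) :=
    ballTerm_mono ((le_max_left _ _).trans (le_max_left _ _)) _
  have m1 : ballTerm R₁ (ofTest (h.cos_mul hθ)) ≤ ballTerm R (ofTest h) :=
    (ballTerm_mul_le h (h.cos_mul hθ) (fun x => Real.abs_cos_le_one _) R₁).trans
      (ballTerm_mono ((le_max_right _ _).trans (le_max_left _ _)) _)
  have m2 : ballTerm R₂ (ofTest (h.sin_mul hθ)) ≤ ballTerm R (ofTest h) :=
    (ballTerm_mul_le h (h.sin_mul hθ) (fun x => Real.abs_sin_le_one _) R₂).trans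
      (ballTerm_mono ((le_max_left _ _).trans (le_max_right _ _)) _)
  have m3 : ballTerm R₃ (ofTest h) ≤ ballTerm R (ofTest h) :=
    ballTerm_mono ((le_max_right _ _).trans (le_max_right _ _)) _
  have n0 := mul_le_mul_of_nonneg_left m0 hK
  have n1 := mul_le_mul_of_nonneg_left m1 hC₁
  have n2 := mul_le_mul_of_nonneg_left m2 hC₂
  have n3 := mul_le_mul_of_nonneg_left m3 hC₃
  have k0' := mul_le_mul_of_nonneg_left (k0.trans (add_le_add_right n0 _))
    (by positivity : 0 ≤ 1 + ε / 2)
  nlinarith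

section Poles

variable {k : ℕ} {h : Fin k → Sph N → ℝ} {a : Fin k → Eucl N}

theorem good_polePot {g : Sph N → ℝ} {m : ℝ} (hm : m ≤ SOne g)
    (hg : ∀ u : D12 N, potTerm (polePot g 0) u ≤ ‖u‖ ^ 2) (b : Eucl N) :
    Good m (polePot g b) := by
  refine Good.of_le fun φ hφ => ?_
  have h1 := (SOne_mul_le hg).2 (ofTest (hφ.dilate one_pos (-b)))
  rw [norm_fn_translate hφ, norm_sq_dilate hφ one_pos, potTerm_dilate g hφ one_pos] at h1
  simp only [one_pow, inv_one, mul_one, one_mul, one_smul, zero_sub, neg_neg] at h1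
  exact (mul_le_mul_of_nonneg_right hm (sq_nonneg _)).trans h1

theorem good_zero {m : ℝ} (hm : m ≤ SSob N) : Good m (fun _ : Eucl N => (0 : ℝ)) := by
  refine Good.of_le fun φ hφ => ?_
  have : potTerm (fun _ : Eucl N => (0 : ℝ)) (ofTest hφ) = 0 := by simp [potTerm]
  rw [this, sub_zero]
  exact (mul_le_mul_of_nonneg_right hm (sq_nonneg _)).trans (SSob_mul_le.2 _)

/-- The potentials of finitely many poles, cut off outside a ball. -/
def cutPot (h : Fin k → Sph N → ℝ) (a : Fin k → Eucl N) (R : ℝ) (s : Finset (Fin k)) :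
    Eucl N → ℝ :=
  (closedBall (0 : Eucl N) R).indicator fun x => ∑ i ∈ s, polePot (h i) (a i) x

theorem hardyPot_cutPot (hc : ∀ i, Continuous (h i)) (a : Fin k → Eucl N) (R : ℝ)
    (s : Finset (Fin k)) : HardyPot (cutPot h a R s) :=
  (HardyPot.sum s fun i _ => hardyPot_polePot (hc i) (a i)).indicator measurableSet_closedBall

theorem good_cutPot (hc : ∀ i, Continuous (h i)) (ha : Function.Injective a)
    (hpos : 0 < mu h a) {R : ℝ} (hR : ∀ i, ‖a i‖ + 2 ≤ R) (s : Finset (Fin k)) :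
    Good (minLevel h) (cutPot h a R s) := by
  obtain ⟨hm0, hmS, -, hmi⟩ := minLevel_props hc ha hpos
  obtain ⟨r, hr0, hr1, hr⟩ := exists_separation ha
  choose M hM0 hM using fun i => exists_polePot_bound (hc i)
  have hfar : ∀ i x, r ≤ ‖x - a i‖ → polePot (h i) (a i) x ≤ M i * (r ^ 2)⁻¹ := fun i x hx => by
    refine (le_abs_self _).trans ((hM i (a i) x).trans ?_)
    have := hM0 i
    gcongr
  induction s using Finset.induction_on with
  | empty =>
    have : cutPot h a R ∅ = fun _ => 0 := by
      ext x; simp [cutPot]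
    rw [this]
    exact good_zero hmS
  | insert i s hi ih =>
    let b : ContDiffBump (a i) := ⟨r, 2 * r, hr0, by linarith⟩
    have hb : IsTest (b : Eucl N → ℝ) := ⟨b.contDiff, b.hasCompactSupport⟩
    have hins : ∀ x ∈ closedBall (0 : Eucl N) R, cutPot h a R (insert i s) x =
        polePot (h i) (a i) x + ∑ j ∈ s, polePot (h j) (a j) x := fun x hx => by
      rw [cutPot, Set.indicator_of_mem hx, Finset.sum_insert hi]
    refine Good.glue hm0 (hardyPot_cutPot hc a R _) (hardyPot_cutPot hc a R s)
      (hardyPot_polePot (hc i) (a i)) (hb.const_mul (Real.pi / 2)) ?_ ?_ ih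
      (good_polePot (hmi i) (potTerm_pole_le hc ha hpos i) (a i))
    · have := hM0 i
      refine PertLE.of_bound (C := M i * (r ^ 2)⁻¹) (R := R) (by positivity) fun x hx => ?_
      have hxr : r ≤ ‖x - a i‖ := by
        by_contra hlt
        refine hx ?_
        rw [b.one_of_mem_closedBall (by
          rw [mem_closedBall, dist_eq_norm]; exact (not_le.1 hlt).le), mul_one]
        exact Real.cos_pi_div_two
      by_cases hxR : x ∈ closedBall (0 : Eucl N) R
      · rw [hins x hxR, Set.indicator_of_mem hxR, cutPot, Set.indicator_of_mem hxR]
        linarith [hfar i x hxr]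
      · rw [Set.indicator_of_notMem hxR, cutPot, cutPot, Set.indicator_of_notMem hxR,
          Set.indicator_of_notMem hxR]
        simp
    · refine PertLE.of_bound (C := ∑ j ∈ s, M j * (r ^ 2)⁻¹) (R := R)
        (Finset.sum_nonneg fun j _ => mul_nonneg (hM0 j) (by positivity)) fun x hx => ?_
      have hxr : ‖x - a i‖ < 2 * r := by
        by_contra hlt
        refine hx ?_
        rw [b.zero_of_le_dist (by rw [dist_eq_norm]; exact not_lt.1 hlt), mul_zero]
        exact Real.sin_zero
      have hxR : x ∈ closedBall (0 : Eucl N) R := by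
        rw [mem_closedBall_zero_iff]
        have h1 : ‖x‖ ≤ ‖x - a i‖ + ‖a i‖ := by
          have := norm_add_le (x - a i) (a i)
          rwa [sub_add_cancel] at this
        linarith [hR i]
      rw [hins x hxR, Set.indicator_of_mem hxR, mul_one]
      gcongr with j hj
      refine hfar j x ?_
      have hij : i ≠ j := fun e => hi (e ▸ hj)
      have h1 := hr i j hij
      have h2 : ‖a i - a j‖ ≤ ‖x - a i‖ + ‖x - a j‖ := by
        have := norm_sub_le (x - a j) (x - a i)
        rw [sub_sub_sub_cancel_left] at this
        linarith
      linarith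

theorem good_totalPot (hc : ∀ i, Continuous (h i)) (ha : Function.Injective a)
    (hpos : 0 < mu h a) : Good (minLevel h) (totalPot h a) := by
  obtain ⟨hm0, -, hmI, -⟩ := minLevel_props hc ha hpos
  have hcs : Continuous (∑ j, h j) := by
    have := continuous_finsetSum Finset.univ fun i _ => hc i
    convert this using 1
    ext x
    simp
  set R := ∑ i, ‖a i‖ + 1 with hR
  have hRi : ∀ i, ‖a i‖ + 1 ≤ R := fun i => by
    have := Finset.single_le_sum (f := fun i => ‖a i‖) (fun j _ => norm_nonneg _)
      (Finset.mem_univ i)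
    linarith
  have hR1 : 1 ≤ R := by
    have : 0 ≤ ∑ i, ‖a i‖ := Finset.sum_nonneg fun i _ => norm_nonneg _
    linarith
  obtain ⟨χ, hχ, hχ1, -, hχ0⟩ := exists_test_bump (N := N) R
  rw [abs_of_nonneg (by linarith)] at hχ0
  refine Good.glue hm0 (hardyPot_totalPot hc a) (hardyPot_polePot hcs 0)
    (hardyPot_cutPot hc a (R + 2) Finset.univ) (hχ.const_mul (Real.pi / 2)) ?_ ?_
    (good_polePot hmI (potTerm_infty_le hc hpos) 0)
    (good_cutPot hc ha hpos (fun i => by linarith [hRi i]) _)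
  · intro ε hε
    obtain ⟨C, R', hC, hb⟩ := pertLE_infty hc hRi hR1 ε hε
    refine ⟨C, R', hC, fun x hx => hb x ?_⟩
    by_contra hlt
    refine hx ?_
    rw [hχ1 x (not_le.1 hlt).le, mul_one]
    exact Real.cos_pi_div_two
  · refine PertLE.of_bound (C := 0) (R := 0) le_rfl fun x hx => ?_
    have hxR : x ∈ closedBall (0 : Eucl N) (R + 2) := by
      rw [mem_closedBall_zero_iff]
      by_contra hlt
      refine hx ?_
      rw [hχ0 x (not_le.1 hlt).le, mul_zero]
      exact Real.sin_zero
    rw [cutPot, Set.indicator_of_mem hxR]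
    simp [totalPot]

/-- The localized inequality on `𝒟^{1,2}`. -/
theorem exists_minLevel_mul_le (hc : ∀ i, Continuous (h i)) (ha : Function.Injective a)
    (hpos : 0 < mu h a) {ε : ℝ} (hε : 0 < ε) : ∃ C R : ℝ, 0 ≤ C ∧ ∀ u : D12 N,
      minLevel h * ‖u.fn‖ ^ 2 ≤ Q h a u + C * ballTerm R u + ε * ‖u‖ ^ 2 := by
  obtain ⟨C, R, hC, hb⟩ := good_totalPot hc ha hpos ε hε
  refine ⟨C, R, hC, fun u => ?_⟩
  simp only [Q_eq hc]
  refine D12.induction_test (P := fun u => minLevel h * ‖u.fn‖ ^ 2 ≤ ‖u‖ ^ 2 -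
    potTerm (totalPot h a) u + C * ballTerm R u + ε * ‖u‖ ^ 2) (isClosed_le ?_ ?_) hb u
  · exact (((fnL N).continuous.norm).pow 2).const_mul _
  · have h1 := (hardyPot_totalPot hc a).continuous_potTerm
    have h2 : Continuous (ballTerm (N := N) R) := by
      rw [ballTerm_eq_potTerm]
      exact (hardyPot_ball R).continuous_potTerm
    fun_prop

end Poles

end Localization

section Compactness

variable {N : ℕ} [hN : Fact (3 ≤ N)]

theorem exists_integral_rpow_mul_test_le {φ : Eucl N → ℝ} (hφ : IsTest φ) {A : ℝ} {δ : ℝ}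
    (hδ : 0 < δ) : ∃ C R : ℝ, 0 ≤ C ∧ ∀ (F : LCrit N) (w : D12 N), ‖F‖ ≤ A → ‖w.fn‖ ≤ A →
      ∫ x, |F x| ^ (crit N - 2) * |(ofTest hφ).fn x| * |w.fn x| ≤ δ + C * ballTerm R w := by
  have hp := two_lt_crit N
  obtain ⟨R, -, hR⟩ := hφ.exists_support_bound
  obtain ⟨M, hM⟩ := hφ.cpt.exists_bound_of_continuous hφ.continuous
  have hM0 : 0 ≤ M := (norm_nonneg _).trans (hM 0)
  set vol := (volume (closedBall (0 : Eucl N) R)).toReal with hvol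
  set D := M * (|A| ^ crit N + vol + |A| ^ crit N) + 1 with hD
  have hD0 : 0 < D := by positivity
  obtain ⟨C, hC, hb⟩ := exists_rpow_mul_le hp (div_pos hδ hD0)
  refine ⟨M * C, R, by positivity, fun F w hF hw => ?_⟩
  set S := closedBall (0 : Eucl N) R with hS
  set η := δ / D with hη
  have hη0 : 0 < η := by positivity
  have iF := integrable_rpow_crit F
  have iw := integrable_rpow_crit w.fn
  have j1 : IntegrableOn (fun x => η * |F x| ^ crit N) S := (iF.const_mul η).integrableOn
  have j0 : IntegrableOn (fun _ : Eucl N => (1 : ℝ)) S :=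
    integrableOn_const measure_closedBall_lt_top.ne
  have j2 : IntegrableOn (fun x => η * (1 + |w.fn x| ^ crit N)) S :=
    (j0.add iw.integrableOn).const_mul η
  have j3 : IntegrableOn (fun x => C * w.fn x ^ 2) S := (integrableOn_fn_sq R w).const_mul C
  have j : IntegrableOn (fun x => η * |F x| ^ crit N + η * (1 + |w.fn x| ^ crit N) +
      C * w.fn x ^ 2) S := (j1.add j2).add j3
  have pw : ∀ᵐ x, |F x| ^ (crit N - 2) * |(ofTest hφ).fn x| * |w.fn x| ≤
      S.indicator (fun x => M * (η * |F x| ^ crit N + η * (1 + |w.fn x| ^ crit N) +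
        C * w.fn x ^ 2)) x := by
    filter_upwards [ofTest_fn hφ] with x hx
    rw [hx]
    by_cases h0 : φ x = 0
    · rw [h0, abs_zero, mul_zero, zero_mul]
      exact Set.indicator_nonneg (fun y _ => by positivity) _
    · have hxS : x ∈ S := by
        rw [hS, mem_closedBall_zero_iff]
        exact hR x h0
      rw [Set.indicator_of_mem hxS]
      have h1 := hb |F x| |w.fn x| (abs_nonneg _) (abs_nonneg _)
      rw [sq_abs] at h1
      calc |F x| ^ (crit N - 2) * |φ x| * |w.fn x| = |φ x| * (|F x| ^ (crit N - 2) * |w.fn x|) := by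
            ring
        _ ≤ M * _ := mul_le_mul (hM x) h1 (by positivity) hM0
  have hI := integral_mono_ae (integrable_rpow_mul_mul F (ofTest hφ).fn w.fn)
    ((integrable_indicator_iff measurableSet_closedBall).2 (j.const_mul M)) pw
  refine hI.trans ?_
  rw [integral_indicator measurableSet_closedBall, integral_const_mul]
  have e1 := integral_add (j1.add j2) j3
  have e2 := integral_add j1 j2
  simp only [Pi.add_def] at e1 e2
  rw [e1, e2, integral_const_mul, integral_const_mul, integral_const_mul]
  have e3 : ∫ x in S, (1 + |w.fn x| ^ crit N) = vol + ∫ x in S, |w.fn x| ^ crit N := by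
    rw [integral_add j0 iw.integrableOn]
    simp [hvol, Measure.real]
  rw [e3]
  have b1 : ∫ x in S, |F x| ^ crit N ≤ |A| ^ crit N := by
    refine (setIntegral_le_integral iF (Eventually.of_forall fun x => by positivity)).trans ?_
    rw [← norm_rpow_crit]
    exact Real.rpow_le_rpow (norm_nonneg _) (hF.trans (le_abs_self A)) crit_pos.le
  have b2 : ∫ x in S, |w.fn x| ^ crit N ≤ |A| ^ crit N := by
    refine (setIntegral_le_integral iw (Eventually.of_forall fun x => by positivity)).trans ?_
    rw [← norm_rpow_crit]
    exact Real.rpow_le_rpow (norm_nonneg _) (hw.trans (le_abs_self A)) crit_pos.le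
  have b3 : ∫ x in S, w.fn x ^ 2 = ballTerm R w := rfl
  rw [b3]
  have hηD : η * (M * (|A| ^ crit N + vol + |A| ^ crit N)) ≤ δ := by
    have : η * D = δ := div_mul_cancel₀ δ hD0.ne'
    nlinarith
  calc M * (η * (∫ x in S, |F x| ^ crit N) + η * (vol + ∫ x in S, |w.fn x| ^ crit N) +
        C * ballTerm R w)
      ≤ M * (η * |A| ^ crit N + η * (vol + |A| ^ crit N) + C * ballTerm R w) := by gcongr
    _ = η * (M * (|A| ^ crit N + vol + |A| ^ crit N)) + M * C * ballTerm R w := by ring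
    _ ≤ _ := by gcongr

theorem tendsto_integral_rpow_mul_mul (u₀ : D12 N) {F : ℕ → LCrit N} {w : ℕ → D12 N} {A : ℝ}
    (hF : ∀ n, ‖F n‖ ≤ A) (hw : ∀ n, ‖(w n).fn‖ ≤ A)
    (hball : ∀ R, Tendsto (fun n => ballTerm R (w n)) atTop (𝓝 0)) :
    Tendsto (fun n => ∫ x, |F n x| ^ (crit N - 2) * |u₀.fn x| * |(w n).fn x|) atTop (𝓝 0) := by
  have hp := two_lt_crit N
  have hA : 0 ≤ A := (norm_nonneg _).trans (hF 0)
  obtain ⟨S, hS⟩ := exists_sobolev N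
  rw [Metric.tendsto_atTop]
  intro δ hδ
  set D := 3 * (A ^ (crit N - 2) * |S| * A) + 1 with hD
  have hD0 : 0 < D := by positivity
  obtain ⟨φ, hφ, hφn⟩ := exists_test_near u₀ (div_pos (by positivity : 0 < δ / 3) hD0)
  obtain ⟨C, R, hC, hb⟩ := exists_integral_rpow_mul_test_le hφ (A := A)
    (by positivity : 0 < δ / 3)
  have hlim : Tendsto (fun n => C * ballTerm R (w n)) atTop (𝓝 0) := by
    simpa using (hball R).const_mul C
  obtain ⟨n₀, hn₀⟩ := eventually_atTop.1
    (hlim.eventually_lt_const (by positivity : 0 < δ / 3))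
  refine ⟨n₀, fun n hn => ?_⟩
  rw [Real.dist_eq, sub_zero, abs_of_nonneg (integral_nonneg fun x => by positivity)]
  have i1 := integrable_rpow_mul_mul (F n) (u₀ - ofTest hφ).fn (w n).fn
  have i2 := integrable_rpow_mul_mul (F n) (ofTest hφ).fn (w n).fn
  have h1 : ∫ x, |F n x| ^ (crit N - 2) * |u₀.fn x| * |(w n).fn x| ≤
      (∫ x, |F n x| ^ (crit N - 2) * |(u₀ - ofTest hφ).fn x| * |(w n).fn x|) +
      ∫ x, |F n x| ^ (crit N - 2) * |(ofTest hφ).fn x| * |(w n).fn x| := by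
    rw [← integral_add i1 i2]
    refine integral_mono_ae (integrable_rpow_mul_mul _ _ _) (i1.add i2) ?_
    filter_upwards [fn_sub_ae u₀ (ofTest hφ)] with x hx
    rw [hx, ← add_mul, ← mul_add]
    gcongr
    have := abs_add_le (u₀.fn x - (ofTest hφ).fn x) ((ofTest hφ).fn x)
    rwa [sub_add_cancel] at this
  have h2 := integral_rpow_mul_mul_le (F n) (u₀ - ofTest hφ).fn (w n).fn
  have h3 := hb (F n) (w n) (hF n) (hw n)
  have h4 : ‖(u₀ - ofTest hφ).fn‖ ≤ |S| * (δ / 3 / D) := by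
    refine (hS _).trans ?_
    rw [← D12.norm_eq]
    calc S * ‖u₀ - ofTest hφ‖ ≤ |S| * ‖u₀ - ofTest hφ‖ := by gcongr; exact le_abs_self S
      _ ≤ _ := by gcongr
  have h5 : 3 * (‖F n‖ ^ (crit N - 2) * ‖(u₀ - ofTest hφ).fn‖ * ‖(w n).fn‖) ≤ δ / 3 := by
    have hpw : ‖F n‖ ^ (crit N - 2) ≤ A ^ (crit N - 2) :=
      Real.rpow_le_rpow (norm_nonneg _) (hF n) (by linarith)
    calc 3 * (‖F n‖ ^ (crit N - 2) * ‖(u₀ - ofTest hφ).fn‖ * ‖(w n).fn‖)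
        ≤ 3 * (A ^ (crit N - 2) * (|S| * (δ / 3 / D)) * A) := by
          gcongr
          exact hw n
      _ = (D - 1) * (δ / 3 / D) := by rw [hD]; ring
      _ ≤ D * (δ / 3 / D) := by gcongr; linarith
      _ = δ / 3 := by field_simp
  linarith [hn₀ n hn]

/-- Splitting of the nonlinear term along weakly convergent sequences. -/
theorem tendsto_dualPow_sub_critTerm (u₀ : D12 N) {w : ℕ → D12 N} {K : ℝ} (hK : ∀ n, ‖w n‖ ≤ K)
    (hball : ∀ R, Tendsto (fun n => ballTerm R (w n)) atTop (𝓝 0)) :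
    Tendsto (fun n => (∫ x, dualPow (crit N) ((u₀ + w n).fn x) * (w n).fn x) - critTerm (w n))
      atTop (𝓝 0) := by
  have hp := two_lt_crit N
  obtain ⟨S, hS⟩ := exists_sobolev N
  have hK0 : 0 ≤ K := (norm_nonneg _).trans (hK 0)
  have hS' : ∀ u : D12 N, ‖u.fn‖ ≤ |S| * ‖u‖ := fun u =>
    (hS u).trans (by rw [← D12.norm_eq]; gcongr; exact le_abs_self S)
  have hw : ∀ n, ‖(w n).fn‖ ≤ |S| * K := fun n => (hS' _).trans (by gcongr; exact hK n)
  let F : ℕ → LCrit N := fun n => |(u₀ + w n).fn| + |(w n).fn|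
  have hFae : ∀ n, ∀ᵐ x, |F n x| = |(u₀ + w n).fn x| + |(w n).fn x| := fun n => by
    filter_upwards [Lp.coeFn_add |(u₀ + w n).fn| |(w n).fn|, Lp.coeFn_abs (u₀ + w n).fn,
      Lp.coeFn_abs (w n).fn] with x h1 h2 h3
    rw [h1, Pi.add_apply, h2, h3, abs_of_nonneg (by positivity)]
  have hF : ∀ n, ‖F n‖ ≤ |S| * (‖u₀‖ + K) + |S| * K := fun n => by
    refine (norm_add_le _ _).trans ?_
    rw [norm_abs_eq_norm, norm_abs_eq_norm]
    refine add_le_add ((hS' _).trans ?_) (hw n)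
    gcongr
    exact (norm_add_le _ _).trans (by gcongr; exact hK n)
  have hlim := tendsto_integral_rpow_mul_mul u₀ hF (fun n => (hw n).trans
    (by have : 0 ≤ |S| * (‖u₀‖ + K) := by positivity
        linarith)) hball
  have hlim' := hlim.const_mul (crit N - 1)
  rw [mul_zero] at hlim'
  refine squeeze_zero_norm (fun n => ?_) hlim'
  have i1 := integrable_dualPow_mul (u₀ + w n).fn (w n).fn
  have i2 := integrable_rpow_crit (w n).fn
  rw [critTerm, ← integral_sub i1 i2, ← integral_const_mul]
  refine norm_integral_le_of_norm_le
    ((integrable_rpow_mul_mul (F n) u₀.fn (w n).fn).const_mul (crit N - 1)) ?_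
  filter_upwards [hFae n, fn_add_ae u₀ (w n)] with x h1 h2
  rw [h1, ← dualPow_mul_self hp ((w n).fn x), ← sub_mul, norm_mul, Real.norm_eq_abs,
    Real.norm_eq_abs]
  have h3 := dualPow_sub_le hp ((u₀ + w n).fn x) ((w n).fn x)
  have h4 : (u₀ + w n).fn x - (w n).fn x = u₀.fn x := by rw [h2]; ring
  rw [h4] at h3
  calc _ ≤ ((crit N - 1) * (|(u₀ + w n).fn x| + |(w n).fn x|) ^ (crit N - 2) * |u₀.fn x|) *
        |(w n).fn x| := by gcongr
    _ = _ := by ring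

theorem le_div_add_one_of_sq_le {α A D t : ℝ} (hα : 0 < α) (hA : 0 ≤ A) (hD : 0 ≤ D)
    (h : α * t ^ 2 ≤ A + D * t) : t ≤ (A + D) / α + 1 := by
  have h0 : 0 ≤ (A + D) / α := by positivity
  rcases le_total t 1 with ht | ht
  · linarith
  · have : t ≤ (A + D) / α := by
      rw [le_div_iff₀ hα]
      nlinarith [mul_le_mul_of_nonneg_left ht hA]
    linarith

section PalaisSmale

variable {k : ℕ} {h : Fin k → Sph N → ℝ} {a : Fin k → Eucl N} {u : ℕ → D12 N} {c : ℝ}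

theorem integral_dualPow_self (u : D12 N) :
    ∫ x, dualPow (crit N) (u.fn x) * u.fn x = critTerm u := by
  simp only [dualPow_mul_self (two_lt_crit N)]
  rfl

theorem J_sub_fderiv (hc : ∀ i, Continuous (h i)) (u : D12 N) :
    J h a u - (crit N)⁻¹ * fderiv ℝ (J h a) u u = (N : ℝ)⁻¹ * Q h a u := by
  obtain ⟨B, hs, hB⟩ := (hardyPot_totalPot hc a).exists_form
  have hB' : ∀ u, B u u = Q h a u := fun u => by rw [hB, Q_eq hc]
  rw [fderiv_J_apply hs hB', integral_dualPow_self, hB', J]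
  have h1 : Q h a u = dirichlet u - ∑ i, poleTerm (h i) (a i) u := rfl
  have h2 := crit_inv N
  rw [div_eq_mul_inv]
  linear_combination (-1 / 2 : ℝ) * h1 - Q h a u * h2

theorem IsPalaisSmale.bounded (hc : ∀ i, Continuous (h i)) (hpos : 0 < mu h a)
    (hu : IsPalaisSmale h a u c) : ∃ K, ∀ n, ‖u n‖ ≤ K := by
  obtain ⟨A, hA⟩ := hu.1.norm.bddAbove_range
  obtain ⟨D, hD⟩ := hu.2.norm.bddAbove_range
  have hN0 : (0 : ℝ) < N := by linarith [three_le_real (N := N)]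
  have hcr := crit_pos (N := N)
  refine ⟨(|A| + (crit N)⁻¹ * |D|) / ((N : ℝ)⁻¹ * mu h a) + 1, fun n =>
    le_div_add_one_of_sq_le (by positivity) (abs_nonneg A) (by positivity) ?_⟩
  have h1 := J_sub_fderiv (a := a) hc (u n)
  have h2 := mul_le_mul_of_nonneg_left (mu_mul_le_Q hpos (u n)) (by positivity : 0 ≤ (N : ℝ)⁻¹)
  have h3 : J h a (u n) ≤ |A| :=
    (le_abs_self _).trans ((hA ⟨n, rfl⟩).trans (le_abs_self A))
  have h4 : -(fderiv ℝ (J h a) (u n) (u n)) ≤ |D| * ‖u n‖ := by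
    refine (neg_le_abs _).trans (((fderiv ℝ (J h a) (u n)).le_opNorm (u n)).trans ?_)
    gcongr
    exact (hD ⟨n, rfl⟩).trans (le_abs_self D)
  have h5 := mul_le_mul_of_nonneg_left h4 (by positivity : 0 ≤ (crit N)⁻¹)
  nlinarith

theorem IsPalaisSmale.tendsto_fderiv_apply (hu : IsPalaisSmale h a u c) {s : ℕ → ℕ}
    (hs : StrictMono s) {v : ℕ → D12 N} {K : ℝ} (hv : ∀ n, ‖v n‖ ≤ K) :
    Tendsto (fun n => fderiv ℝ (J h a) (u (s n)) (v n)) atTop (𝓝 0) := by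
  have h1 := (hu.2.norm.comp hs.tendsto_atTop).mul_const K
  rw [norm_zero, zero_mul] at h1
  refine squeeze_zero_norm (fun n => ?_) h1
  refine ((fderiv ℝ (J h a) (u (s n))).le_opNorm (v n)).trans ?_
  simp only [Function.comp_apply]
  gcongr
  exact hv n

variable (N) in
theorem two_div_crit : 2 / crit N * ((N : ℝ) / 2) = N / 2 - 1 := by
  have := crit_inv N
  have hN0 : (N : ℝ) ≠ 0 := by linarith [three_le_real (N := N)]
  rw [div_eq_mul_inv, this]
  field_simp

theorem rpow_level_le {m Λ l : ℝ} (hm : 0 ≤ m) (hΛ : 0 < Λ) (hl : 0 < l)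
    (h : m * (l / Λ) ^ (2 / crit N) ≤ l) :
    Λ ^ (1 - (N : ℝ) / 2) * m ^ ((N : ℝ) / 2) ≤ l := by
  have hN3 : (3 : ℝ) ≤ N := three_le_real
  have hy : 0 < l / Λ := by positivity
  have h1 := Real.rpow_le_rpow (by positivity) h (by positivity : (0 : ℝ) ≤ N / 2)
  rw [Real.mul_rpow hm (by positivity), ← Real.rpow_mul hy.le, two_div_crit,
    Real.div_rpow hl.le hΛ.le] at h1
  have e1 : l ^ ((N : ℝ) / 2) = l ^ ((N : ℝ) / 2 - 1) * l := by
    rw [← Real.rpow_add_one hl.ne', sub_add_cancel]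
  have e2 : Λ ^ (1 - (N : ℝ) / 2) = (Λ ^ ((N : ℝ) / 2 - 1))⁻¹ := by
    rw [← Real.rpow_neg hΛ.le, neg_sub]
  have hl' : 0 < l ^ ((N : ℝ) / 2 - 1) := by positivity
  have hΛ' : 0 < Λ ^ ((N : ℝ) / 2 - 1) := by positivity
  rw [e2]
  rw [e1, mul_div_assoc', div_le_iff₀ hΛ'] at h1
  rw [inv_mul_le_iff₀ hΛ']
  nlinarith

theorem exists_convergent_subseq (hc : ∀ i, Continuous (h i)) (ha : Function.Injective a)
    (hpos : 0 < mu h a) (hu : IsPalaisSmale h a u c)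
    (hlev : c < 1 / (N : ℝ) * SMulti h a ^ (1 - (N : ℝ) / 2) * minLevel h ^ ((N : ℝ) / 2)) :
    ∃ s : ℕ → ℕ, StrictMono s ∧ ∃ u₀ : D12 N, Tendsto (fun n => u (s n)) atTop (𝓝 u₀) := by
  have hN3 : (3 : ℝ) ≤ N := three_le_real
  obtain ⟨K, hK⟩ := hu.bounded hc hpos
  obtain ⟨s, u₀, hs, hweak⟩ := exists_weak_subseq u K hK
  refine ⟨s, hs, u₀, ?_⟩
  obtain ⟨B, hsym, hB⟩ := (hardyPot_totalPot hc a).exists_form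
  have hBQ : ∀ u, B u u = Q h a u := fun u => by rw [hB, Q_eq hc]
  set w : ℕ → D12 N := fun n => u (s n) - u₀ with hw
  have hwK : ∀ n, ‖w n‖ ≤ K + ‖u₀‖ := fun n =>
    (norm_sub_le _ _).trans (by gcongr; exact hK _)
  have hw0 : ∀ f : D12 N →L[ℝ] ℝ, Tendsto (fun n => f (w n)) atTop (𝓝 0) := fun f => by
    simpa [hw] using (hweak f).sub_const (f u₀)
  have hball := tendsto_ballTerm w hwK hw0
  have hQu : Tendsto (fun n => Q h a (u (s n))) atTop (𝓝 (N * c)) := by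
    have h1 := (hu.1.comp hs.tendsto_atTop).sub
      ((hu.tendsto_fderiv_apply hs (v := fun n => u (s n)) fun n => hK _).const_mul (crit N)⁻¹)
    have h2 := h1.const_mul (N : ℝ)
    rw [mul_zero, sub_zero] at h2
    refine h2.congr fun n => ?_
    simp only [Function.comp_apply]
    rw [J_sub_fderiv hc, mul_inv_cancel_left₀ (by linarith)]
  set l := (N : ℝ) * c - Q h a u₀ with hl
  have hQw : Tendsto (fun n => Q h a (w n)) atTop (𝓝 l) := by
    have h1 := (hQu.sub ((hweak (B u₀)).const_mul 2)).add_const (Q h a u₀)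
    rw [hBQ] at h1
    have e : (N : ℝ) * c - 2 * Q h a u₀ + Q h a u₀ = l := by rw [hl]; ring
    rw [e] at h1
    refine h1.congr fun n => ?_
    rw [← hBQ (w n), ← hBQ u₀, ← hBQ (u (s n))]
    simp only [hw, map_sub, sub_apply]
    rw [hsym (u (s n)) u₀]
    ring
  have hl0 : 0 ≤ l := ge_of_tendsto' hQw fun n => Q_nonneg hpos (w n)
  have hlc : l ≤ N * c := by linarith [Q_nonneg hpos u₀]
  have hΛ := SMulti_pos hpos
  set Λ := SMulti h a with hΛdef
  have hcrit : Tendsto (fun n => critTerm (w n)) atTop (𝓝 (l / Λ)) := by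
    have h1 := hu.tendsto_fderiv_apply hs hwK
    have h2 := tendsto_dualPow_sub_critTerm u₀ hwK hball
    have h3 := (((hQw.add (hw0 (B u₀))).sub h1).div_const Λ).sub h2
    simp only [add_zero, sub_zero] at h3
    refine h3.congr fun n => ?_
    have e : u (s n) = u₀ + w n := by simp [hw]
    rw [fderiv_J_apply hsym hBQ, ← hBQ (w n), ← hΛdef, e, map_add, add_apply]
    field_simp
    ring
  have hnorm : Tendsto (fun n => ‖(w n).fn‖ ^ 2) atTop (𝓝 ((l / Λ) ^ (2 / crit N))) := by
    have h1 := hcrit.rpow_const (p := 2 / crit N)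
      (Or.inr (div_nonneg zero_le_two crit_pos.le))
    simpa only [critTerm_rpow] using h1
  have hm := (minLevel_props hc ha hpos).1
  have hkey : minLevel h * (l / Λ) ^ (2 / crit N) ≤ l := by
    refine le_of_forall_pos_le_add fun ε hε => ?_
    have hε' : 0 < ε / ((K + ‖u₀‖) ^ 2 + 1) := by positivity
    obtain ⟨C, R, hC, hb⟩ := exists_minLevel_mul_le hc ha hpos hε'
    have h1 := (hQw.add ((hball R).const_mul C)).add_const ε
    rw [mul_zero, add_zero] at h1
    refine le_of_tendsto_of_tendsto' (hnorm.const_mul (minLevel h)) h1 fun n => ?_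
    refine (hb (w n)).trans ?_
    gcongr
    calc ε / ((K + ‖u₀‖) ^ 2 + 1) * ‖w n‖ ^ 2
        ≤ ε / ((K + ‖u₀‖) ^ 2 + 1) * ((K + ‖u₀‖) ^ 2 + 1) := by
          gcongr
          have := pow_le_pow_left₀ (norm_nonneg _) (hwK n) 2
          linarith
      _ = ε := div_mul_cancel₀ _ (by positivity)
  have hlz : l = 0 := by
    by_contra hne
    have h1 := rpow_level_le hm hΛ (lt_of_le_of_ne hl0 (Ne.symm hne)) hkey
    have hN0 : (0 : ℝ) < N := by linarith
    rw [mul_assoc, one_div, ← div_eq_inv_mul, lt_div_iff₀ hN0] at hlev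
    linarith
  rw [hlz] at hQw
  have hsq : Tendsto (fun n => ‖w n‖ ^ 2) atTop (𝓝 0) := by
    have h1 := hQw.div_const (mu h a)
    rw [zero_div] at h1
    refine squeeze_zero (fun n => sq_nonneg _) (fun n => ?_) h1
    rw [le_div_iff₀ hpos, mul_comm]
    exact mu_mul_le_Q hpos (w n)
  rw [tendsto_iff_norm_sub_tendsto_zero]
  have := hsq.sqrt
  simpa [Real.sqrt_sq (norm_nonneg _)] using this

end PalaisSmale

end Compactness

end MultiSing

end

theorem mainTheorem4 {N : ℕ} [Fact (3 ≤ N)] {k : ℕ}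
    (h : Fin k → MultiSing.Sph N → ℝ) (hh : ∀ i, ContMDiff (𝓡 (N - 1)) 𝓘(ℝ, ℝ) 1 (h i))
    (a : Fin k → MultiSing.Eucl N) (ha : Function.Injective a)
    (hpos : 0 < MultiSing.mu h a)
    (u : ℕ → MultiSing.D12 N) (c : ℝ) (hu : MultiSing.IsPalaisSmale h a u c)
    (hc : c < 1 / (N : ℝ) * MultiSing.SMulti h a ^ (1 - (N : ℝ) / 2)
      * MultiSing.minLevel h ^ ((N : ℝ) / 2)) :
    ∃ s : ℕ → ℕ, StrictMono s ∧
      ∃ u₀ : MultiSing.D12 N, Tendsto (fun n => u (s n)) atTop (𝓝 u₀) :=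
  MultiSing.exists_convergent_subseq (fun i => (hh i).continuous) ha hpos hu hc
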